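/- **Setting.** Let $q_0>0$, $|q_\pm|=q_0$, and let $q(x,t)$ be a classical solution of $iq_t+q_{xx}-i(|q|^2q)_x=0$ on $\mathbb R^2$ ($C^2$ in $x$, differentiable in $t$) with $q\to q_\pm$ as $x\to\pm\infty$, $(1+|x|)(q-q_\pm)\in L^1(\mathbb R^\pm)$ and $q_x\in L^1(\mathbb R)$ for every $t$. Put $\sigma_3=\mathrm{diag}(1,-1)$, $Q=\begin{pmatrix}0&q\\-q^*&0\end{pmatrix}$, $Q_\pm=\begin{pmatrix}0&q_\pm\\-q_\pm^*&0\end{pmatrix}$, $E_\pm(z)=I+\frac iz\sigma_3Q_\pm$, $$k=\tfrac12\big(z-\tfrac{q_0^2}{z}\big),\quad \lambda=\tfrac12\big(z+\tfrac{q_0^2}{z}\big),\quad \theta(x,t;z)=k\lambda\,[x-(2k^2-q_0^2)t],$$ $\Sigma=(\mathbb R\cup i\mathbb R)\setminus\{0\}$, $D^\pm=\{z:\pm\,\mathrm{Re}\,z\,\mathrm{Im}\,z>0\}$; $\Sigma$ is oriented with $D^+$ on its left. For $z\in\Sigma$ let $\Phi_\pm$ be the Jost solutions: $\Phi_x=(ik^2\sigma_3+kQ)\Phi$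 and $\Phi_\pm=E_\pm e^{i\theta\sigma_3}+o(1)$ as $x\to\pm\infty$. Their columns $\Phi_{+1},\Phi_{-2}$ (resp. $\Phi_{-1},\Phi_{+2}$) are extended analytically to $D^+$ (resp. $D^-$), continuously up to $\Sigma$. Let $\mu_\pm=\Phi_\pm e^{-i\theta\sigma_3}$. The scattering matrix $S(z)=(s_{ij}(z))$, independent of $x,t$, is defined by $\Phi_+=\Phi_-S$ on $\Sigma\setminus\{\pm iq_0\}$; $s_{11}$ (resp. $s_{22}$) is extended analytically to $D^+$ (resp. $D^-$), continuously up to $\Sigma\setminus\{\pm iq_0\}$. Put $\rho=s_{21}/s_{11}$, $\tilde\rho=s_{12}/s_{22}$. Assume that there are no spectral singularities: $s_{11}s_{22}\ne0$ on $\Sigma\setminus\{\pm iq_0\}$, and $1/s_{11}$, $1/s_{22}$ have limits at $\pm iq_0$ from $D^+$, $D^-$ respectively. Assume that the zeros of $s_{11}$ in $\{\mathrm{Re}\,z>0,\mathrm{Im}\,z>0,|z|>q_0\}$ are $N_1$ distinct points $z_n$, those in $\{\mathrm{Re}\,z>0,\mathrm{Im}\,z>0,|z|=q_0\}$ are $N_2$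 distinct points $w_m$, and that all of these are double zeros ($s_{11}=s_{11}'=0\neq s_{11}''$). Let $$Z=\{\pm z_n,\pm z_n^*,\pm q_0^2/z_n,\pm q_0^2/z_n^*\}_{n=1}^{N_1}\cup\{\pm w_m,\pm w_m^*\}_{m=1}^{N_2}.$$ For $z_0\in Z\cap D^+$ let $b[z_0]\neq0$ and $d[z_0]$ be the constants (independent of $x,t$) with $\Phi_{+1}(z_0)=b[z_0]\Phi_{-2}(z_0)$ and $\Phi_{+1}'(z_0)-b[z_0]\Phi_{-2}'(z_0)=d[z_0]\Phi_{-2}(z_0)$, and put $A[z_0]=2b[z_0]/s_{11}''(z_0)$, $B[z_0]=\frac{d[z_0]}{b[z_0]}-\frac{s_{11}'''(z_0)}{3s_{11}''(z_0)}$; for $z_0\in Z\cap D^-$ use instead $\Phi_{+2},\Phi_{-1},s_{22}$ in place of $\Phi_{+1},\Phi_{-2},s_{11}$. Here $'=\partial_z$. Let $\eta_1,\dots,\eta_{4N_1+2N_2}$ be, in this order, $z_n$, $-z_n$, $q_0^2/z_n^*$, $-q_0^2/z_n^*$ ($n=1,\dots,N_1$ in each block), $w_m$, $-w_m$ ($m=1,\dots,N_2$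 in each block), and $\widehat\eta_n=-q_0^2/\eta_n$. Let $v_-(x,t)=\frac12\int_{-\infty}^x(|q(y,t)|^2-q_0^2)\,dy$. Let $$M=\Big(\frac{\mu_{+1}}{s_{11}},\mu_{-2}\Big)\ (z\in D^+),\qquad M=\Big(\mu_{-1},\frac{\mu_{+2}}{s_{22}}\Big)\ (z\in D^-),$$ let $M^+$ be the boundary value of $M$ on $\Sigma$ from $D^+$, and $J=e^{i\theta\sigma_3}\begin{pmatrix}0&-\tilde\rho\\ \rho&\rho\tilde\rho\end{pmatrix}e^{-i\theta\sigma_3}$. **Proposition (solution of the Riemann–Hilbert problem with double poles, NZBCs).** For all $x,t$, the boundary value $M^+$ exists on $\Sigma$, the integrals below converge absolutely, and for $z\in(D^+\cup D^-)\setminus Z$ $$M(x,t;z)=e^{iv_-\sigma_3}\Big(I+\frac iz\sigma_3Q_-\Big)+\frac1{2\pi i}\int_\Sigma\frac{(M^+J)(\zeta)}{\zeta-z}\,d\zeta$$ $$+\sum_{n=1}^{4N_1+2N_2}\Big(C_n(z)\Big[\mu_{-2}'(\eta_n)+\Big(D_n+\frac1{z-\eta_n}\Big)\mu_{-2}(\eta_n)\Big],\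 \widehat C_n(z)\Big[\mu_{-1}'(\widehat\eta_n)+\Big(\widehat D_n+\frac1{z-\widehat\eta_n}\Big)\mu_{-1}(\widehat\eta_n)\Big]\Big),$$ where $$C_n(z)=\frac{A[\eta_n]}{z-\eta_n}e^{-2i\theta(\eta_n)},\quad D_n=B[\eta_n]-2i\theta'(\eta_n),\quad \widehat C_n(z)=\frac{A[\widehat\eta_n]}{z-\widehat\eta_n}e^{2i\theta(\widehat\eta_n)},\quad \widehat D_n=B[\widehat\eta_n]+2i\theta'(\widehat\eta_n).$$ Moreover $$\mu_{-2}(\eta_n)=\frac{iq_-}{\eta_n}\mu_{-1}(\widehat\eta_n),\qquad \mu_{-2}'(\eta_n)=-\frac{iq_-}{\eta_n^2}\mu_{-1}(\widehat\eta_n)+\frac{iq_-q_0^2}{\eta_n^3}\mu_{-1}'(\widehat\eta_n),$$ and $\mu_{-1}(\widehat\eta_n)$, $\mu_{-1}'(\widehat\eta_n)$ satisfy the linear system of $8N_1+4N_2$ (vector) equations, $k=1,\dots,4N_1+2N_2$, $$\sum_{n}\widehat C_n(\eta_k)\mu_{-1}'(\widehat\eta_n)+\Big[\widehat C_n(\eta_k)\Big(\widehat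 D_n+\frac1{\eta_k-\widehat\eta_n}\Big)-\frac{iq_-}{\eta_k}\delta_{k,n}\Big]\mu_{-1}(\widehat\eta_n)=-e^{iv_-\sigma_3}\begin{pmatrix}iq_- /\eta_k\\1\end{pmatrix}-\frac1{2\pi i}\int_\Sigma\frac{(M^+J)_2(\zeta)}{\zeta-\eta_k}d\zeta,$$ $$\sum_{n}\Big(\frac{\widehat C_n(\eta_k)}{\eta_k-\widehat\eta_n}+\frac{iq_-q_0^2}{\eta_k^3}\delta_{k,n}\Big)\mu_{-1}'(\widehat\eta_n)+\Big[\frac{\widehat C_n(\eta_k)}{\eta_k-\widehat\eta_n}\Big(\widehat D_n+\frac2{\eta_k-\widehat\eta_n}\Big)-\frac{iq_-}{\eta_k^2}\delta_{k,n}\Big]\mu_{-1}(\widehat\eta_n)=-e^{iv_-\sigma_3}\begin{pmatrix}iq_- /\eta_k^2\\0\end{pmatrix}+\frac1{2\pi i}\int_\Sigma\frac{(M^+J)_2(\zeta)}{(\zeta-\eta_k)^2}d\zeta,$$ where $(\cdot)_2$ denotes the second column. -/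

import Mathlib

open Complex Set Filter Topology MeasureTheory
open scoped ComplexConjugate

noncomputable section

namespace DNLS

/-- Complex `2 × 2` matrices. -/
abbrev Mat := Matrix (Fin 2) (Fin 2) ℂ

/-! ### Matrices -/

/-- The Pauli matrix `σ₃`. -/
def sigma3 : Mat := !![1, 0; 0, -1]

/-- `e^{a σ₃} = diag (e^a, e^{-a})`. -/
def expSigma3 (a : ℂ) : Mat := !![exp a, 0; 0, exp (-a)]

/-- The potential matrix `Q` of a scalar `c` (for `σ = -1`). -/
def potMat (c : ℂ) : Mat := !![0, c; -conj c, 0]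

/-- The matrix with columns `u` and `v`. -/
def colPair (u v : Fin 2 → ℂ) : Mat := Matrix.of fun i => ![u i, v i]

/-- The `j`-th column of a matrix-valued function, at `z`. -/
def col (F : ℂ → Mat) (j : Fin 2) (z : ℂ) : Fin 2 → ℂ := fun i => F z i j

/-- The derivative in `z` of the `j`-th column of a matrix-valued function, at `z`. -/
def dcol (F : ℂ → Mat) (j : Fin 2) (z : ℂ) : Fin 2 → ℂ := fun i => deriv (fun w => F w i j) z

/-! ### The uniformization variable `z = k + λ` and the regions of the `z`-plane -/

/-- `k(z) = (z - q₀² / z) / 2`. -/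
def kz (q0 : ℝ) (z : ℂ) : ℂ := (z - (q0 : ℂ) ^ 2 / z) / 2

/-- `λ(z) = (z + q₀² / z) / 2`. -/
def lamz (q0 : ℝ) (z : ℂ) : ℂ := (z + (q0 : ℂ) ^ 2 / z) / 2

/-- `θ(x, t; z) = k λ [x - (2 k² - q₀²) t]`. -/
def theta (q0 x t : ℝ) (z : ℂ) : ℂ :=
  kz q0 z * lamz q0 z * ((x : ℂ) - (2 * kz q0 z ^ 2 - (q0 : ℂ) ^ 2) * (t : ℂ))

/-- `Σ = (ℝ ∪ iℝ) \ {0}`. -/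
def Sig : Set ℂ := {z | (z.im = 0 ∨ z.re = 0) ∧ z ≠ 0}

/-- `D⁺ = {Re z Im z > 0}`. -/
def Dp : Set ℂ := {z | 0 < z.re * z.im}

/-- `D⁻ = {Re z Im z < 0}`. -/
def Dm : Set ℂ := {z | z.re * z.im < 0}

/-- The two branch points `± i q₀`. -/
def branch (q0 : ℝ) : Set ℂ := {I * (q0 : ℂ), -(I * (q0 : ℂ))}

/-- The integral of `f` along `Σ`, oriented with `D⁺` on the left: the real half-axes run
from `0` to `±∞`, the imaginary half-axes from `±i∞` to `0`. -/
def sigInt (f : ℂ → ℂ) : ℂ :=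
  (∫ s in Ioi (0 : ℝ), f (s : ℂ)) - (∫ s in Ioi (0 : ℝ), f (-(s : ℂ)))
    - I * (∫ s in Ioi (0 : ℝ), f (I * (s : ℂ))) + I * (∫ s in Ioi (0 : ℝ), f (-(I * (s : ℂ))))

/-- Absolute integrability of `f` along `Σ`. -/
def SigIntegrable (f : ℂ → ℂ) : Prop :=
  IntegrableOn (fun s : ℝ => f (s : ℂ)) (Ioi 0) ∧
  IntegrableOn (fun s : ℝ => f (-(s : ℂ))) (Ioi 0) ∧
  IntegrableOn (fun s : ℝ => f (I * (s : ℂ))) (Ioi 0) ∧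
  IntegrableOn (fun s : ℝ => f (-(I * (s : ℂ)))) (Ioi 0)

/-! ### The potential -/

/-- `q` is a classical solution of `i q_t + q_xx - i (|q|² q)_x = 0` with the non-zero boundary
conditions `q → q_±` as `x → ±∞`, `|q_±| = q₀ > 0`, where `(1 + |x|)(q - q_±) ∈ L¹(ℝ^±)` and
`q_x ∈ L¹(ℝ)` for every `t`. -/
structure IsPotential (q0 : ℝ) (qm qp : ℂ) (q : ℝ → ℝ → ℂ) : Prop where
  pos : 0 < q0
  norm_minus : ‖qm‖ = q0
  norm_plus : ‖qp‖ = q0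
  smooth_x : ∀ t, ContDiff ℝ 2 (fun x => q x t)
  diff_t : ∀ x, Differentiable ℝ (fun t => q x t)
  dnls : ∀ x t, I * deriv (fun s => q x s) t + deriv (deriv (fun y => q y t)) x
    - I * deriv (fun y => ((‖q y t‖ ^ 2 : ℝ) : ℂ) * q y t) x = 0
  lim_minus : ∀ t, Tendsto (fun x => q x t) atBot (𝓝 qm)
  lim_plus : ∀ t, Tendsto (fun x => q x t) atTop (𝓝 qp)
  weight_minus : ∀ t, IntegrableOn (fun x : ℝ => ((1 + |x| : ℝ) : ℂ) * (q x t - qm)) (Iio 0)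
  weight_plus : ∀ t, IntegrableOn (fun x : ℝ => ((1 + |x| : ℝ) : ℂ) * (q x t - qp)) (Ioi 0)
  deriv_int : ∀ t, Integrable (deriv (fun x => q x t))

/-- `v_-(x, t) = (1/2) ∫_{-∞}^x (|q(y, t)|² - q₀²) dy`. -/
def vMinus (q0 : ℝ) (q : ℝ → ℝ → ℂ) (x t : ℝ) : ℝ :=
  (1 / 2) * ∫ y in Iic x, (‖q y t‖ ^ 2 - q0 ^ 2)

/-! ### Jost solutions and scattering matrix -/

/-- `X(x, t; z) = i k² σ₃ + k Q(x, t)`. -/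
def laxX (q0 : ℝ) (q : ℝ → ℝ → ℂ) (x t : ℝ) (z : ℂ) : Mat :=
  (I * kz q0 z ^ 2) • sigma3 + kz q0 z • potMat (q x t)

/-- `E_±(z)`, for `c = q_±`. -/
def Ebg (c z : ℂ) : Mat := !![1, I * c / z; I * conj c / z, 1]

/-- On `Σ`, `Φ` solves `Φ_x = X Φ` and `Φ = E e^{iθσ₃} + o(1)` as `x → ±∞` (`l = atTop` or
`l = atBot`). -/
def IsJostOnSig (q0 : ℝ) (q : ℝ → ℝ → ℂ) (c : ℂ) (l : Filter ℝ) (Φ : ℝ → ℝ → ℂ → Mat) : Prop :=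
  ∀ z ∈ Sig, ∀ t,
    (∀ x i j, HasDerivAt (fun y => Φ y t z i j) ((laxX q0 q x t z * Φ x t z) i j) x) ∧
    Tendsto (fun x => Φ x t z - Ebg c z * expSigma3 (I * theta q0 x t z)) l (𝓝 0)

/-- `f` is, on `U`, the analytic extension of its restriction to `Γ`: it is analytic in `U` and
continuous on `U ∪ Γ`. -/
def ExtendsTo (f : ℂ → ℂ) (U Γ : Set ℂ) : Prop :=
  DifferentiableOn ℂ f U ∧ ContinuousOn f (U ∪ Γ)

/-- `Φ` is the Jost solution `Φ₊`. On `D⁺` (resp. `D⁻`) the first (resp. second) column of `Φ`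
stands for the analytic extension of that column from `Σ`; the other column is not used there. -/
structure IsJostPlus (q0 : ℝ) (q : ℝ → ℝ → ℂ) (qp : ℂ) (Φ : ℝ → ℝ → ℂ → Mat) : Prop where
  onSig : IsJostOnSig q0 q qp atTop Φ
  ext_one : ∀ x t i, ExtendsTo (fun z => Φ x t z i 0) Dp Sig
  ext_two : ∀ x t i, ExtendsTo (fun z => Φ x t z i 1) Dm Sig

/-- `Φ` is the Jost solution `Φ₋`. On `D⁻` (resp. `D⁺`) the first (resp. second) column of `Φ`
stands for the analytic extension of that column from `Σ`; the other column is not used there. -/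
structure IsJostMinus (q0 : ℝ) (q : ℝ → ℝ → ℂ) (qm : ℂ) (Φ : ℝ → ℝ → ℂ → Mat) : Prop where
  onSig : IsJostOnSig q0 q qm atBot Φ
  ext_one : ∀ x t i, ExtendsTo (fun z => Φ x t z i 0) Dm Sig
  ext_two : ∀ x t i, ExtendsTo (fun z => Φ x t z i 1) Dp Sig

/-- `S` is the scattering matrix: `Φ₊ = Φ₋ S` on `Σ \ {± i q₀}`. On `D⁺` (resp. `D⁻`) the entry
`s₁₁` (resp. `s₂₂`) stands for its analytic extension; the other entries are not used there. -/
structure IsScatteringMatrix (q0 : ℝ) (Φm Φp : ℝ → ℝ → ℂ → Mat) (S : ℂ → Mat) : Prop where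
  rel : ∀ z ∈ Sig \ branch q0, ∀ x t, Φp x t z = Φm x t z * S z
  ext_11 : ExtendsTo (fun z => S z 0 0) Dp (Sig \ branch q0)
  ext_22 : ExtendsTo (fun z => S z 1 1) Dm (Sig \ branch q0)

/-- No spectral singularities: `1/s₁₁` and `1/s₂₂` extend continuously to all of `Σ`. -/
structure NoSpectralSingularities (q0 : ℝ) (S : ℂ → Mat) : Prop where
  ne_11 : ∀ z ∈ Sig \ branch q0, S z 0 0 ≠ 0
  ne_22 : ∀ z ∈ Sig \ branch q0, S z 1 1 ≠ 0
  lim_11 : ∀ z ∈ branch q0, ∃ c, Tendsto (fun w => (S w 0 0)⁻¹) (𝓝[Dp] z) (𝓝 c)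
  lim_22 : ∀ z ∈ branch q0, ∃ c, Tendsto (fun w => (S w 1 1)⁻¹) (𝓝[Dm] z) (𝓝 c)

/-- The reflection coefficient `ρ = s₂₁ / s₁₁`. -/
def rho (S : ℂ → Mat) (z : ℂ) : ℂ := S z 1 0 / S z 0 0

/-- The reflection coefficient `ρ̃ = s₁₂ / s₂₂`. -/
def rhoTilde (S : ℂ → Mat) (z : ℂ) : ℂ := S z 0 1 / S z 1 1

/-! ### Discrete spectrum -/

/-- `z₀` is a double zero of `f`. -/
def IsDoubleZero (f : ℂ → ℂ) (z0 : ℂ) : Prop :=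
  f z0 = 0 ∧ iteratedDeriv 1 f z0 = 0 ∧ iteratedDeriv 2 f z0 ≠ 0

/-- The zeros of `s₁₁` in `{Re z > 0, Im z > 0, |z| > q₀}` are the `N₁` distinct points `zₙ`,
those in `{Re z > 0, Im z > 0, |z| = q₀}` are the `N₂` distinct points `wₘ`, and all are double. -/
structure HasDoubleZeros (q0 : ℝ) (S : ℂ → Mat) {N1 N2 : ℕ} (zs : Fin N1 → ℂ) (ws : Fin N2 → ℂ) :
    Prop where
  inj_z : Function.Injective zs
  inj_w : Function.Injective ws
  zeros_z : {z : ℂ | 0 < z.re ∧ 0 < z.im ∧ q0 < ‖z‖ ∧ S z 0 0 = 0} = range zs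
  zeros_w : {z : ℂ | 0 < z.re ∧ 0 < z.im ∧ ‖z‖ = q0 ∧ S z 0 0 = 0} = range ws
  double_z : ∀ n, IsDoubleZero (fun z => S z 0 0) (zs n)
  double_w : ∀ m, IsDoubleZero (fun z => S z 0 0) (ws m)

/-- The discrete spectrum `Z`. -/
def discSpec (q0 : ℝ) {N1 N2 : ℕ} (zs : Fin N1 → ℂ) (ws : Fin N2 → ℂ) : Set ℂ :=
  (⋃ n, {zs n, -zs n, conj (zs n), -conj (zs n),
    (q0 : ℂ) ^ 2 / zs n, -((q0 : ℂ) ^ 2 / zs n),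
    (q0 : ℂ) ^ 2 / conj (zs n), -((q0 : ℂ) ^ 2 / conj (zs n))}) ∪
  ⋃ m, {ws m, -ws m, conj (ws m), -conj (ws m)}

/-- The enumeration `η₁, …, η_{4N₁+2N₂}` of `Z ∩ D⁺` (indices here start at `0`). -/
def eta (q0 : ℝ) {N1 N2 : ℕ} (zs : Fin N1 → ℂ) (ws : Fin N2 → ℂ) (n : Fin (4 * N1 + 2 * N2)) : ℂ :=
  if h1 : n.1 < N1 then zs ⟨n.1, h1⟩
  else if h2 : n.1 < 2 * N1 then -zs ⟨n.1 - N1, by omega⟩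
  else if h3 : n.1 < 3 * N1 then (q0 : ℂ) ^ 2 / conj (zs ⟨n.1 - 2 * N1, by omega⟩)
  else if h4 : n.1 < 4 * N1 then -((q0 : ℂ) ^ 2 / conj (zs ⟨n.1 - 3 * N1, by omega⟩))
  else if h5 : n.1 < 4 * N1 + N2 then ws ⟨n.1 - 4 * N1, by omega⟩
  else -ws ⟨n.1 - 4 * N1 - N2, by omega⟩

/-- `η̂ₙ = -q₀² / ηₙ`. -/
def etaHat (q0 : ℝ) {N1 N2 : ℕ} (zs : Fin N1 → ℂ) (ws : Fin N2 → ℂ)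
    (n : Fin (4 * N1 + 2 * N2)) : ℂ :=
  -((q0 : ℂ) ^ 2 / eta q0 zs ws n)

/-- `b[z₀]` and `d[z₀]` are the (nonzero, resp. arbitrary) proportionality coefficients of
`Φ₊₁` to `Φ₋₂` and of `Φ₊₁' - b Φ₋₂'` to `Φ₋₂` at the points `z₀ ∈ Z ∩ D⁺`, and of `Φ₊₂` to `Φ₋₁`
and of `Φ₊₂' - b Φ₋₁'` to `Φ₋₁` at the points `z₀ ∈ Z ∩ D⁻`. -/
structure AreProportionality (Z : Set ℂ) (Φm Φp : ℝ → ℝ → ℂ → Mat) (b d : ℂ → ℂ) : Prop where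
  b_ne : ∀ z0 ∈ Z, b z0 ≠ 0
  b_plus : ∀ z0 ∈ Z ∩ Dp, ∀ x t, col (Φp x t) 0 z0 = b z0 • col (Φm x t) 1 z0
  b_minus : ∀ z0 ∈ Z ∩ Dm, ∀ x t, col (Φp x t) 1 z0 = b z0 • col (Φm x t) 0 z0
  d_plus : ∀ z0 ∈ Z ∩ Dp, ∀ x t,
    dcol (Φp x t) 0 z0 - b z0 • dcol (Φm x t) 1 z0 = d z0 • col (Φm x t) 1 z0
  d_minus : ∀ z0 ∈ Z ∩ Dm, ∀ x t,
    dcol (Φp x t) 1 z0 - b z0 • dcol (Φm x t) 0 z0 = d z0 • col (Φm x t) 0 z0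

open Classical in
/-- The diagonal scattering coefficient analytic near `z₀`: `s₁₁` for `z₀ ∈ D⁺`, else `s₂₂`. -/
def diagCoeff (S : ℂ → Mat) (z0 : ℂ) : ℂ → ℂ :=
  if z0 ∈ Dp then fun z => S z 0 0 else fun z => S z 1 1

/-- `A[z₀] = 2 b / s''`. -/
def Acoef (S : ℂ → Mat) (b : ℂ → ℂ) (z0 : ℂ) : ℂ :=
  2 * b z0 / iteratedDeriv 2 (diagCoeff S z0) z0

/-- `B[z₀] = d / b - s''' / (3 s'')`. -/
def Bcoef (S : ℂ → Mat) (b d : ℂ → ℂ) (z0 : ℂ) : ℂ :=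
  d z0 / b z0
    - iteratedDeriv 3 (diagCoeff S z0) z0 / (3 * iteratedDeriv 2 (diagCoeff S z0) z0)

/-! ### The Riemann–Hilbert problem -/

/-- The modified Jost solution `μ = Φ e^{-iθσ₃}`. -/
def modJost (q0 : ℝ) (Φ : ℝ → ℝ → ℂ → Mat) (x t : ℝ) (z : ℂ) : Mat :=
  Φ x t z * expSigma3 (-(I * theta q0 x t z))

open Classical in
/-- The sectionally meromorphic matrix: `M = (μ₊₁ / s₁₁, μ₋₂)` on `D⁺` and
`M = (μ₋₁, μ₊₂ / s₂₂)` on `D⁻`. -/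
def Mrhp (q0 : ℝ) (Φm Φp : ℝ → ℝ → ℂ → Mat) (S : ℂ → Mat) (x t : ℝ) (z : ℂ) : Mat :=
  if z ∈ Dp then
    colPair ((S z 0 0)⁻¹ • col (modJost q0 Φp x t) 0 z) (col (modJost q0 Φm x t) 1 z)
  else
    colPair (col (modJost q0 Φm x t) 0 z) ((S z 1 1)⁻¹ • col (modJost q0 Φp x t) 1 z)

/-- The boundary value `M⁺(z)`: the limit of `M` at `z ∈ Σ` from `D⁺`. -/
def plusLim (M : ℂ → Mat) (z : ℂ) : Mat := limUnder (𝓝[Dp] z) M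

/-- `J = e^{iθσ₃} [[0, -ρ̃], [ρ, ρ ρ̃]] e^{-iθσ₃}`. -/
def jumpJ (q0 : ℝ) (S : ℂ → Mat) (x t : ℝ) (z : ℂ) : Mat :=
  expSigma3 (I * theta q0 x t z)
    * !![0, -rhoTilde S z; rho S z, rho S z * rhoTilde S z]
    * expSigma3 (-(I * theta q0 x t z))

/-- `C(z) = A[η] / (z - η) e^{-2iθ(η)}`. -/
def Cco (q0 x t : ℝ) (A : ℂ → ℂ) (η z : ℂ) : ℂ := A η / (z - η) * exp (-2 * I * theta q0 x t η)

/-- `D = B[η] - 2iθ'(η)`. -/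
def Dco (q0 x t : ℝ) (B : ℂ → ℂ) (η : ℂ) : ℂ := B η - 2 * I * deriv (theta q0 x t) η

/-- `Ĉ(z) = A[η̂] / (z - η̂) e^{2iθ(η̂)}`. -/
def CHat (q0 x t : ℝ) (A : ℂ → ℂ) (η z : ℂ) : ℂ := A η / (z - η) * exp (2 * I * theta q0 x t η)

/-- `D̂ = B[η̂] + 2iθ'(η̂)`. -/
def DHat (q0 x t : ℝ) (B : ℂ → ℂ) (η : ℂ) : ℂ := B η + 2 * I * deriv (theta q0 x t) η

end DNLS

end

/-! In each quadrant `M` is built from the Jost columns that continue there, so off `Σ` it is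
analytic except at the zeros of `s₁₁` and `s₂₂`, where it has double poles. Subtract from `M` the
background term `e^{iv₋σ₃}(I + (i/z)σ₃Q₋)` and all principal parts. What remains is sectionally
analytic, `O(1/z)` at infinity and bounded at the origin, and its jump across `Σ` is `M⁺ - M⁻ =
M⁺J`. Cauchy's theorem in the four sectors identifies it with the Cauchy integral of this jump
(`sigInt_eq_of_sectors`, `cauchy_formula`, `cauchy_formula_of_doublePoles`), and this is the
solution formula.

Behaviour at infinity (`RightPotential.jost_asymptotics`): inside `D±` a Jost column is known only
as the continuation of its boundary values. For large `z` a solution is therefore constructed from a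
gauge transformation and a Volterra system holomorphic in `z`. It equals the Jost column on `Σ` by
uniqueness for the Lax equation, hence also in `D⁺` by boundary uniqueness (`eqOn_zero_Dp`). A
reflection in `x` reduces `Φ₋` to `Φ₊`. The Wronskian formula for `s₁₁` then gives the quotient
`μ₊₁/s₁₁`, in which `v₊` cancels and `v₋` remains.

Symmetries (`IsJostMat.conj_symm`, `IsJostMat.neg_symm`, `IsJostMat.hat_symm`,
`scatteringRelations`): they hold on `Σ` because Jost columns are unique, and are continued into
`D±`. Conjugation carries estimates from `D⁺` to `D⁻`, and `z ↦ -q₀²/z` exchanges infinity and the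
origin. Together with `z ↦ -z` they show that the enumerated points are all the zeros and that each
has order two (`ScatteringRelations.order_eta`, `ScatteringRelations.zero_Dp`).

Principal parts (`exists_tendsto_sub_principalPart`, `exists_tendsto_sub_doublePole`): factoring `s
= (z - η)² g` gives them in terms of `s''` and `s'''`, and the constants `b`, `d` express them
through the analytic columns `μ₋₂`, `μ₋₁`.

The linear system is the second column of the formula, evaluated and differentiated at `ηₖ ∈ D⁺`.
There that column is the regular function `μ₋₂`, and the third symmetry rewrites it in terms of
`μ₋₁` at `-q₀²/ηₖ`. -/

noncomputable section

namespace DNLS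

/-! ### Boundary uniqueness for holomorphic functions in a quadrant -/

/-- The part `R < re z + im z` of the open first quadrant. -/
def quad (R : ℝ) : Set ℂ := {z | 0 < z.re ∧ 0 < z.im ∧ R < z.re + z.im}

lemma isOpen_quad (R : ℝ) : IsOpen (quad R) := by
  have h1 : IsOpen {z : ℂ | 0 < z.re} := isOpen_lt continuous_const continuous_re
  have h2 : IsOpen {z : ℂ | 0 < z.im} := isOpen_lt continuous_const continuous_im
  have h3 : IsOpen {z : ℂ | R < z.re + z.im} :=
    isOpen_lt continuous_const (continuous_re.add continuous_im)
  exact h1.inter (h2.inter h3)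

lemma convex_quad (R : ℝ) : Convex ℝ (quad R) := by
  intro z hz w hw a b ha hb hab
  obtain ⟨h1, h2, h3⟩ := hz
  obtain ⟨g1, g2, g3⟩ := hw
  have key : ∀ c x y : ℝ, c < x → c < y → c < a * x + b * y := by
    intro c x y hx hy
    rcases ha.eq_or_lt with h | h
    · have hb1 : b = 1 := by linarith
      subst h; subst hb1; linarith
    · have : a * c < a * x := mul_lt_mul_of_pos_left hx h
      have : b * c ≤ b * y := mul_le_mul_of_nonneg_left hy.le hb
      have : a * c + b * c = c := by rw [← add_mul, hab, one_mul]
      linarith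
  refine ⟨?_, ?_, ?_⟩
  · simpa using key 0 _ _ h1 g1
  · simpa using key 0 _ _ h2 g2
  · have := key R _ _ h3 g3
    simp only [add_re, add_im, real_smul, re_ofReal_mul, im_ofReal_mul]
    linarith

/-- A function holomorphic in the quadrant and continuous up to an arc of the real axis, where it
vanishes, is zero. -/
theorem eqOn_zero_quad {f : ℂ → ℂ} {R R' : ℝ} (hf : DifferentiableOn ℂ f (quad R))
    (hR : 0 ≤ R') (hRR : R ≤ R') (hc : ContinuousOn f (quad R ∪ {z | z.im = 0 ∧ R' < z.re}))
    (h0 : ∀ z : ℂ, z.im = 0 → R' < z.re → f z = 0) : ∀ z ∈ quad R, f z = 0 := by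
  -- a bounded half-disc-like region near the point `R' + 2`
  set p : ℂ := (R' + 2 : ℝ) - I with hp
  set U : Set ℂ := {z | 0 < z.im} ∩ Metric.ball p (3 / 2) with hU
  have hUo : IsOpen U := (isOpen_lt continuous_const continuous_im).inter Metric.isOpen_ball
  have hre : ∀ z ∈ Metric.closedBall p (3 / 2), R' < z.re := by
    intro z hz
    have h := (abs_re_le_norm (z - p)).trans (mem_closedBall_iff_norm.1 hz)
    have := (abs_le.1 h).1
    simp [hp] at this
    linarith
  have hUq : U ⊆ quad R := by
    intro z hz
    have := hre z (Metric.ball_subset_closedBall hz.2)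
    have h2 : 0 < z.im := hz.1
    exact ⟨by linarith, hz.1, by linarith⟩
  have hcl : closure U ⊆ {z | 0 ≤ z.im} ∩ Metric.closedBall p (3 / 2) := by
    refine closure_minimal (fun z hz => ⟨le_of_lt (show (0:ℝ) < z.im from hz.1), Metric.ball_subset_closedBall hz.2⟩) ?_
    exact (isClosed_le continuous_const continuous_im).inter Metric.isClosed_closedBall
  have hcl2 : closure U ⊆ quad R ∪ {z | z.im = 0 ∧ R' < z.re} := by
    intro z hz
    have h := hcl hz
    have h1 := hre z h.2
    have h2 : 0 ≤ z.im := h.1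
    rcases h2.eq_or_lt with h3 | h3
    · exact Or.inr ⟨h3.symm, h1⟩
    · exact Or.inl ⟨by linarith, h3, by linarith⟩
  have hUb : Bornology.IsBounded U := Metric.isBounded_ball.subset inter_subset_right
  have hcomp : IsCompact (closure U) := hUb.isCompact_closure
  obtain ⟨K, hK⟩ := hcomp.exists_bound_of_continuousOn (hc.mono hcl2)
  have hpne : ∀ z ∈ closure U, z - p ≠ 0 := by
    intro z hz h
    have h2 : 0 ≤ z.im := (hcl hz).1
    have := congrArg im h
    simp [hp] at this
    linarith
  have hUz : ∀ z ∈ U, f z = 0 := by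
    intro z hz
    by_contra hne
    have hzlt : ‖z - p‖ < 3 / 2 := mem_ball_iff_norm.1 hz.2
    have hzpos : 0 < ‖z - p‖ := norm_pos_iff.2 (hpne z (subset_closure hz))
    -- The centre `p` lies below the axis, so `w - p` has no zero on the closure of `U`. On the
    -- frontier either `f` vanishes or `‖w - p‖ = 3/2`, whereas `‖z - p‖ < 3/2`. The maximum
    -- principle for `f / (w - p) ^ N` thus gains a geometric factor, and `N → ∞` forces `f z = 0`.
    have hbound : ∀ N : ℕ, ‖f z‖ * (3 / 2 / ‖z - p‖) ^ N ≤ K := by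
      intro N
      have hd : DiffContOnCl ℂ (fun w => f w / (w - p) ^ N) U := by
        constructor
        · intro w hw
          refine ((hf.mono hUq) w hw).div (by fun_prop) ?_
          exact pow_ne_zero _ (hpne w (subset_closure hw))
        · refine (hc.mono hcl2).div (by fun_prop) ?_
          intro w hw
          exact pow_ne_zero _ (hpne w hw)
      have hK0 : 0 ≤ K := (norm_nonneg _).trans (hK z (subset_closure hz))
      have := Complex.norm_le_of_forall_mem_frontier_norm_le hUb hd
        (C := K / (3 / 2) ^ N) ?_ (subset_closure hz)
      · rw [norm_div, norm_pow, div_le_div_iff₀ (by positivity) (by positivity)] at this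
        rw [div_pow, mul_div_assoc', div_le_iff₀ (by positivity)]
        exact this
      · intro w hw
        have hwc : w ∈ closure U := hw.1
        have hwU : w ∉ U := by rw [hUo.frontier_eq] at hw; exact hw.2
        have h1 := hcl hwc
        have h2 : 0 ≤ w.im := h1.1
        rcases h2.eq_or_lt with h3 | h3
        · rw [h0 w h3.symm (hre w h1.2), zero_div, norm_zero]
          positivity
        · have h4 : w ∉ Metric.ball p (3 / 2) := fun h => hwU ⟨h3, h⟩
          have h5 : 3 / 2 ≤ ‖w - p‖ := by
            rw [mem_ball_iff_norm] at h4; exact not_lt.1 h4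
          rw [norm_div, norm_pow]
          exact div_le_div₀ hK0 (hK w hwc) (by positivity)
            (pow_le_pow_left₀ (by norm_num) h5 N)
    have hgt : 1 < 3 / 2 / ‖z - p‖ := by rw [lt_div_iff₀ hzpos]; linarith
    have ht := (tendsto_pow_atTop_atTop_of_one_lt hgt).const_mul_atTop (norm_pos_iff.2 hne)
    obtain ⟨N, hN⟩ := (ht.eventually_gt_atTop K).exists
    exact absurd (hbound N) (not_le.2 hN)
  -- This point has height `1/4` and distance `5/4` from `p`; it seeds the identity theorem in the
  -- connected region.
  have hz0 : (p + (5 / 4 : ℝ) * I) ∈ U := by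
    constructor
    · show (0 : ℝ) < _
      simp [hp]; norm_num
    · rw [mem_ball_iff_norm, add_sub_cancel_left]
      simp; norm_num [abs_of_pos]
  have han : AnalyticOnNhd ℂ f (quad R) := hf.analyticOnNhd (isOpen_quad R)
  have hev : f =ᶠ[𝓝 (p + (5 / 4 : ℝ) * I)] 0 := by
    filter_upwards [hUo.mem_nhds hz0] with w hw using hUz w hw
  exact fun z hz => han.eqOn_zero_of_preconnected_of_eventuallyEq_zero
    (convex_quad R).isPreconnected (hUq hz0) hev hz

/-- The exterior of the square `|re z| + |im z| ≤ R`. -/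
def extReg (R : ℝ) : Set ℂ := {z | R < |z.re| + |z.im|}

lemma isOpen_extReg (R : ℝ) : IsOpen (extReg R) :=
  isOpen_lt continuous_const (continuous_re.abs.add continuous_im.abs)

lemma isOpen_Dp : IsOpen Dp := isOpen_lt continuous_const (continuous_re.mul continuous_im)

lemma isOpen_Dm : IsOpen Dm := isOpen_lt (continuous_re.mul continuous_im) continuous_const

/-- Transport of the first-quadrant statement by multiplication by `ω`; the values `1` and `-1` give
the two quadrants of `D⁺`. -/
lemma rot_zero {f : ℂ → ℂ} {R R' : ℝ} {U V : Set ℂ} (ω : ℂ)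
    (hf : DifferentiableOn ℂ f U) (hR : 0 ≤ R') (hRR : R ≤ R')
    (hc : ContinuousOn f (U ∪ (V ∩ extReg R'))) (h0 : ∀ z ∈ V ∩ extReg R', f z = 0)
    (hU : ∀ z ∈ quad R, ω * z ∈ U)
    (hV : ∀ z : ℂ, z.im = 0 → R' < z.re → ω * z ∈ V ∩ extReg R') :
    ∀ z ∈ quad R, f (ω * z) = 0 := by
  refine eqOn_zero_quad (f := fun z => f (ω * z)) ?_ hR hRR ?_ ?_
  · exact hf.comp (by fun_prop) hU
  · refine hc.comp (by fun_prop) ?_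
    rintro z (hz | hz)
    · exact Or.inl (hU z hz)
    · exact Or.inr (hV z hz.1 hz.2)
  · intro z h1 h2
    exact h0 _ (hV z h1 h2)

theorem eqOn_zero_Dp {f : ℂ → ℂ} {R R' : ℝ} (hf : DifferentiableOn ℂ f (Dp ∩ extReg R))
    (hR : 0 ≤ R') (hRR : R ≤ R') (hc : ContinuousOn f (Dp ∩ extReg R ∪ (Sig ∩ extReg R')))
    (h0 : ∀ z ∈ Sig ∩ extReg R', f z = 0) : ∀ z ∈ Dp ∩ extReg R, f z = 0 := by
  rintro z ⟨hz, hzR⟩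
  simp only [Dp, extReg, mem_ofPred_eq] at hz hzR
  rcases lt_or_ge 0 z.re with h | h
  · have h2 : 0 < z.im := pos_of_mul_pos_right hz h.le
    have := rot_zero (R := R) 1 hf hR hRR hc h0 ?_ ?_ z ?_
    · simpa using this
    · rintro w ⟨g1, g2, g3⟩
      rw [one_mul]
      refine ⟨mul_pos g1 g2, ?_⟩
      simpa [extReg, abs_of_pos g1, abs_of_pos g2] using g3
    · intro w g1 g2
      have : 0 < w.re := by linarith
      rw [one_mul]
      refine ⟨⟨Or.inl g1, fun h => ?_⟩, ?_⟩
      · simp [h] at this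
      · simpa [extReg, g1, abs_of_pos this] using g2
    · refine ⟨h, h2, ?_⟩
      rwa [abs_of_pos h, abs_of_pos h2] at hzR
  · have h1 : z.re < 0 := by
      rcases h.eq_or_lt with h | h
      · rw [h, zero_mul] at hz; exact absurd hz (lt_irrefl _)
      · exact h
    have h2 : z.im < 0 := by
      by_contra hh
      push Not at hh
      nlinarith
    have := rot_zero (R := R) (-1) hf hR hRR hc h0 ?_ ?_ (-z) ?_
    · simpa using this
    · rintro w ⟨g1, g2, g3⟩
      refine ⟨?_, ?_⟩
      · simpa [Dp] using mul_pos g1 g2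
      · simpa [extReg, abs_of_pos g1, abs_of_pos g2] using g3
    · intro w g1 g2
      have : 0 < w.re := by linarith
      refine ⟨⟨Or.inl (by simpa using g1), fun h => ?_⟩, ?_⟩
      · have hw : w = 0 := by simpa using h
        simp [hw] at this
      · simpa [extReg, g1, abs_of_pos this] using g2
    · refine ⟨by simpa using h1, by simpa using h2, ?_⟩
      rw [abs_of_neg h1, abs_of_neg h2] at hzR
      simpa using hzR

/-- Multiplication by `i` carries `D⁺` to `D⁻` and preserves `Σ` and the exterior of each square, so
`eqOn_zero_Dp` applies to `w ↦ f (I * w)`. -/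
theorem eqOn_zero_Dm {f : ℂ → ℂ} {R R' : ℝ} (hf : DifferentiableOn ℂ f (Dm ∩ extReg R))
    (hR : 0 ≤ R') (hRR : R ≤ R') (hc : ContinuousOn f (Dm ∩ extReg R ∪ (Sig ∩ extReg R')))
    (h0 : ∀ z ∈ Sig ∩ extReg R', f z = 0) : ∀ z ∈ Dm ∩ extReg R, f z = 0 := by
  intro z hz
  have hmem : ∀ w, I * w ∈ extReg R ↔ w ∈ extReg R := by
    intro w; simp [extReg, add_comm]
  have hmem' : ∀ w, I * w ∈ extReg R' ↔ w ∈ extReg R' := by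
    intro w; simp [extReg, add_comm]
  have hD : ∀ w, w ∈ Dp ∩ extReg R → I * w ∈ Dm ∩ extReg R := by
    rintro w ⟨hw, hw'⟩
    refine ⟨?_, (hmem w).2 hw'⟩
    simp only [Dp, Dm, mem_ofPred_eq, mul_re, mul_im, I_re, I_im] at hw ⊢
    nlinarith
  have hS : ∀ w, w ∈ Sig ∩ extReg R' → I * w ∈ Sig ∩ extReg R' := by
    rintro w ⟨⟨hw, hw0⟩, hw'⟩
    refine ⟨⟨?_, mul_ne_zero I_ne_zero hw0⟩, (hmem' w).2 hw'⟩
    rcases hw with hw | hw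
    · right; simp [hw]
    · left; simp [hw]
  have := eqOn_zero_Dp (f := fun w => f (I * w)) (R := R) (R' := R')
    (hf.comp (by fun_prop) hD) hR hRR (hc.comp (by fun_prop) ?_) (fun w hw => h0 _ (hS w hw))
    (-I * z) ?_
  · simpa [← mul_assoc] using this
  · rintro w (hw | hw)
    · exact Or.inl (hD w hw)
    · exact Or.inr (hS w hw)
  · obtain ⟨hz, hz'⟩ := hz
    refine ⟨?_, ?_⟩
    · simp only [Dp, Dm, mem_ofPred_eq, mul_re, mul_im, neg_re, neg_im, I_re, I_im] at hz ⊢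
      nlinarith
    · rw [← hmem]; simpa [← mul_assoc] using hz'

lemma extReg_zero_of_ne {z : ℂ} (h : z ≠ 0) : z ∈ extReg 0 := by
  by_contra hh
  simp only [extReg, mem_ofPred_eq, not_lt] at hh
  apply h
  have h1 := abs_nonneg z.re
  have h2 := abs_nonneg z.im
  apply Complex.ext
  · exact abs_eq_zero.1 (by linarith)
  · exact abs_eq_zero.1 (by linarith)

lemma ne_zero_of_mem_Dp {z : ℂ} (h : z ∈ Dp) : z ≠ 0 := by
  rintro rfl; simp [Dp] at h

lemma ne_zero_of_mem_Dm {z : ℂ} (h : z ∈ Dm) : z ≠ 0 := by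
  rintro rfl; simp [Dm] at h

/-- The branch points lie on the square `|re z| + |im z| = |q0|`. Boundary uniqueness needs data
only on the outer part of each ray, so nothing has to be known at the branch points. -/
lemma branch_not_extReg {q0 : ℝ} {z : ℂ} (hz : z ∈ extReg |q0|) : z ∉ branch q0 := by
  rintro (h | h)
  · rw [h] at hz; simp [extReg] at hz
  · rw [mem_singleton_iff.1 h] at hz; simp [extReg] at hz

/-- Functions analytic in `D⁺`, continuous up to `Σ` off the branch points, that agree there, agree
in `D⁺`. -/
theorem ExtendsTo.eqOn_Dp {q0 : ℝ} {f g : ℂ → ℂ} (hf : ExtendsTo f Dp (Sig \ branch q0))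
    (hg : ExtendsTo g Dp (Sig \ branch q0)) (h : ∀ z ∈ Sig \ branch q0, f z = g z) :
    ∀ z ∈ Dp, f z = g z := by
  intro z hz
  refine sub_eq_zero.1 (eqOn_zero_Dp (f := fun z => f z - g z) (R := 0) (R' := |q0|) ?_
    (abs_nonneg _) (abs_nonneg _) ?_ ?_ z ⟨hz, extReg_zero_of_ne (ne_zero_of_mem_Dp hz)⟩)
  · exact (hf.1.sub hg.1).mono inter_subset_left
  · refine (hf.2.sub hg.2).mono (union_subset_union inter_subset_left ?_)
    exact fun z hz => ⟨hz.1, branch_not_extReg hz.2⟩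
  · intro z hz
    exact sub_eq_zero.2 (h z ⟨hz.1, branch_not_extReg hz.2⟩)

theorem ExtendsTo.eqOn_Dm {q0 : ℝ} {f g : ℂ → ℂ} (hf : ExtendsTo f Dm (Sig \ branch q0))
    (hg : ExtendsTo g Dm (Sig \ branch q0)) (h : ∀ z ∈ Sig \ branch q0, f z = g z) :
    ∀ z ∈ Dm, f z = g z := by
  intro z hz
  refine sub_eq_zero.1 (eqOn_zero_Dm (f := fun z => f z - g z) (R := 0) (R' := |q0|) ?_
    (abs_nonneg _) (abs_nonneg _) ?_ ?_ z ⟨hz, extReg_zero_of_ne (ne_zero_of_mem_Dm hz)⟩)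
  · exact (hf.1.sub hg.1).mono inter_subset_left
  · refine (hf.2.sub hg.2).mono (union_subset_union inter_subset_left ?_)
    exact fun z hz => ⟨hz.1, branch_not_extReg hz.2⟩
  · intro z hz
    exact sub_eq_zero.2 (h z ⟨hz.1, branch_not_extReg hz.2⟩)

/-! ### Algebra of the uniformization variable -/

/-- The involution `z ↦ -q₀² / z`. -/
def hatz (q0 : ℝ) (z : ℂ) : ℂ := -((q0 : ℂ) ^ 2 / z)

section Algebra

variable {q0 : ℝ} {z : ℂ}

lemma hatz_ne_zero (h0 : 0 < q0) (hz : z ≠ 0) : hatz q0 z ≠ 0 := by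
  have : (q0 : ℂ) ≠ 0 := by exact_mod_cast h0.ne'
  exact neg_ne_zero.2 (div_ne_zero (pow_ne_zero _ this) hz)

lemma hatz_hatz (h0 : 0 < q0) (hz : z ≠ 0) : hatz q0 (hatz q0 z) = z := by
  have : (q0 : ℂ) ≠ 0 := by exact_mod_cast h0.ne'
  unfold hatz
  field_simp

/-- The points `z` and `-q₀²/z` are the two preimages of the same `k`: `k` is unchanged, while `λ`,
and with it `θ`, changes sign. This is why the two columns of a Jost matrix exchange roles under
this map. -/
lemma kz_hatz (h0 : 0 < q0) (hz : z ≠ 0) : kz q0 (hatz q0 z) = kz q0 z := by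
  have : (q0 : ℂ) ≠ 0 := by exact_mod_cast h0.ne'
  unfold kz hatz
  field_simp
  ring

lemma lamz_hatz (h0 : 0 < q0) (hz : z ≠ 0) : lamz q0 (hatz q0 z) = -lamz q0 z := by
  have : (q0 : ℂ) ≠ 0 := by exact_mod_cast h0.ne'
  unfold lamz hatz
  field_simp
  ring

lemma theta_hatz (h0 : 0 < q0) (hz : z ≠ 0) (x t : ℝ) :
    theta q0 x t (hatz q0 z) = -theta q0 x t z := by
  unfold theta
  rw [kz_hatz h0 hz, lamz_hatz h0 hz]
  ring

lemma kz_neg : kz q0 (-z) = -kz q0 z := by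
  unfold kz; rw [div_neg]; ring

lemma lamz_neg : lamz q0 (-z) = -lamz q0 z := by
  unfold lamz; rw [div_neg]; ring

lemma theta_neg (x t : ℝ) : theta q0 x t (-z) = theta q0 x t z := by
  unfold theta; rw [kz_neg, lamz_neg]; ring

lemma kz_conj : kz q0 (conj z) = conj (kz q0 z) := by
  simp [kz, map_ofNat (starRingEnd ℂ) 2]

lemma theta_conj (x t : ℝ) : theta q0 x t (conj z) = conj (theta q0 x t z) := by
  simp [theta, kz, lamz, map_ofNat (starRingEnd ℂ) 2]

/-- The phase keeps its form under `x ↦ -x` if time is reversed too; this is what lets a left Jost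
solution be treated as a right one. -/
lemma theta_reflect (x t : ℝ) : theta q0 (-x) t z = -theta q0 x (-t) z := by
  simp only [theta]; push_cast; ring

/-- `k λ` as a function of `z²`. -/
lemma kz_mul_lamz (hz : z ≠ 0) : kz q0 z * lamz q0 z = (z ^ 2 - (q0 : ℂ) ^ 4 / z ^ 2) / 4 := by
  unfold kz lamz; field_simp; ring

lemma kz_sq (hz : z ≠ 0) :
    kz q0 z ^ 2 = (z ^ 2 - 2 * (q0 : ℂ) ^ 2 + (q0 : ℂ) ^ 4 / z ^ 2) / 4 := by
  unfold kz; field_simp; ring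

lemma exists_sq_eq_of_mem_Sig (hz : z ∈ Sig) : ∃ r : ℝ, z ^ 2 = r := by
  rcases hz.1 with h | h
  · refine ⟨z.re ^ 2, ?_⟩
    rw [← re_add_im z, h]; simp
  · refine ⟨-z.im ^ 2, ?_⟩
    rw [← re_add_im z, h]; simp [mul_pow]

/-- Both `kλ` and `k²` depend on `z` only through `z²`, which is real on `Σ`. A real phase makes
`e^{±iθ}` unimodular there. -/
lemma exists_theta_eq_of_mem_Sig (hz : z ∈ Sig) (x t : ℝ) : ∃ r : ℝ, theta q0 x t z = r := by
  obtain ⟨r, hr⟩ := exists_sq_eq_of_mem_Sig hz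
  refine ⟨(r - q0 ^ 4 / r) / 4 *
    (x - (2 * ((r - 2 * q0 ^ 2 + q0 ^ 4 / r) / 4) - q0 ^ 2) * t), ?_⟩
  unfold theta
  rw [kz_mul_lamz hz.2, kz_sq hz.2, hr]
  push_cast
  ring

lemma norm_exp_theta (hz : z ∈ Sig) (x t : ℝ) : ‖exp (I * theta q0 x t z)‖ = 1 := by
  obtain ⟨r, hr⟩ := exists_theta_eq_of_mem_Sig (q0 := q0) hz x t
  rw [hr, mul_comm, norm_exp_ofReal_mul_I]

lemma norm_exp_neg_theta (hz : z ∈ Sig) (x t : ℝ) : ‖exp (-(I * theta q0 x t z))‖ = 1 := by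
  rw [exp_neg, norm_inv, norm_exp_theta hz, inv_one]

lemma Sig_neg (hz : z ∈ Sig) : -z ∈ Sig := by
  refine ⟨?_, neg_ne_zero.2 hz.2⟩
  rcases hz.1 with h | h
  · left; simp [h]
  · right; simp [h]

lemma Sig_conj (hz : z ∈ Sig) : conj z ∈ Sig := by
  refine ⟨?_, ?_⟩
  · rcases hz.1 with h | h
    · left; simp [h]
    · right; simp [h]
  · simpa using hz.2

lemma hatz_re (q0 : ℝ) (z : ℂ) : (hatz q0 z).re = -(q0 ^ 2 * z.re / normSq z) := by
  unfold hatz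
  rw [← ofReal_pow, neg_re, div_eq_mul_inv, re_ofReal_mul, inv_re]
  ring

lemma hatz_im (q0 : ℝ) (z : ℂ) : (hatz q0 z).im = q0 ^ 2 * z.im / normSq z := by
  unfold hatz
  rw [← ofReal_pow, neg_im, div_eq_mul_inv, im_ofReal_mul, inv_im]
  ring

lemma Sig_hatz (h0 : 0 < q0) (hz : z ∈ Sig) : hatz q0 z ∈ Sig := by
  refine ⟨?_, hatz_ne_zero h0 hz.2⟩
  rcases hz.1 with h | h
  · left; simp [hatz_im, h]
  · right; simp [hatz_re, h]

lemma hatz_re_mul_im (z : ℂ) : (hatz q0 z).re * (hatz q0 z).im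
    = -((q0 ^ 2 / normSq z) ^ 2 * (z.re * z.im)) := by
  rw [hatz_re, hatz_im]; ring

lemma hatz_factor_pos (h0 : 0 < q0) (hz : z ≠ 0) : 0 < (q0 ^ 2 / normSq z) ^ 2 := by
  have := normSq_pos.2 hz
  positivity

lemma hatz_mem_Dm (h0 : 0 < q0) (hz : z ∈ Dp) : hatz q0 z ∈ Dm := by
  have := mul_pos (hatz_factor_pos h0 (ne_zero_of_mem_Dp hz)) hz
  simp only [Dm, mem_ofPred_eq, hatz_re_mul_im]
  linarith

lemma hatz_mem_Dp (h0 : 0 < q0) (hz : z ∈ Dm) : hatz q0 z ∈ Dp := by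
  have := mul_neg_of_pos_of_neg (hatz_factor_pos h0 (ne_zero_of_mem_Dm hz)) hz
  simp only [Dp, mem_ofPred_eq, hatz_re_mul_im]
  linarith

lemma neg_mem_Dp (hz : z ∈ Dp) : -z ∈ Dp := by simpa [Dp] using hz

lemma conj_mem_Dm (hz : z ∈ Dp) : conj z ∈ Dm := by simpa [Dp, Dm] using hz

lemma conj_mem_Dp (hz : z ∈ Dm) : conj z ∈ Dp := by simpa [Dp, Dm] using hz

lemma mem_branch_iff : z ∈ branch q0 ↔ z ^ 2 + (q0 : ℂ) ^ 2 = 0 := by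
  have : z ^ 2 + (q0 : ℂ) ^ 2 = (z - I * q0) * (z - -(I * q0)) := by
    ring_nf; simp
  rw [this, mul_eq_zero, sub_eq_zero, sub_eq_zero]
  rfl

lemma branch_neg (hz : -z ∈ branch q0) : z ∈ branch q0 := by
  rw [mem_branch_iff] at *; simpa using hz

lemma branch_conj (hz : conj z ∈ branch q0) : z ∈ branch q0 := by
  rw [mem_branch_iff] at *
  have := congrArg conj hz
  simpa using this

lemma branch_hatz (h0 : 0 < q0) (hz0 : z ≠ 0) (hz : hatz q0 z ∈ branch q0) : z ∈ branch q0 := by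
  rw [mem_branch_iff] at *
  have h1 : (q0 : ℂ) ≠ 0 := by exact_mod_cast h0.ne'
  unfold hatz at hz
  field_simp at hz
  rw [mul_zero] at hz
  have := (mul_eq_zero.1 hz).resolve_left (pow_ne_zero 2 h1)
  rwa [add_comm]

/-- `det E_± = 1 + q₀² / z²`. -/
def detE (q0 : ℝ) (z : ℂ) : ℂ := 1 + (q0 : ℂ) ^ 2 / z ^ 2

lemma detE_eq_zero_iff (hz : z ≠ 0) : detE q0 z = 0 ↔ z ∈ branch q0 := by
  rw [mem_branch_iff]
  unfold detE
  rw [← mul_right_inj' (pow_ne_zero 2 hz), mul_zero, mul_add, mul_div_cancel₀ _ (pow_ne_zero 2 hz),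
    mul_one]

lemma Sig_re_mul_im (hz : z ∈ Sig) : z.re * z.im = 0 := by
  rcases hz.1 with h | h <;> simp [h]

lemma Dp_not_Sig (hz : z ∈ Dp) : z ∉ Sig := fun h => by
  have := Sig_re_mul_im h
  exact (ne_of_gt (show 0 < z.re * z.im from hz)) this

lemma Dm_not_Sig (hz : z ∈ Dm) : z ∉ Sig := fun h => by
  have := Sig_re_mul_im h
  exact (ne_of_lt (show z.re * z.im < 0 from hz)) this

lemma Dm_not_Dp (hz : z ∈ Dm) : z ∉ Dp := fun h =>
  lt_asymm (show z.re * z.im < 0 from hz) h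

end Algebra

/-! ### Solutions of the spatial Lax equation -/

/-- `(f, g)` solves `φ_x = X φ`. -/
def LaxSol (q0 : ℝ) (u : ℝ → ℂ) (z : ℂ) (f g : ℝ → ℂ) : Prop :=
  ∀ x, HasDerivAt f (I * kz q0 z ^ 2 * f x + kz q0 z * u x * g x) x ∧
    HasDerivAt g (-(kz q0 z * conj (u x) * f x) - I * kz q0 z ^ 2 * g x) x

section LaxSol

variable {q0 : ℝ} {u : ℝ → ℂ} {z : ℂ} {f g f' g' : ℝ → ℂ}

lemma LaxSol.const_mul (h : LaxSol q0 u z f g) (a : ℂ) :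
    LaxSol q0 u z (fun x => a * f x) (fun x => a * g x) := by
  intro x
  refine ⟨((h x).1.const_mul a).congr_deriv ?_, ((h x).2.const_mul a).congr_deriv ?_⟩ <;> ring

lemma LaxSol.sub (h : LaxSol q0 u z f g) (h' : LaxSol q0 u z f' g') :
    LaxSol q0 u z (fun x => f x - f' x) (fun x => g x - g' x) := by
  intro x
  refine ⟨((h x).1.sub (h' x).1).congr_deriv ?_, ((h x).2.sub (h' x).2).congr_deriv ?_⟩ <;> ring

/-- The Wronskian of two solutions is constant. -/
lemma LaxSol.wronskian (h : LaxSol q0 u z f g) (h' : LaxSol q0 u z f' g') (x y : ℝ) :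
    f x * g' x - f' x * g x = f y * g' y - f' y * g y := by
  have hd : ∀ x, HasDerivAt (fun x => f x * g' x - f' x * g x) 0 x := by
    intro x
    refine (((h x).1.mul (h' x).2).sub ((h' x).1.mul (h x).2)).congr_deriv ?_
    ring
  exact is_const_of_deriv_eq_zero (fun x => (hd x).differentiableAt) (fun x => (hd x).deriv) x y

end LaxSol

/-- For one value of `t`, `F` is a matrix of solutions asymptotic to `E e^{iθσ₃}`. -/
structure IsJostMat (q0 t : ℝ) (u : ℝ → ℂ) (c : ℂ) (l : Filter ℝ) (F : ℝ → ℂ → Mat) : Prop where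
  sol : ∀ z ∈ Sig, ∀ j, LaxSol q0 u z (fun x => F x z 0 j) (fun x => F x z 1 j)
  lim0 : ∀ z ∈ Sig, ∀ i, Tendsto (fun x => F x z i 0 * exp (-(I * theta q0 x t z))) l
    (𝓝 (Ebg c z i 0))
  lim1 : ∀ z ∈ Sig, ∀ i, Tendsto (fun x => F x z i 1 * exp (I * theta q0 x t z)) l
    (𝓝 (Ebg c z i 1))

lemma laxX_mul_zero (q0 : ℝ) (q : ℝ → ℝ → ℂ) (x t : ℝ) (z : ℂ) (A : Mat) (j : Fin 2) :
    (laxX q0 q x t z * A) 0 j = I * kz q0 z ^ 2 * A 0 j + kz q0 z * q x t * A 1 j := by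
  simp [laxX, sigma3, potMat, Matrix.mul_apply, Fin.sum_univ_two]

lemma laxX_mul_one (q0 : ℝ) (q : ℝ → ℝ → ℂ) (x t : ℝ) (z : ℂ) (A : Mat) (j : Fin 2) :
    (laxX q0 q x t z * A) 1 j = -(kz q0 z * conj (q x t) * A 0 j) - I * kz q0 z ^ 2 * A 1 j := by
  simp [laxX, sigma3, potMat, Matrix.mul_apply, Fin.sum_univ_two]
  ring

/-- The `o(1)` error may be multiplied by the unimodular factors `e^{∓iθ}`, which turns the
asymptotics of each column into genuine limits. -/
lemma IsJostOnSig.isJostMat {q0 : ℝ} {q : ℝ → ℝ → ℂ} {c : ℂ} {l : Filter ℝ}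
    {Φ : ℝ → ℝ → ℂ → Mat} (h : IsJostOnSig q0 q c l Φ) (t : ℝ) :
    IsJostMat q0 t (fun x => q x t) c l (fun x z => Φ x t z) := by
  have hent : ∀ z ∈ Sig, ∀ i j, Tendsto (fun x => Φ x t z i j
      - (Ebg c z * expSigma3 (I * theta q0 x t z)) i j) l (𝓝 0) := by
    intro z hz i j
    have := (h z hz t).2
    simpa [Function.comp_def] using (((continuous_id.matrix_elem i j).tendsto (0 : Mat)).comp this)
  refine ⟨?_, ?_, ?_⟩
  · intro z hz j x
    have h0 := (h z hz t).1 x 0 j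
    have h1 := (h z hz t).1 x 1 j
    rw [laxX_mul_zero] at h0
    rw [laxX_mul_one] at h1
    exact ⟨h0, h1⟩
  · intro z hz i
    have h1 : Tendsto (fun x => (Φ x t z i 0 - (Ebg c z * expSigma3 (I * theta q0 x t z)) i 0)
        * exp (-(I * theta q0 x t z))) l (𝓝 0) := by
      rw [tendsto_zero_iff_norm_tendsto_zero]
      simp only [norm_mul, norm_exp_neg_theta hz, mul_one]
      exact tendsto_zero_iff_norm_tendsto_zero.1 (hent z hz i 0)
    have h2 := h1.add_const (Ebg c z i 0)
    rw [zero_add] at h2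
    refine h2.congr fun x => ?_
    simp only [expSigma3, Matrix.mul_apply, Fin.sum_univ_two, Matrix.of_apply, Matrix.cons_val',
      Matrix.cons_val_zero, Matrix.cons_val_one, Matrix.cons_val_fin_one, mul_zero, add_zero]
    rw [sub_mul, mul_assoc (Ebg c z i 0), ← Complex.exp_add, add_neg_cancel, Complex.exp_zero]
    ring
  · intro z hz i
    have h1 : Tendsto (fun x => (Φ x t z i 1 - (Ebg c z * expSigma3 (I * theta q0 x t z)) i 1)
        * exp (I * theta q0 x t z)) l (𝓝 0) := by
      rw [tendsto_zero_iff_norm_tendsto_zero]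
      simp only [norm_mul, norm_exp_theta hz, mul_one]
      exact tendsto_zero_iff_norm_tendsto_zero.1 (hent z hz i 1)
    have h2 := h1.add_const (Ebg c z i 1)
    rw [zero_add] at h2
    refine h2.congr fun x => ?_
    simp only [expSigma3, Matrix.mul_apply, Fin.sum_univ_two, Matrix.of_apply, Matrix.cons_val',
      Matrix.cons_val_zero, Matrix.cons_val_one, Matrix.cons_val_fin_one, mul_zero, zero_add]
    rw [sub_mul, mul_assoc (Ebg c z i 1), ← Complex.exp_add, neg_add_cancel, Complex.exp_zero]
    ring

section Jost

variable {q0 t : ℝ} {u : ℝ → ℂ} {c z : ℂ} {l : Filter ℝ} {F G : ℝ → ℂ → Mat}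

@[simp] lemma Ebg_00 : Ebg c z 0 0 = 1 := rfl
@[simp] lemma Ebg_01 : Ebg c z 0 1 = I * c / z := rfl
@[simp] lemma Ebg_10 : Ebg c z 1 0 = I * conj c / z := rfl
@[simp] lemma Ebg_11 : Ebg c z 1 1 = 1 := rfl

lemma mul_conj_of_norm (hc : ‖c‖ = q0) : c * conj c = (q0 : ℂ) ^ 2 := by
  rw [mul_conj, normSq_eq_norm_sq, hc]; push_cast; rfl

/-- The Wronskian of the two columns does not depend on `x`, and in its limit the factors `e^{iθ}`
and `e^{-iθ}` cancel, which leaves `det E`. -/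
lemma IsJostMat.det_eq [l.NeBot] (hF : IsJostMat q0 t u c l F) (hc : ‖c‖ = q0) (hz : z ∈ Sig)
    (x : ℝ) : F x z 0 0 * F x z 1 1 - F x z 0 1 * F x z 1 0 = detE q0 z := by
  have h1 : Tendsto (fun y => F y z 0 0 * F y z 1 1 - F y z 0 1 * F y z 1 0) l
      (𝓝 (Ebg c z 0 0 * Ebg c z 1 1 - Ebg c z 0 1 * Ebg c z 1 0)) := by
    refine (((hF.lim0 z hz 0).mul (hF.lim1 z hz 1)).sub
      ((hF.lim1 z hz 0).mul (hF.lim0 z hz 1))).congr fun y => ?_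
    have : exp (-(I * theta q0 y t z)) * exp (I * theta q0 y t z) = 1 := by
      rw [← Complex.exp_add, neg_add_cancel, Complex.exp_zero]
    linear_combination (F y z 0 0 * F y z 1 1 - F y z 0 1 * F y z 1 0) * this
  have h2 : Tendsto (fun y => F y z 0 0 * F y z 1 1 - F y z 0 1 * F y z 1 0) l
      (𝓝 (F x z 0 0 * F x z 1 1 - F x z 0 1 * F x z 1 0)) := by
    refine tendsto_const_nhds.congr fun y => ?_
    exact (hF.sol z hz 0).wronskian (hF.sol z hz 1) x y
  rw [tendsto_nhds_unique h2 h1]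
  have := hz.2
  simp only [Ebg_00, Ebg_01, Ebg_10, Ebg_11, detE]
  field_simp
  rw [I_sq]
  linear_combination mul_conj_of_norm hc

/-- A solution that tends to zero vanishes. -/
lemma IsJostMat.eq_zero [l.NeBot] (hF : IsJostMat q0 t u c l F) (hc : ‖c‖ = q0) (hz : z ∈ Sig)
    (hzb : z ∉ branch q0) {f g : ℝ → ℂ} (h : LaxSol q0 u z f g) (hf : Tendsto f l (𝓝 0))
    (hg : Tendsto g l (𝓝 0)) (x : ℝ) : f x = 0 ∧ g x = 0 := by
  have hmul : ∀ {f e : ℝ → ℂ}, Tendsto f l (𝓝 0) → (∀ x, ‖e x‖ = 1) →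
      Tendsto (fun x => f x * e x) l (𝓝 0) := by
    intro f e hf he
    rw [tendsto_zero_iff_norm_tendsto_zero]
    simpa only [norm_mul, he, mul_one] using tendsto_zero_iff_norm_tendsto_zero.1 hf
  -- The Wronskians of the given solution with both Jost columns are constant and tend to zero, so
  -- they vanish. Off the branch points `det E ≠ 0`, and the two linear equations have only the zero
  -- solution.
  have h0 : f x * F x z 1 0 - F x z 0 0 * g x = 0 := by
    have h1 : Tendsto (fun y => f y * F y z 1 0 - F y z 0 0 * g y) l (𝓝 0) := by
      have a1 := (hmul hf (fun x => norm_exp_theta (q0 := q0) hz x t)).mul (hF.lim0 z hz 1)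
      have a2 := (hF.lim0 z hz 0).mul (hmul hg (fun x => norm_exp_theta (q0 := q0) hz x t))
      have a3 := a1.sub a2
      rw [zero_mul, mul_zero, sub_zero] at a3
      refine a3.congr fun y => ?_
      have : exp (-(I * theta q0 y t z)) * exp (I * theta q0 y t z) = 1 := by
        rw [← Complex.exp_add, neg_add_cancel, Complex.exp_zero]
      linear_combination (f y * F y z 1 0 - F y z 0 0 * g y) * this
    refine tendsto_nhds_unique (tendsto_const_nhds.congr fun y => ?_) h1
    exact h.wronskian (hF.sol z hz 0) x y
  have h1 : f x * F x z 1 1 - F x z 0 1 * g x = 0 := by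
    have h1 : Tendsto (fun y => f y * F y z 1 1 - F y z 0 1 * g y) l (𝓝 0) := by
      have a1 := (hmul hf (fun x => norm_exp_neg_theta (q0 := q0) hz x t)).mul (hF.lim1 z hz 1)
      have a2 := (hF.lim1 z hz 0).mul (hmul hg (fun x => norm_exp_neg_theta (q0 := q0) hz x t))
      have a3 := a1.sub a2
      rw [zero_mul, mul_zero, sub_zero] at a3
      refine a3.congr fun y => ?_
      have : exp (-(I * theta q0 y t z)) * exp (I * theta q0 y t z) = 1 := by
        rw [← Complex.exp_add, neg_add_cancel, Complex.exp_zero]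
      linear_combination (f y * F y z 1 1 - F y z 0 1 * g y) * this
    refine tendsto_nhds_unique (tendsto_const_nhds.congr fun y => ?_) h1
    exact h.wronskian (hF.sol z hz 1) x y
  have hdet := hF.det_eq hc hz x
  have hne : detE q0 z ≠ 0 := fun hh => hzb ((detE_eq_zero_iff hz.2).1 hh)
  constructor
  · refine (mul_eq_zero.1 (?_ : f x * detE q0 z = 0)).resolve_right hne
    rw [← hdet]; linear_combination F x z 0 0 * h1 - F x z 0 1 * h0
  · refine (mul_eq_zero.1 (?_ : g x * detE q0 z = 0)).resolve_right hne
    rw [← hdet]; linear_combination F x z 1 0 * h1 - F x z 1 1 * h0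

/-- A solution with the asymptotic behaviour of the first Jost column is that column. -/
lemma IsJostMat.col_zero_unique [l.NeBot] (hF : IsJostMat q0 t u c l F) (hc : ‖c‖ = q0)
    (hz : z ∈ Sig) (hzb : z ∉ branch q0) {f g : ℝ → ℂ} (h : LaxSol q0 u z f g)
    (hf : Tendsto (fun x => f x * exp (-(I * theta q0 x t z))) l (𝓝 (Ebg c z 0 0)))
    (hg : Tendsto (fun x => g x * exp (-(I * theta q0 x t z))) l (𝓝 (Ebg c z 1 0))) (x : ℝ) :
    F x z 0 0 = f x ∧ F x z 1 0 = g x := by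
  have key : ∀ (f g : ℝ → ℂ) (a : ℂ),
      Tendsto (fun x => f x * exp (-(I * theta q0 x t z))) l (𝓝 a) →
      Tendsto (fun x => g x * exp (-(I * theta q0 x t z))) l (𝓝 a) →
      Tendsto (fun x => f x - g x) l (𝓝 0) := by
    intro f g a h1 h2
    have h3 := h1.sub h2
    rw [sub_self, tendsto_zero_iff_norm_tendsto_zero] at h3
    rw [tendsto_zero_iff_norm_tendsto_zero]
    refine h3.congr fun x => ?_
    rw [← sub_mul, norm_mul, norm_exp_neg_theta hz, mul_one]
  have := hF.eq_zero hc hz hzb ((hF.sol z hz 0).sub h) (key _ _ _ (hF.lim0 z hz 0) hf)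
    (key _ _ _ (hF.lim0 z hz 1) hg) x
  exact ⟨sub_eq_zero.1 this.1, sub_eq_zero.1 this.2⟩

lemma IsJostMat.col_one_unique [l.NeBot] (hF : IsJostMat q0 t u c l F) (hc : ‖c‖ = q0)
    (hz : z ∈ Sig) (hzb : z ∉ branch q0) {f g : ℝ → ℂ} (h : LaxSol q0 u z f g)
    (hf : Tendsto (fun x => f x * exp (I * theta q0 x t z)) l (𝓝 (Ebg c z 0 1)))
    (hg : Tendsto (fun x => g x * exp (I * theta q0 x t z)) l (𝓝 (Ebg c z 1 1))) (x : ℝ) :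
    F x z 0 1 = f x ∧ F x z 1 1 = g x := by
  have key : ∀ (f g : ℝ → ℂ) (a : ℂ),
      Tendsto (fun x => f x * exp (I * theta q0 x t z)) l (𝓝 a) →
      Tendsto (fun x => g x * exp (I * theta q0 x t z)) l (𝓝 a) →
      Tendsto (fun x => f x - g x) l (𝓝 0) := by
    intro f g a h1 h2
    have h3 := h1.sub h2
    rw [sub_self, tendsto_zero_iff_norm_tendsto_zero] at h3
    rw [tendsto_zero_iff_norm_tendsto_zero]
    refine h3.congr fun x => ?_
    rw [← sub_mul, norm_mul, norm_exp_theta hz, mul_one]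
  have := hF.eq_zero hc hz hzb ((hF.sol z hz 1).sub h) (key _ _ _ (hF.lim1 z hz 0) hf)
    (key _ _ _ (hF.lim1 z hz 1) hg) x
  exact ⟨sub_eq_zero.1 this.1, sub_eq_zero.1 this.2⟩

/-! ### The symmetries -/

/-- The lower-left entry of `Q` is minus the conjugate of the upper-right one, so `(f, g) ↦ (conj g,
-conj f)` sends solutions at `conj z` to solutions at `z`. The image has the asymptotics of a Jost
column, and uniqueness identifies the two. The next two symmetries follow the same pattern. -/
lemma IsJostMat.conj_symm [l.NeBot] (hF : IsJostMat q0 t u c l F) (hc : ‖c‖ = q0) (hz : z ∈ Sig)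
    (hzb : z ∉ branch q0) (x : ℝ) :
    (F x z 0 0 = conj (F x (conj z) 1 1) ∧ F x z 1 0 = -conj (F x (conj z) 0 1)) ∧
    (F x z 0 1 = -conj (F x (conj z) 1 0) ∧ F x z 1 1 = conj (F x (conj z) 0 0)) := by
  have hz' := Sig_conj hz
  have hsol : ∀ j, LaxSol q0 u z (fun x => conj (F x (conj z) 1 j))
      (fun x => -conj (F x (conj z) 0 j)) := by
    intro j x
    have h := hF.sol _ hz' j x
    rw [kz_conj] at h
    refine ⟨h.2.star.congr_deriv ?_, h.1.star.neg.congr_deriv ?_⟩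
    · simp; ring
    · simp
  have hexp : ∀ x, conj (exp (I * theta q0 x t (conj z))) = exp (-(I * theta q0 x t z)) := by
    intro x; rw [theta_conj, ← exp_conj]; simp
  have hexp' : ∀ x, conj (exp (-(I * theta q0 x t (conj z)))) = exp (I * theta q0 x t z) := by
    intro x; rw [theta_conj, ← exp_conj]; simp
  constructor
  · refine hF.col_zero_unique hc hz hzb (hsol 1) ?_ ?_ x
    · have := (continuous_conj.tendsto _).comp (hF.lim1 _ hz' 1)
      simpa [Function.comp_def, hexp] using this
    · have := ((continuous_conj.tendsto _).comp (hF.lim1 _ hz' 0)).neg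
      simpa [Function.comp_def, hexp, neg_div] using this
  · have h2 : LaxSol q0 u z (fun x => -conj (F x (conj z) 1 0))
      (fun x => conj (F x (conj z) 0 0)) := by
      simpa using (hsol 0).const_mul (-1)
    refine hF.col_one_unique hc hz hzb h2 ?_ ?_ x
    · have := ((continuous_conj.tendsto _).comp (hF.lim0 _ hz' 1)).neg
      simpa [Function.comp_def, hexp', neg_div] using this
    · have := (continuous_conj.tendsto _).comp (hF.lim0 _ hz' 0)
      simpa [Function.comp_def, hexp'] using this

/-- Since `k` is odd in `z` and enters the diagonal only through `k²`, a sign change of one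
component compensates `z ↦ -z`. -/
lemma IsJostMat.neg_symm [l.NeBot] (hF : IsJostMat q0 t u c l F) (hc : ‖c‖ = q0) (hz : z ∈ Sig)
    (hzb : z ∉ branch q0) (x : ℝ) :
    (F x z 0 0 = F x (-z) 0 0 ∧ F x z 1 0 = -F x (-z) 1 0) ∧
    (F x z 0 1 = -F x (-z) 0 1 ∧ F x z 1 1 = F x (-z) 1 1) := by
  have hz' := Sig_neg hz
  have hsol : ∀ j, LaxSol q0 u z (fun x => F x (-z) 0 j) (fun x => -F x (-z) 1 j) := by
    intro j x
    have h := hF.sol _ hz' j x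
    rw [kz_neg] at h
    refine ⟨h.1.congr_deriv ?_, h.2.neg.congr_deriv ?_⟩ <;> ring
  constructor
  · refine hF.col_zero_unique hc hz hzb (hsol 0) ?_ ?_ x
    · simpa [theta_neg] using hF.lim0 _ hz' 0
    · simpa [theta_neg, div_neg] using (hF.lim0 _ hz' 1).neg
  · have h2 : LaxSol q0 u z (fun x => -F x (-z) 0 1) (fun x => F x (-z) 1 1) := by
      simpa using (hsol 1).const_mul (-1)
    refine hF.col_one_unique hc hz hzb h2 ?_ ?_ x
    · simpa [theta_neg, div_neg] using (hF.lim1 _ hz' 0).neg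
    · simpa [theta_neg] using hF.lim1 _ hz' 1

/-- The equation is the same at `z` and at `-q₀²/z`, but `θ` changes sign, so each column becomes a
multiple of the other. Comparison with `E` fixes the factor, where `|c| = q₀` enters. -/
lemma IsJostMat.hat_symm [l.NeBot] (hF : IsJostMat q0 t u c l F) (h0 : 0 < q0) (hc : ‖c‖ = q0)
    (hz : z ∈ Sig) (hzb : z ∉ branch q0) (x : ℝ) (i : Fin 2) :
    F x z i 0 = I * conj c / z * F x (hatz q0 z) i 1 ∧
    F x z i 1 = I * c / z * F x (hatz q0 z) i 0 := by
  have hz' := Sig_hatz h0 hz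
  have hq : (q0 : ℂ) ≠ 0 := by exact_mod_cast h0.ne'
  have hzne := hz.2
  have hsol : ∀ j, LaxSol q0 u z (fun x => F x (hatz q0 z) 0 j) (fun x => F x (hatz q0 z) 1 j) := by
    intro j x
    have h := hF.sol _ hz' j x
    rwa [kz_hatz h0 hz.2] at h
  have hlim0 := hF.lim0 _ hz'
  have hlim1 := hF.lim1 _ hz'
  simp only [theta_hatz h0 hz.2, mul_neg, neg_neg] at hlim0 hlim1
  have e0 : I * conj c / z * (I * c / hatz q0 z) = 1 := by
    unfold hatz; field_simp; rw [I_sq]; linear_combination mul_conj_of_norm hc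
  have e1 : I * c / z * (I * conj c / hatz q0 z) = 1 := by
    unfold hatz; field_simp; rw [I_sq]; linear_combination mul_conj_of_norm hc
  have A := hF.col_zero_unique hc hz hzb ((hsol 1).const_mul (I * conj c / z)) (by
      have := (hlim1 0).const_mul (I * conj c / z)
      rw [Ebg_01, e0] at this
      simpa [mul_assoc] using this) (by
      have := (hlim1 1).const_mul (I * conj c / z)
      simpa [mul_assoc] using this) x
  have B := hF.col_one_unique hc hz hzb ((hsol 0).const_mul (I * c / z)) (by
      have := (hlim0 0).const_mul (I * c / z)
      simpa [mul_assoc] using this) (by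
      have := (hlim0 1).const_mul (I * c / z)
      rw [Ebg_10, e1] at this
      simpa [mul_assoc] using this) x
  fin_cases i
  · exact ⟨A.1, B.1⟩
  · exact ⟨A.2, B.2⟩

/-- The reflection `x ↦ -x`. -/
def reflectJost (F : ℝ → ℂ → Mat) (x : ℝ) (z : ℂ) : Mat :=
  !![F (-x) z 1 1, F (-x) z 1 0; F (-x) z 0 1, F (-x) z 0 0]

/-- Exchanging rows as well as columns absorbs the sign from `x ↦ -x`, the potential becoming `conj
(u (-x))`. All asymptotic analysis can thus be carried out at `x → +∞`. -/
lemma IsJostMat.reflect (hF : IsJostMat q0 t u c atBot F) :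
    IsJostMat q0 (-t) (fun x => conj (u (-x))) (conj c) atTop (reflectJost F) := by
  have hsol : ∀ z ∈ Sig, ∀ j, LaxSol q0 (fun x => conj (u (-x))) z (fun x => F (-x) z 1 j)
      (fun x => F (-x) z 0 j) := by
    intro z hz j x
    have h := hF.sol z hz j (-x)
    have h1 := h.1.scomp x (hasDerivAt_neg x)
    have h2 := h.2.scomp x (hasDerivAt_neg x)
    refine ⟨h2.congr_deriv ?_, h1.congr_deriv ?_⟩
    · simp
    · simp; ring
  refine ⟨?_, ?_, ?_⟩
  · intro z hz j
    fin_cases j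
    · exact hsol z hz 1
    · exact hsol z hz 0
  · intro z hz i
    have h0 := (hF.lim1 z hz 0).comp tendsto_neg_atTop_atBot
    have h1 := (hF.lim1 z hz 1).comp tendsto_neg_atTop_atBot
    simp only [Function.comp_def, theta_reflect, mul_neg] at h0 h1
    fin_cases i
    · simpa [reflectJost] using h1
    · simpa [reflectJost] using h0
  · intro z hz i
    have h0 := (hF.lim0 z hz 0).comp tendsto_neg_atTop_atBot
    have h1 := (hF.lim0 z hz 1).comp tendsto_neg_atTop_atBot
    simp only [Function.comp_def, theta_reflect, mul_neg, neg_neg] at h0 h1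
    fin_cases i
    · simpa [reflectJost] using h1
    · simpa [reflectJost] using h0

end Jost

/-! ### Holomorphic parameter integrals -/

/-- For holomorphic integrands no bound on derivatives has to be assumed: Cauchy's estimate on discs
of radius `r/2` turns the domination by `w` into the Lipschitz constant `w / (r/2)`. -/
theorem differentiableOn_integral_of_dominated {α : Type*} [MeasurableSpace α] {μ : Measure α}
    {F : ℂ → α → ℂ} {U : Set ℂ} {w : α → ℝ} (hU : IsOpen U)
    (hm : ∀ z ∈ U, AEStronglyMeasurable (F z) μ)
    (hd : ∀ᵐ a ∂μ, DifferentiableOn ℂ (fun z => F z a) U)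
    (hb : ∀ᵐ a ∂μ, ∀ z ∈ U, ‖F z a‖ ≤ w a) (hw : Integrable w μ) :
    DifferentiableOn ℂ (fun z => ∫ a, F z a ∂μ) U := by
  intro z0 hz0
  obtain ⟨r, hr, hball⟩ := Metric.isOpen_iff.1 hU z0 hz0
  have hr2 : 0 < r / 2 := by linarith
  have hsub : Metric.ball z0 (r / 2) ⊆ U := (Metric.ball_subset_ball (by linarith)).trans hball
  -- The derivative is a pointwise limit of difference quotients along a sequence of increments
  -- tending to zero, hence measurable in the parameter.
  have hderiv : AEStronglyMeasurable (fun a => deriv (fun z => F z a) z0) μ := by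
    have hlim : ∀ n : ℕ, ‖((r / 2 / (n + 1) : ℝ) : ℂ)‖ ≤ r / 2 := by
      intro n
      rw [norm_real, Real.norm_of_nonneg (by positivity)]
      exact div_le_self hr2.le (by linarith [(Nat.cast_nonneg n : (0 : ℝ) ≤ n)])
    refine aestronglyMeasurable_of_tendsto_ae atTop
      (f := fun (n : ℕ) a => (((r / 2 / (n + 1) : ℝ) : ℂ))⁻¹ •
        (F (z0 + ((r / 2 / (n + 1) : ℝ) : ℂ)) a - F z0 a)) ?_ ?_
    · intro n
      refine AEStronglyMeasurable.const_smul ((hm _ (hball ?_)).sub (hm z0 hz0))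
        ((((r / 2 / (n + 1) : ℝ) : ℂ))⁻¹)
      rw [mem_ball_iff_norm, add_sub_cancel_left]
      exact (hlim n).trans_lt (by linarith)
    · filter_upwards [hd] with a ha
      have h := ((ha.differentiableAt (hU.mem_nhds hz0)).hasDerivAt).tendsto_slope_zero
      refine h.comp (tendsto_nhdsWithin_iff.2 ⟨?_, ?_⟩)
      · have h1 : Tendsto (fun n : ℕ => r / 2 / ((n : ℝ) + 1)) atTop (𝓝 0) :=
          tendsto_const_nhds.div_atTop
            (tendsto_natCast_atTop_atTop.atTop_add tendsto_const_nhds)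
        have := (continuous_ofReal.tendsto 0).comp h1
        simpa [Function.comp_def] using this
      · refine Eventually.of_forall fun n => ?_
        have : r / 2 / ((n : ℝ) + 1) ≠ 0 := by positivity
        exact ofReal_ne_zero.2 this
  refine (hasDerivAt_integral_of_dominated_loc_of_lip (F := F)
    (F' := fun a => deriv (fun z => F z a) z0) (bound := fun a => w a / (r / 2))
    (Metric.ball_mem_nhds z0 hr2) ?_ ?_ hderiv ?_ (hw.div_const _)
    ?_).2.differentiableAt.differentiableWithinAt
  · filter_upwards [hU.mem_nhds hz0] with z hz using hm z hz
  · refine hw.mono' (hm z0 hz0) ?_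
    filter_upwards [hb] with a ha using ha z0 hz0
  · filter_upwards [hd, hb] with a ha hba
    refine (convex_ball z0 (r / 2)).lipschitzOnWith_of_nnnorm_deriv_le ?_ ?_
    · intro z hz
      exact ha.differentiableAt (hU.mem_nhds (hsub hz))
    · intro z hz
      have hcl : Metric.closedBall z (r / 2) ⊆ U := by
        refine Subset.trans ?_ hball
        intro y hy
        have h1 := Metric.mem_closedBall.1 hy
        have h2 := Metric.mem_ball.1 hz
        exact Metric.mem_ball.2 ((dist_triangle y z z0).trans_lt (by linarith))
      have h1 := Complex.norm_deriv_le_of_forall_mem_sphere_norm_le (c := z) (C := w a) hr2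
        (f := fun z => F z a) (ha.diffContOnCl_ball hcl)
        (fun y hy => hba y (hcl (Metric.sphere_subset_closedBall hy)))
      rw [← NNReal.coe_le_coe, coe_nnnorm, Real.coe_nnabs]
      exact h1.trans (le_abs_self _)
  · filter_upwards [hd] with a ha
    exact (ha.differentiableAt (hU.mem_nhds hz0)).hasDerivAt

/-! ### Volterra operators depending holomorphically on a parameter -/

/-- `h x z` is continuous in `x`, continuous in `z ∈ Ω`, holomorphic in `z ∈ U` and dominated by
`w x`. -/
structure HolFamily (Ω U : Set ℂ) (w : ℝ → ℝ) (h : ℝ → ℂ → ℂ) : Prop where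
  cont : ∀ z ∈ Ω, Continuous fun x => h x z
  contOn : ∀ x, ContinuousOn (h x) Ω
  diffOn : ∀ x, DifferentiableOn ℂ (h x) U
  bound : ∀ x, ∀ z ∈ Ω, ‖h x z‖ ≤ w x

/-- `∫_x^∞ e^{2iκ(y-x)} h(y) dy`. -/
def volterra (κ : ℂ → ℂ) (h : ℝ → ℂ → ℂ) (x : ℝ) (z : ℂ) : ℂ :=
  ∫ y in Ioi x, exp (2 * I * κ z * ((y : ℂ) - x)) * h y z

section Volterra

variable {Ω U : Set ℂ} {w w' : ℝ → ℝ} {h h' : ℝ → ℂ → ℂ} {κ : ℂ → ℂ} {x : ℝ} {z : ℂ}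

lemma HolFamily.mul {b : ℝ} (hh : HolFamily Ω U w h) (hh' : HolFamily Ω U (fun _ => b) h') :
    HolFamily Ω U (fun x => b * w x) (fun x z => h x z * h' x z) := by
  refine ⟨fun z hz => (hh.cont z hz).mul (hh'.cont z hz), fun x => (hh.contOn x).mul (hh'.contOn x),
    fun x => (hh.diffOn x).mul (hh'.diffOn x), fun x z hz => ?_⟩
  rw [norm_mul, mul_comm b]
  exact mul_le_mul (hh.bound x z hz) (hh'.bound x z hz) (norm_nonneg _)
    ((norm_nonneg _).trans (hh.bound x z hz))

lemma HolFamily.add (hh : HolFamily Ω U w h) (hh' : HolFamily Ω U w' h') :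
    HolFamily Ω U (fun x => w x + w' x) (fun x z => h x z + h' x z) :=
  ⟨fun z hz => (hh.cont z hz).add (hh'.cont z hz), fun x => (hh.contOn x).add (hh'.contOn x),
    fun x => (hh.diffOn x).add (hh'.diffOn x),
    fun x z hz => (norm_add_le _ _).trans (add_le_add (hh.bound x z hz) (hh'.bound x z hz))⟩

lemma norm_exp_volterra_le {a y : ℝ} {c : ℂ} (hc : 0 ≤ c.im) (hy : a ≤ y) :
    ‖exp (2 * I * c * ((y : ℂ) - a))‖ ≤ 1 := by
  rw [norm_exp]
  have : (2 * I * c * ((y : ℂ) - a)).re = -(2 * c.im * (y - a)) := by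
    simp
  rw [this]
  refine Real.exp_le_one_iff.2 ?_
  have := mul_nonneg hc (sub_nonneg.2 hy)
  linarith

lemma norm_volterra_integrand_le (hκ : 0 ≤ (κ z).im) (hb : ∀ x, ‖h x z‖ ≤ w x) :
    ∀ᵐ y : ℝ ∂(volume.restrict (Ioi x)), ‖exp (2 * I * κ z * ((y : ℂ) - x)) * h y z‖ ≤ w y := by
  refine (ae_restrict_iff' measurableSet_Ioi).2 (Eventually.of_forall fun y hy => ?_)
  rw [norm_mul]
  exact (mul_le_of_le_one_left (norm_nonneg _)
    (norm_exp_volterra_le hκ (le_of_lt hy))).trans (hb y)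

lemma norm_volterra_le (hw : Integrable w) (hκ : 0 ≤ (κ z).im) (hb : ∀ x, ‖h x z‖ ≤ w x) :
    ‖volterra κ h x z‖ ≤ ∫ y in Ioi x, w y :=
  norm_integral_le_of_norm_le hw.integrableOn (norm_volterra_integrand_le hκ hb)

lemma norm_volterra_le' (hw : Integrable w) (hκ : 0 ≤ (κ z).im) (hb : ∀ x, ‖h x z‖ ≤ w x) :
    ‖volterra κ h x z‖ ≤ ∫ y, w y :=
  (norm_volterra_le hw hκ hb).trans (setIntegral_le_integral hw
    (Eventually.of_forall fun y => (norm_nonneg _).trans (hb y)))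

lemma volterra_integrable (hw : Integrable w) (hκ : 0 ≤ (κ z).im) (hc : Continuous fun x => h x z)
    (hb : ∀ x, ‖h x z‖ ≤ w x) :
    IntegrableOn (fun y : ℝ => exp (2 * I * κ z * ((y : ℂ) - x)) * h y z) (Ioi x) :=
  hw.integrableOn.mono' (Continuous.aestronglyMeasurable (by fun_prop))
    (norm_volterra_integrand_le hκ hb)

lemma norm_volterra_sub_le (hw : Integrable w) (hw' : Integrable w') (hκ : 0 ≤ (κ z).im)
    (hc : Continuous fun x => h x z) (hc' : Continuous fun x => h' x z)
    (hb : ∀ x, ‖h x z‖ ≤ w x) (hb' : ∀ x, ‖h' x z‖ ≤ w x)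
    (hs : ∀ x, ‖h x z - h' x z‖ ≤ w' x) :
    ‖volterra κ h x z - volterra κ h' x z‖ ≤ ∫ y, w' y := by
  have : volterra κ h x z - volterra κ h' x z
      = volterra κ (fun x z => h x z - h' x z) x z := by
    unfold volterra
    rw [← integral_sub (volterra_integrable hw hκ hc hb) (volterra_integrable hw hκ hc' hb')]
    simp only [mul_sub]
  rw [this]
  exact norm_volterra_le' hw' hκ hs

lemma tendsto_setIntegral_Ioi (hw : Integrable w) :
    Tendsto (fun x => ∫ y in Ioi x, w y) atTop (𝓝 0) := by
  have h1 := (aecover_Iic (μ := (volume : Measure ℝ)) (tendsto_id (α := ℝ) (x := atTop))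
    ).integral_tendsto_of_countably_generated hw
  have h2 := (tendsto_const_nhds (x := ∫ y, w y)).sub h1
  rw [sub_self] at h2
  refine h2.congr fun x => ?_
  have := integral_add_compl (measurableSet_Iic (a := x)) hw
  rw [compl_Iic] at this
  simp only [id]
  linarith

lemma tendsto_volterra (hw : Integrable w) (hκ : 0 ≤ (κ z).im) (hb : ∀ x, ‖h x z‖ ≤ w x) :
    Tendsto (fun x => volterra κ h x z) atTop (𝓝 0) :=
  squeeze_zero_norm (fun _ => norm_volterra_le hw hκ hb) (tendsto_setIntegral_Ioi hw)

lemma hasDerivAt_integral_Ioi {E : Type*} [NormedAddCommGroup E] [NormedSpace ℝ E]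
    [CompleteSpace E] {g : ℝ → E} (hg : Continuous g)
    (hi : ∀ a, IntegrableOn g (Ioi a)) (x : ℝ) :
    HasDerivAt (fun x => ∫ y in Ioi x, g y) (-g x) x := by
  have h1 := (intervalIntegral.integral_hasDerivAt_right (hg.intervalIntegrable (x - 1) x)
    (hg.stronglyMeasurableAtFilter _ _) hg.continuousAt).const_sub (∫ y in Ioi (x - 1), g y)
  refine h1.congr_of_eventuallyEq (Eventually.of_forall fun y => ?_)
  have := intervalIntegral.integral_interval_add_Ioi (hi (x - 1)) (hi y)
  simp only
  rw [← this, add_sub_cancel_left]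

/-- The kernel splits as `e^{-2iκx} e^{2iκy}`, so the fundamental theorem of calculus applies to the
integral of the `y`-dependent factor. -/
lemma hasDerivAt_volterra (hw : Integrable w) (hκ : 0 ≤ (κ z).im) (hc : Continuous fun x => h x z)
    (hb : ∀ x, ‖h x z‖ ≤ w x) (x : ℝ) :
    HasDerivAt (fun x => volterra κ h x z) (-h x z - 2 * I * κ z * volterra κ h x z) x := by
  have hsplit : ∀ a y : ℝ, exp (2 * I * κ z * ((y : ℂ) - a)) * h y z
      = exp (-(2 * I * κ z * a)) * (exp (2 * I * κ z * y) * h y z) := by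
    intro a y
    rw [← mul_assoc, ← Complex.exp_add]
    congr 2
    ring
  have hi : ∀ a : ℝ, IntegrableOn (fun y : ℝ => exp (2 * I * κ z * y) * h y z) (Ioi a) := by
    intro a
    have := (volterra_integrable (x := a) hw hκ hc hb).const_mul (exp (2 * I * κ z * a))
    refine this.congr (Eventually.of_forall fun y => ?_)
    simp only
    rw [hsplit, ← mul_assoc, ← Complex.exp_add, add_neg_cancel, Complex.exp_zero, one_mul]
  have hV : ∀ a : ℝ, volterra κ h a z = exp (-(2 * I * κ z * a)) *
      ∫ y in Ioi a, exp (2 * I * κ z * (y : ℝ)) * h y z := by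
    intro a
    unfold volterra
    simp only [hsplit]
    exact integral_const_mul _ _
  have h1 : HasDerivAt (fun a : ℝ => exp (-(2 * I * κ z * a)))
      (exp (-(2 * I * κ z * x)) * (-(2 * I * κ z))) x := by
    refine HasDerivAt.cexp ?_
    exact (((hasDerivAt_id x).ofReal_comp.const_mul (2 * I * κ z)).neg).congr_deriv (by simp)
  have h2 := hasDerivAt_integral_Ioi (g := fun y : ℝ => exp (2 * I * κ z * y) * h y z)
    (by fun_prop) hi x
  have h3 := h1.mul h2
  refine (h3.congr_of_eventuallyEq (Eventually.of_forall hV)).congr_deriv ?_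
  have h4 : exp (-(2 * I * κ z * x)) * exp (2 * I * κ z * x) = 1 := by
    rw [← Complex.exp_add, neg_add_cancel, Complex.exp_zero]
  rw [hV x]
  linear_combination (-h x z) * h4

/-- For `Im κ ≥ 0` the kernel is bounded by one on `y ≥ x`, so the integrand is still dominated by
`w`, and continuity and holomorphy in `z` pass through the integral. -/
lemma HolFamily.volterra (hU : IsOpen U) (hUΩ : U ⊆ Ω) (hw : Integrable w)
    (hκ : ∀ z ∈ Ω, 0 ≤ (κ z).im) (hκc : ContinuousOn κ Ω) (hκd : DifferentiableOn ℂ κ U)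
    (hh : HolFamily Ω U w h) :
    HolFamily Ω U (fun _ => ∫ y, w y) (DNLS.volterra κ h) := by
  refine ⟨fun z hz => ?_, fun x => ?_, fun x => ?_, fun x z hz => ?_⟩
  · exact continuous_iff_continuousAt.2 fun x => (hasDerivAt_volterra hw (hκ z hz) (hh.cont z hz)
      (fun x => hh.bound x z hz) x).continuousAt
  · refine continuousOn_of_dominated (bound := w) (fun z hz => ?_) (fun z hz => ?_)
      hw.integrableOn (Eventually.of_forall fun y => ?_)
    · have := hh.cont z hz
      exact Continuous.aestronglyMeasurable (by fun_prop)
    · exact norm_volterra_integrand_le (hκ z hz) fun x => hh.bound x z hz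
    · exact ((continuousOn_const.mul hκc).mul continuousOn_const).cexp.mul (hh.contOn y)
  · refine differentiableOn_integral_of_dominated (w := w) hU (fun z hz => ?_)
      (Eventually.of_forall fun y => ?_) ?_ hw.integrableOn
    · have := hh.cont z (hUΩ hz)
      exact Continuous.aestronglyMeasurable (by fun_prop)
    · exact (((differentiableOn_const _).mul hκd).mul (differentiableOn_const _)).cexp.mul
        (hh.diffOn y)
    · refine (ae_restrict_iff' measurableSet_Ioi).2 (Eventually.of_forall fun y hy z hz => ?_)
      rw [norm_mul]
      exact (mul_le_of_le_one_left (norm_nonneg _)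
        (norm_exp_volterra_le (hκ z (hUΩ hz)) (le_of_lt hy))).trans (hh.bound y z (hUΩ hz))
  · exact norm_volterra_le' hw (hκ z hz) fun x => hh.bound x z hz

/-- A geometrically convergent sequence of holomorphic families has a limit family. -/
lemma HolFamily.exists_limit {b : ℝ} {φ : ℕ → ℝ → ℂ → ℂ} (hU : IsOpen U) (hUΩ : U ⊆ Ω)
    (hφ : ∀ k, HolFamily Ω U (fun _ => b) (φ k))
    (hs : ∀ k x, ∀ z ∈ Ω, ‖φ (k + 1) x z - φ k x z‖ ≤ (1 / 2) ^ k) :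
    ∃ ψ, HolFamily Ω U (fun _ => b) ψ ∧
      ∀ k x, ∀ z ∈ Ω, ‖φ k x z - ψ x z‖ ≤ 2 * (1 / 2) ^ k := by
  have hex : ∀ x z, ∃ L, z ∈ Ω → Tendsto (fun k => φ k x z) atTop (𝓝 L) := by
    intro x z
    by_cases hz : z ∈ Ω
    · have hc : CauchySeq fun k => φ k x z := by
        refine cauchySeq_of_le_geometric (1 / 2) 1 (by norm_num) fun k => ?_
        rw [one_mul, dist_comm, dist_eq_norm]
        exact hs k x z hz
      obtain ⟨L, hL⟩ := cauchySeq_tendsto_of_complete hc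
      exact ⟨L, fun _ => hL⟩
    · exact ⟨0, fun h => absurd h hz⟩
  choose ψ hψ using hex
  have hdist : ∀ k x, ∀ z ∈ Ω, ‖φ k x z - ψ x z‖ ≤ 2 * (1 / 2) ^ k := by
    intro k x z hz
    have := dist_le_of_le_geometric_of_tendsto (1 / 2) 1 (by norm_num) (f := fun k => φ k x z)
      (fun k => by rw [one_mul, dist_comm, dist_eq_norm]; exact hs k x z hz) (hψ x z hz) k
    rw [dist_eq_norm] at this
    refine this.trans (le_of_eq ?_)
    ring
  have h0 : Tendsto (fun k : ℕ => 2 * (1 / 2 : ℝ) ^ k) atTop (𝓝 0) := by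
    simpa using (tendsto_pow_atTop_nhds_zero_of_lt_one (r := (1 / 2 : ℝ)) (by norm_num)
      (by norm_num)).const_mul 2
  refine ⟨ψ, ⟨fun z hz => ?_, fun x => ?_, fun x => ?_, fun x z hz => ?_⟩, hdist⟩
  · have : TendstoUniformly (fun k x => φ k x z) (fun x => ψ x z) atTop := by
      rw [Metric.tendstoUniformly_iff]
      intro ε hε
      filter_upwards [h0.eventually_lt_const hε] with k hk x
      rw [dist_comm, dist_eq_norm]
      exact (hdist k x z hz).trans_lt hk
    exact this.continuous (Eventually.of_forall fun k => (hφ k).cont z hz).frequently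
  · have : TendstoUniformlyOn (fun k z => φ k x z) (fun z => ψ x z) atTop Ω := by
      rw [Metric.tendstoUniformlyOn_iff]
      intro ε hε
      filter_upwards [h0.eventually_lt_const hε] with k hk z hz
      rw [dist_comm, dist_eq_norm]
      exact (hdist k x z hz).trans_lt hk
    exact this.continuousOn (Eventually.of_forall fun k => (hφ k).contOn x).frequently
  · have : TendstoUniformlyOn (fun k z => φ k x z) (fun z => ψ x z) atTop U := by
      rw [Metric.tendstoUniformlyOn_iff]
      intro ε hε
      filter_upwards [h0.eventually_lt_const hε] with k hk z hz
      rw [dist_comm, dist_eq_norm]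
      exact (hdist k x z (hUΩ hz)).trans_lt hk
    exact this.tendstoLocallyUniformlyOn.differentiableOn
      (Eventually.of_forall fun k => (hφ k).diffOn x) hU
  · exact le_of_tendsto (hψ x z hz).norm (Eventually.of_forall fun k => (hφ k).bound x z hz)

end Volterra

/-! ### Picard iteration for a two-component Volterra system -/

/-- Data of a two-component Volterra system with small integrable coefficients. -/
structure VolterraData (Ω U : Set ℂ) (w : ℝ → ℝ) (κ : ℂ → ℂ) (a : Fin 2 → Fin 2 → ℝ → ℂ → ℂ) :
    Prop where
  isOpen : IsOpen U
  subset : U ⊆ Ω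
  integrable : Integrable w
  small : ∫ y, w y ≤ 1 / 8
  im_nonneg : ∀ z ∈ Ω, 0 ≤ (κ z).im
  contOn : ContinuousOn κ Ω
  diffOn : DifferentiableOn ℂ κ U
  coeff : ∀ i j, HolFamily Ω U w (a i j)

/-- The Picard iteration for the Volterra system. -/
def picard (κ : ℂ → ℂ) (a : Fin 2 → Fin 2 → ℝ → ℂ → ℂ) : ℕ → Fin 2 → ℝ → ℂ → ℂ
  | 0 => ![fun _ _ => 1, fun _ _ => 0]
  | k + 1 => ![
      fun x z => 1 - volterra (fun _ => 0)
        (fun x z => a 0 0 x z * picard κ a k 0 x z + a 0 1 x z * picard κ a k 1 x z) x z,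
      fun x z => -volterra κ
        (fun x z => a 1 0 x z * picard κ a k 0 x z + a 1 1 x z * picard κ a k 1 x z) x z]

section System

variable {Ω U : Set ℂ} {w : ℝ → ℝ} {κ : ℂ → ℂ} {a : Fin 2 → Fin 2 → ℝ → ℂ → ℂ}

lemma VolterraData.row (H : VolterraData Ω U w κ a) {b : ℝ} {n : Fin 2 → ℝ → ℂ → ℂ}
    (hn : ∀ j, HolFamily Ω U (fun _ => b) (n j)) (i : Fin 2) :
    HolFamily Ω U (fun x => b * w x + b * w x)
      (fun x z => a i 0 x z * n 0 x z + a i 1 x z * n 1 x z) :=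
  ((H.coeff i 0).mul (hn 0)).add ((H.coeff i 1).mul (hn 1))

lemma VolterraData.row_integrable (H : VolterraData Ω U w κ a) (b : ℝ) :
    Integrable fun x => b * w x + b * w x :=
  (H.integrable.const_mul b).add (H.integrable.const_mul b)

lemma VolterraData.row_integral (H : VolterraData Ω U w κ a) (b : ℝ) :
    ∫ x, (b * w x + b * w x) = 2 * b * ∫ x, w x := by
  rw [integral_add (H.integrable.const_mul b) (H.integrable.const_mul b), integral_const_mul]
  ring

/-- A row applied to functions bounded by `2` is dominated by `4w`, of integral at most `4 · (1/8) =
1/2`; the iterates therefore stay below `1 + 1/2 ≤ 2`. -/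
lemma VolterraData.picard_family (H : VolterraData Ω U w κ a) (k : ℕ) (i : Fin 2) :
    HolFamily Ω U (fun _ => 2) (picard κ a k i) := by
  induction k generalizing i with
  | zero =>
    fin_cases i
    · exact ⟨fun _ _ => continuous_const, fun _ => continuousOn_const,
        fun _ => differentiableOn_const _, fun _ _ _ => by simp [picard]⟩
    · exact ⟨fun _ _ => continuous_const, fun _ => continuousOn_const,
        fun _ => differentiableOn_const _, fun _ _ _ => by simp [picard]⟩
  | succ k ih =>
    have h0 := (H.row ih 0).volterra (κ := fun _ => 0) H.isOpen H.subset (H.row_integrable 2)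
      (fun _ _ => le_rfl) continuousOn_const (differentiableOn_const _)
    have h1 := (H.row ih 1).volterra H.isOpen H.subset (H.row_integrable 2) H.im_nonneg
      H.contOn H.diffOn
    rw [H.row_integral] at h0 h1
    have hs := H.small
    fin_cases i
    · refine ⟨fun z hz => continuous_const.sub (h0.cont z hz),
        fun x => continuousOn_const.sub (h0.contOn x),
        fun x => (differentiableOn_const _).sub (h0.diffOn x), fun x z hz => ?_⟩
      refine (norm_sub_le _ _).trans ?_
      have := h0.bound x z hz
      rw [norm_one]
      linarith
    · refine ⟨fun z hz => (h1.cont z hz).neg, fun x => (h1.contOn x).neg,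
        fun x => (h1.diffOn x).neg, fun x z hz => ?_⟩
      have := h1.bound x z hz
      refine (norm_neg _).trans_le ?_
      linarith

lemma VolterraData.row_sub_le (H : VolterraData Ω U w κ a) {b : ℝ} {n n' : Fin 2 → ℝ → ℂ → ℂ}
    {z : ℂ} (hz : z ∈ Ω) (hnn : ∀ j x, ‖n j x z - n' j x z‖ ≤ b) (i : Fin 2) (x : ℝ) :
    ‖(a i 0 x z * n 0 x z + a i 1 x z * n 1 x z)
      - (a i 0 x z * n' 0 x z + a i 1 x z * n' 1 x z)‖ ≤ b * w x + b * w x := by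
  have h1 : (a i 0 x z * n 0 x z + a i 1 x z * n 1 x z)
      - (a i 0 x z * n' 0 x z + a i 1 x z * n' 1 x z)
      = a i 0 x z * (n 0 x z - n' 0 x z) + a i 1 x z * (n 1 x z - n' 1 x z) := by ring
  rw [h1]
  refine (norm_add_le _ _).trans (add_le_add ?_ ?_) <;>
  · rw [norm_mul, mul_comm b]
    exact mul_le_mul ((H.coeff _ _).bound x z hz) (hnn _ x) (norm_nonneg _)
      ((norm_nonneg _).trans ((H.coeff i 0).bound x z hz))

/-- The contraction estimate: a row multiplies a uniform distance by at most `2 · (1/8) = 1/4`. The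
convergence argument only uses the weaker rate `1/2`. -/
lemma VolterraData.volterra_row_sub_le (H : VolterraData Ω U w κ a) {b : ℝ}
    {n n' : Fin 2 → ℝ → ℂ → ℂ} (hn : ∀ j, HolFamily Ω U (fun _ => 2) (n j))
    (hn' : ∀ j, HolFamily Ω U (fun _ => 2) (n' j)) {z : ℂ} (hz : z ∈ Ω)
    (hnn : ∀ j x, ‖n j x z - n' j x z‖ ≤ b) (i : Fin 2) {κ' : ℂ → ℂ} (hκ' : 0 ≤ (κ' z).im)
    (x : ℝ) :
    ‖volterra κ' (fun x z => a i 0 x z * n 0 x z + a i 1 x z * n 1 x z) x z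
      - volterra κ' (fun x z => a i 0 x z * n' 0 x z + a i 1 x z * n' 1 x z) x z‖ ≤ b / 4 := by
  have hb : 0 ≤ b := (norm_nonneg _).trans (hnn 0 0)
  refine (norm_volterra_sub_le (H.row_integrable 2) (H.row_integrable b) hκ'
    ((H.row hn i).cont z hz) ((H.row hn' i).cont z hz) (fun x => (H.row hn i).bound x z hz)
    (fun x => (H.row hn' i).bound x z hz) (H.row_sub_le hz hnn i)).trans ?_
  rw [H.row_integral]
  have := mul_le_mul_of_nonneg_left H.small hb
  linarith

lemma VolterraData.picard_sub_le (H : VolterraData Ω U w κ a) (k : ℕ) (i : Fin 2) (x : ℝ) {z : ℂ}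
    (hz : z ∈ Ω) : ‖picard κ a (k + 1) i x z - picard κ a k i x z‖ ≤ (1 / 2) ^ k := by
  induction k generalizing i x with
  | zero =>
    have hs := H.small
    have hr := H.row (H.picard_family 0)
    have hk := H.im_nonneg z hz
    fin_cases i
    · have := norm_volterra_le' (κ := fun _ => 0) (x := x) (H.row_integrable 2) (z := z) le_rfl
        (h := fun x z => a 0 0 x z * picard κ a 0 0 x z + a 0 1 x z * picard κ a 0 1 x z)
        (fun x => (hr 0).bound x z hz)
      rw [H.row_integral] at this
      have e : picard κ a (0 + 1) 0 x z - picard κ a 0 0 x z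
        = -volterra (fun _ => 0) (fun x z => a 0 0 x z * picard κ a 0 0 x z
          + a 0 1 x z * picard κ a 0 1 x z) x z := by simp [picard]
      simp only [Fin.zero_eta]
      rw [e, norm_neg, pow_zero]
      linarith
    · have := norm_volterra_le' (x := x) (H.row_integrable 2) hk
        (h := fun x z => a 1 0 x z * picard κ a 0 0 x z + a 1 1 x z * picard κ a 0 1 x z)
        (fun x => (hr 1).bound x z hz)
      rw [H.row_integral] at this
      have e : picard κ a (0 + 1) 1 x z - picard κ a 0 1 x z
        = -volterra κ (fun x z => a 1 0 x z * picard κ a 0 0 x z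
          + a 1 1 x z * picard κ a 0 1 x z) x z := by simp [picard]
      simp only [Fin.mk_one]
      rw [e, norm_neg, pow_zero]
      linarith
  | succ k ih =>
    have hp : (0 : ℝ) < (1 / 2) ^ k := by positivity
    have key := fun i (κ' : ℂ → ℂ) (hκ' : 0 ≤ (κ' z).im) => H.volterra_row_sub_le
      (H.picard_family (k + 1)) (H.picard_family k) hz (fun j x => ih j x) i hκ' x
    fin_cases i
    · have := key 0 (fun _ => 0) le_rfl
      refine (norm_sub_rev _ _).trans_le ?_
      have e : picard κ a (k + 1) 0 x z - picard κ a (k + 1 + 1) 0 x z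
        = volterra (fun _ => 0) (fun x z => a 0 0 x z * picard κ a (k + 1) 0 x z
            + a 0 1 x z * picard κ a (k + 1) 1 x z) x z
          - volterra (fun _ => 0) (fun x z => a 0 0 x z * picard κ a k 0 x z
            + a 0 1 x z * picard κ a k 1 x z) x z := by
        show (1 - _) - (1 - _) = _
        ring
      simp only [Fin.zero_eta]
      rw [e, pow_succ]
      linarith
    · have := key 1 κ (H.im_nonneg z hz)
      refine (norm_sub_rev _ _).trans_le ?_
      have e : picard κ a (k + 1) 1 x z - picard κ a (k + 1 + 1) 1 x z
        = volterra κ (fun x z => a 1 0 x z * picard κ a (k + 1) 0 x z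
            + a 1 1 x z * picard κ a (k + 1) 1 x z) x z
          - volterra κ (fun x z => a 1 0 x z * picard κ a k 0 x z
            + a 1 1 x z * picard κ a k 1 x z) x z := by
        show (-_) - (-_) = _
        ring
      simp only [Fin.mk_one]
      rw [e, pow_succ]
      linarith

/-- The Volterra system has a bounded solution, holomorphic in the parameter. -/
theorem VolterraData.exists_solution (H : VolterraData Ω U w κ a) :
    ∃ n : Fin 2 → ℝ → ℂ → ℂ, (∀ i, HolFamily Ω U (fun _ => 2) (n i)) ∧
      ∀ z ∈ Ω, ∀ x,
        n 0 x z = 1 - volterra (fun _ => 0)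
          (fun x z => a 0 0 x z * n 0 x z + a 0 1 x z * n 1 x z) x z ∧
        n 1 x z = -volterra κ (fun x z => a 1 0 x z * n 0 x z + a 1 1 x z * n 1 x z) x z := by
  have hlim := fun i => HolFamily.exists_limit H.isOpen H.subset
    (fun k => H.picard_family k i) (fun k x z hz => H.picard_sub_le k i x hz)
  choose n hn hd using hlim
  refine ⟨n, hn, fun z hz x => ?_⟩
  have h0 : Tendsto (fun k : ℕ => 2 * (1 / 2 : ℝ) ^ k) atTop (𝓝 0) := by
    simpa using (tendsto_pow_atTop_nhds_zero_of_lt_one (r := (1 / 2 : ℝ)) (by norm_num)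
      (by norm_num)).const_mul 2
  have hpt : ∀ i, Tendsto (fun k => picard κ a k i x z) atTop (𝓝 (n i x z)) := by
    intro i
    rw [tendsto_iff_norm_sub_tendsto_zero]
    exact squeeze_zero (fun _ => norm_nonneg _) (fun k => hd i k x z hz) h0
  have hvol : ∀ i (κ' : ℂ → ℂ), 0 ≤ (κ' z).im →
      Tendsto (fun k => volterra κ' (fun x z => a i 0 x z * picard κ a k 0 x z
        + a i 1 x z * picard κ a k 1 x z) x z) atTop
        (𝓝 (volterra κ' (fun x z => a i 0 x z * n 0 x z + a i 1 x z * n 1 x z) x z)) := by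
    intro i κ' hκ'
    rw [tendsto_iff_norm_sub_tendsto_zero]
    refine squeeze_zero (fun _ => norm_nonneg _) (fun k => H.volterra_row_sub_le
      (H.picard_family k) hn hz (fun j x => hd j k x z hz) i hκ' x) ?_
    simpa using h0.div_const 4
  constructor
  · refine tendsto_nhds_unique ((hpt 0).comp (tendsto_add_atTop_nat 1)) ?_
    exact tendsto_const_nhds.sub (hvol 0 (fun _ => 0) le_rfl)
  · refine tendsto_nhds_unique ((hpt 1).comp (tendsto_add_atTop_nat 1)) ?_
    exact (hvol 1 κ (H.im_nonneg z hz)).neg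

end System

/-! ### Large-`z` behaviour of the Jost columns -/

lemma differentiableAt_kz {q0 : ℝ} {z : ℂ} (hz : z ≠ 0) : DifferentiableAt ℂ (kz q0) z :=
  (differentiableAt_id.sub ((differentiableAt_const _).div differentiableAt_id hz)).div_const 2

lemma differentiableAt_lamz {q0 : ℝ} {z : ℂ} (hz : z ≠ 0) : DifferentiableAt ℂ (lamz q0) z :=
  (differentiableAt_id.add ((differentiableAt_const _).div differentiableAt_id hz)).div_const 2

lemma differentiableAt_theta {q0 x t : ℝ} {z : ℂ} (hz : z ≠ 0) :
    DifferentiableAt ℂ (theta q0 x t) z := by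
  have h1 := differentiableAt_kz (q0 := q0) hz
  have h2 := differentiableAt_lamz (q0 := q0) hz
  unfold theta
  fun_prop

/-- The sign of `Im (kλ)` is that of `re z · im z`. Hence `e^{2ikλ(y - x)}` with `y ≥ x` is bounded
by one on `D⁺ ∪ Σ`, as the Volterra system requires. -/
lemma kz_mul_lamz_im {q0 : ℝ} {z : ℂ} (hz : z ≠ 0) :
    (kz q0 z * lamz q0 z).im = z.re * z.im * (1 + q0 ^ 4 / normSq z ^ 2) / 2 := by
  have hn : normSq z ≠ 0 := (normSq_pos.2 hz).ne'
  have e : kz q0 z * lamz q0 z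
      = ((1 / 4 : ℝ) : ℂ) * (z ^ 2 - ((q0 ^ 4 / normSq z ^ 2 : ℝ) : ℂ) * (conj z) ^ 2) := by
    rw [kz_mul_lamz hz]
    have h1 : ((normSq z : ℝ) : ℂ) = z * conj z := (mul_conj z).symm
    have h2 : conj z ≠ 0 := by simpa using hz
    push_cast
    rw [h1]
    field_simp
  rw [e, im_ofReal_mul, sub_im, im_ofReal_mul]
  simp only [pow_two, mul_im, conj_re, conj_im]
  ring

lemma extReg_lt_norm {R : ℝ} {z : ℂ} (hz : z ∈ extReg R) : R / 2 < ‖z‖ := by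
  have h1 := abs_re_le_norm z
  have h2 := abs_im_le_norm z
  have h3 : R < |z.re| + |z.im| := hz
  linarith

lemma mem_extReg_of_lt_norm {R : ℝ} {z : ℂ} (hz : R < ‖z‖) : z ∈ extReg R :=
  hz.trans_le (norm_le_abs_re_add_abs_im z)

/-- A potential at a fixed time, as seen from `x → +∞`. -/
structure RightPotential (q0 : ℝ) (u : ℝ → ℂ) (c : ℂ) : Prop where
  pos : 0 < q0
  norm_eq : ‖c‖ = q0
  smooth : ContDiff ℝ 1 u
  lim : Tendsto u atTop (𝓝 c)
  bounded : ∃ K, ∀ x, ‖u x‖ ≤ K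
  int_sq : Integrable fun x => ‖u x‖ ^ 2 - q0 ^ 2
  int_deriv : Integrable (deriv u)

/-- `v_+(x) = -(1/2) ∫_x^∞ (|u|² - q₀²)`. -/
def vPlus (q0 : ℝ) (u : ℝ → ℂ) (x : ℝ) : ℝ := -(1 / 2) * ∫ y in Ioi x, (‖u y‖ ^ 2 - q0 ^ 2)

/-- Coefficients of the system satisfied by the renormalised Jost column. -/
def wkbCoeff (q0 : ℝ) (u : ℝ → ℂ) (i j : Fin 2) (x : ℝ) (z : ℂ) : ℂ :=
  ![![-(I / 2 * ((q0 : ℂ) ^ 2 + u x * conj (u x)) * (u x * conj (u x) - (q0 : ℂ) ^ 2)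
        + u x * conj (deriv u x)),
      exp (-(I * vPlus q0 u x)) ^ 2 *
        (-(kz q0 z * (u x * conj (u x) - (q0 : ℂ) ^ 2) * u x) - I * z * deriv u x)],
    ![exp (I * vPlus q0 u x) ^ 2 *
        (kz q0 z * (u x * conj (u x) - (q0 : ℂ) ^ 2) * conj (u x) - I * z * conj (deriv u x)),
      I / 2 * ((q0 : ℂ) ^ 2 + u x * conj (u x)) * (u x * conj (u x) - (q0 : ℂ) ^ 2)
        - conj (u x) * deriv u x]] i j / (z ^ 2 + u x * conj (u x))

section Core

variable {q0 : ℝ} {u : ℝ → ℂ} {c : ℂ}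

lemma sq_sub_eq (x : ℝ) : u x * conj (u x) - (q0 : ℂ) ^ 2 = ((‖u x‖ ^ 2 - q0 ^ 2 : ℝ) : ℂ) := by
  rw [mul_conj, normSq_eq_norm_sq]; push_cast; rfl

lemma RightPotential.cont (hu : RightPotential q0 u c) : Continuous u := hu.smooth.continuous

lemma RightPotential.cont_deriv (hu : RightPotential q0 u c) : Continuous (deriv u) :=
  hu.smooth.continuous_deriv le_rfl

lemma RightPotential.hasDerivAt (hu : RightPotential q0 u c) (x : ℝ) :
    HasDerivAt u (deriv u x) x :=
  (hu.smooth.differentiable one_ne_zero x).hasDerivAt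

lemma RightPotential.hasDerivAt_vPlus (hu : RightPotential q0 u c) (x : ℝ) :
    HasDerivAt (vPlus q0 u) ((‖u x‖ ^ 2 - q0 ^ 2) / 2) x := by
  have hc := hu.cont
  have := (hasDerivAt_integral_Ioi (g := fun y => ‖u y‖ ^ 2 - q0 ^ 2) (by fun_prop)
    (fun a => hu.int_sq.integrableOn) x).const_mul (-(1 / 2) : ℝ)
  exact this.congr_deriv (by ring)

lemma RightPotential.cont_vPlus (hu : RightPotential q0 u c) : Continuous (vPlus q0 u) :=
  continuous_iff_continuousAt.2 fun x => (hu.hasDerivAt_vPlus x).continuousAt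

lemma RightPotential.tendsto_vPlus (hu : RightPotential q0 u c) :
    Tendsto (vPlus q0 u) atTop (𝓝 0) := by
  have := (tendsto_setIntegral_Ioi hu.int_sq).const_mul (-(1 / 2) : ℝ)
  rwa [mul_zero] at this

lemma norm_exp_I_mul_real (r : ℝ) : ‖exp (I * r)‖ = 1 := by
  rw [mul_comm, norm_exp_ofReal_mul_I]

lemma norm_exp_neg_I_mul_real (r : ℝ) : ‖exp (-(I * r))‖ = 1 := by
  rw [exp_neg, norm_inv, norm_exp_I_mul_real, inv_one]

/-- The hypothesis on `‖z‖` makes `|u|²` at most half of `‖z‖²`, which keeps the denominator of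
`wkbCoeff` away from zero uniformly in `x`. -/
lemma wkb_denom {K x : ℝ} {z : ℂ} (hK : ‖u x‖ ≤ K) (hz : 2 * K ^ 2 ≤ ‖z‖ ^ 2) :
    ‖z‖ ^ 2 / 2 ≤ ‖z ^ 2 + u x * conj (u x)‖ := by
  have h1 : ‖u x * conj (u x)‖ ≤ K ^ 2 := by
    rw [norm_mul, RCLike.norm_conj, ← pow_two]
    exact pow_le_pow_left₀ (norm_nonneg _) hK 2
  have h2 := norm_sub_norm_le (z ^ 2) (-(u x * conj (u x)))
  rw [norm_neg, sub_neg_eq_add, norm_pow] at h2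
  linarith

lemma norm_kz_le {z : ℂ} (h0 : 0 < q0) (hz : q0 ≤ ‖z‖) : ‖kz q0 z‖ ≤ ‖z‖ := by
  have hzp : 0 < ‖z‖ := h0.trans_le hz
  unfold kz
  rw [norm_div, RCLike.norm_ofNat]
  have h1 : ‖(q0 : ℂ) ^ 2 / z‖ ≤ ‖z‖ := by
    rw [norm_div, norm_pow, norm_real, Real.norm_of_nonneg h0.le, div_le_iff₀ hzp, ← pow_two]
    exact pow_le_pow_left₀ h0.le hz 2
  have := norm_sub_le z ((q0 : ℂ) ^ 2 / z)
  linarith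

/-- The coefficients are `O(1/z)` with an integrable profile. -/
lemma norm_wkbCoeff_le {K x : ℝ} {z : ℂ} (h0 : 0 < q0) (hK : ‖u x‖ ≤ K) (hz1 : 1 ≤ ‖z‖)
    (hzq : q0 ≤ ‖z‖) (hzK : 2 * K ^ 2 ≤ ‖z‖ ^ 2) (i j : Fin 2) :
    ‖wkbCoeff q0 u i j x z‖ ≤ 2 * (q0 ^ 2 + K ^ 2 + K + 1) / ‖z‖ *
      (|‖u x‖ ^ 2 - q0 ^ 2| + ‖deriv u x‖) := by
  have hK0 : 0 ≤ K := (norm_nonneg _).trans hK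
  have hzp : 0 < ‖z‖ := by linarith
  have hden := wkb_denom hK hzK
  have hden0 : 0 < ‖z‖ ^ 2 / 2 := by positivity
  set p : ℝ := ‖u x‖ ^ 2 - q0 ^ 2 with hp
  have hpn : ‖((p : ℝ) : ℂ)‖ = |p| := by rw [norm_real, Real.norm_eq_abs]
  have hp0 := abs_nonneg p
  set m : ℝ := ‖deriv u x‖ with hm
  have hm0 : 0 ≤ m := norm_nonneg _
  set L : ℝ := q0 ^ 2 + K ^ 2 + K + 1 with hL
  have hL1 : K + 1 ≤ L := by rw [hL]; nlinarith [sq_nonneg q0, sq_nonneg K]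
  have hk := norm_kz_le h0 hzq
  have hq2 : ‖(q0 : ℂ) ^ 2 + u x * conj (u x)‖ ≤ q0 ^ 2 + K ^ 2 := by
    refine (norm_add_le _ _).trans (add_le_add ?_ ?_)
    · rw [norm_pow, norm_real, Real.norm_of_nonneg h0.le]
    · rw [norm_mul, RCLike.norm_conj, ← pow_two]
      exact pow_le_pow_left₀ (norm_nonneg _) hK 2
  have hdiag : ‖I / 2 * ((q0 : ℂ) ^ 2 + u x * conj (u x)) * (u x * conj (u x) - (q0 : ℂ) ^ 2)‖
      ≤ (q0 ^ 2 + K ^ 2) * |p| := by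
    rw [sq_sub_eq, norm_mul, norm_mul, hpn, norm_div, norm_I, RCLike.norm_ofNat]
    refine mul_le_mul_of_nonneg_right ?_ hp0
    have := norm_nonneg ((q0 : ℂ) ^ 2 + u x * conj (u x))
    linarith
  have hud : ‖u x‖ * m ≤ K * m := mul_le_mul_of_nonneg_right hK hm0
  have hoff : ∀ a b : ℂ, ‖a‖ = ‖u x‖ → ‖b‖ = m →
      ‖kz q0 z * (u x * conj (u x) - (q0 : ℂ) ^ 2) * a‖ + ‖I * z * b‖ ≤ L * (|p| + m) * ‖z‖ := by
    intro a b ha hb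
    rw [sq_sub_eq, norm_mul, norm_mul, norm_mul, norm_mul, hpn, ha, hb, norm_I, one_mul]
    have h1 : ‖kz q0 z‖ * |p| * ‖u x‖ ≤ ‖z‖ * |p| * K := by gcongr
    have h2 : K * |p| + m ≤ L * (|p| + m) := by nlinarith
    have h3 := mul_le_mul_of_nonneg_right h2 hzp.le
    nlinarith
  have hfin : ∀ N : ℂ, ‖N‖ ≤ L * (|p| + m) * ‖z‖ →
      ‖N / (z ^ 2 + u x * conj (u x))‖ ≤ 2 * L / ‖z‖ * (|p| + m) := by
    intro N hN
    rw [norm_div]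
    have : 0 ≤ L * (|p| + m) * ‖z‖ := (norm_nonneg _).trans hN
    refine (div_le_div₀ this hN hden0 hden).trans (le_of_eq ?_)
    field_simp
  have hz_le : ∀ r : ℝ, 0 ≤ r → r ≤ r * ‖z‖ := fun r hr => le_mul_of_one_le_right hr hz1
  have hd2 : (q0 ^ 2 + K ^ 2) * |p| + K * m ≤ L * (|p| + m) * ‖z‖ := by
    refine le_trans ?_ (hz_le _ (by positivity))
    rw [hL]
    nlinarith [sq_nonneg q0, sq_nonneg K, mul_nonneg hK0 hp0, mul_nonneg (sq_nonneg q0) hm0,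
      mul_nonneg (sq_nonneg K) hm0]
  unfold wkbCoeff
  refine hfin _ ?_
  fin_cases i <;> fin_cases j
  · simp only [Fin.zero_eta, Matrix.cons_val_zero]
    rw [norm_neg]
    refine (norm_add_le _ _).trans ((add_le_add hdiag ?_).trans hd2)
    rw [norm_mul, RCLike.norm_conj]; exact hud
  · simp only [Fin.zero_eta, Fin.mk_one, Matrix.cons_val_zero, Matrix.cons_val_one]
    rw [norm_mul, norm_pow, norm_exp_neg_I_mul_real, one_pow, one_mul]
    refine (norm_sub_le _ _).trans ?_
    rw [norm_neg]
    exact hoff _ _ rfl rfl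
  · simp only [Fin.zero_eta, Fin.mk_one, Matrix.cons_val_zero, Matrix.cons_val_one]
    rw [norm_mul, norm_pow, norm_exp_I_mul_real, one_pow, one_mul]
    exact (norm_sub_le _ _).trans (hoff _ _ (RCLike.norm_conj _) (RCLike.norm_conj _))
  · simp only [Fin.mk_one, Matrix.cons_val_one]
    refine (norm_sub_le _ _).trans ((add_le_add hdiag ?_).trans hd2)
    rw [norm_mul, RCLike.norm_conj]; exact hud

lemma RightPotential.wkb_family (hu : RightPotential q0 u c) {K R : ℝ} (hK : ∀ x, ‖u x‖ ≤ K)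
    (hR1 : 2 ≤ R) (hRq : 2 * q0 ≤ R) (hRK : 4 * K ≤ R) {Ω U : Set ℂ} (hΩ : Ω ⊆ extReg R)
    (hU : U ⊆ extReg R) (i j : Fin 2) :
    HolFamily Ω U (fun x => 2 * (q0 ^ 2 + K ^ 2 + K + 1) / (R / 2) *
      (|‖u x‖ ^ 2 - q0 ^ 2| + ‖deriv u x‖)) (wkbCoeff q0 u i j) := by
  have hK0 : 0 ≤ K := (norm_nonneg _).trans (hK 0)
  have hnorm : ∀ z ∈ extReg R, 1 ≤ ‖z‖ ∧ q0 ≤ ‖z‖ ∧ 2 * K ^ 2 ≤ ‖z‖ ^ 2 := by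
    intro z hz
    have h := extReg_lt_norm hz
    refine ⟨by linarith, by linarith, ?_⟩
    have : (2 * K) ^ 2 ≤ ‖z‖ ^ 2 := pow_le_pow_left₀ (by positivity) (by linarith) 2
    nlinarith [sq_nonneg K]
  have hden : ∀ z ∈ extReg R, ∀ x, z ^ 2 + u x * conj (u x) ≠ 0 := by
    intro z hz x
    have h := wkb_denom (hK x) (hnorm z hz).2.2
    have := (hnorm z hz).1
    exact norm_pos_iff.1 (lt_of_lt_of_le (by positivity) h)
  have hd : ∀ x, DifferentiableOn ℂ (wkbCoeff q0 u i j x) (extReg R) := by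
    intro x z hz
    have hz0 : z ≠ 0 := norm_pos_iff.1 (by linarith [(hnorm z hz).1])
    have hk := differentiableAt_kz (q0 := q0) hz0
    refine DifferentiableAt.differentiableWithinAt ?_
    unfold wkbCoeff
    refine DifferentiableAt.div ?_ (by fun_prop) (hden z hz x)
    fin_cases i <;> fin_cases j <;>
      simp only [Fin.zero_eta, Fin.mk_one, Matrix.cons_val_zero, Matrix.cons_val_one] <;> fun_prop
  refine ⟨fun z hz => ?_, fun x => ((hd x).continuousOn).mono hΩ, fun x => (hd x).mono hU,
    fun x z hz => ?_⟩
  · have h1 := hu.cont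
    have h2 := hu.cont_deriv
    have h3 := hu.cont_vPlus
    unfold wkbCoeff
    refine Continuous.div ?_ (by fun_prop) (hden z (hΩ hz))
    fin_cases i <;> fin_cases j <;>
      simp only [Fin.zero_eta, Fin.mk_one, Matrix.cons_val_zero, Matrix.cons_val_one] <;> fun_prop
  · have h := hnorm z (hΩ hz)
    refine (norm_wkbCoeff_le hu.pos (hK x) h.1 h.2.1 h.2.2 i j).trans ?_
    refine mul_le_mul_of_nonneg_right ?_ (by positivity)
    exact div_le_div_of_nonneg_left (by positivity) (by linarith)
      (extReg_lt_norm (hΩ hz)).le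

/-- The renormalisation turns solutions of the reduced system into solutions of the Lax equation. -/
lemma RightPotential.laxSol_of_system (hu : RightPotential q0 u c) (t : ℝ) {z : ℂ} (hz : z ≠ 0)
    (hden : ∀ x, z ^ 2 + u x * conj (u x) ≠ 0) {n0 n1 : ℝ → ℂ}
    (h0 : ∀ x, HasDerivAt n0 (wkbCoeff q0 u 0 0 x z * n0 x + wkbCoeff q0 u 0 1 x z * n1 x) x)
    (h1 : ∀ x, HasDerivAt n1 (wkbCoeff q0 u 1 0 x z * n0 x + wkbCoeff q0 u 1 1 x z * n1 x
      - 2 * I * (kz q0 z * lamz q0 z) * n1 x) x) :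
    LaxSol q0 u z
      (fun x => (exp (I * vPlus q0 u x) * n0 x + I / z * u x * exp (-(I * vPlus q0 u x)) * n1 x)
        * exp (I * theta q0 x t z))
      (fun x => (I / z * conj (u x) * exp (I * vPlus q0 u x) * n0 x
        + exp (-(I * vPlus q0 u x)) * n1 x) * exp (I * theta q0 x t z)) := by
  -- The ansatz is `[[1, iu/z], [i conj u/z, 1]] e^{iv₊σ₃} n e^{iθ}`: the background matrix `E`,
  -- with `u x` in place of its limit, diagonalises the equation to leading order for large `z`, and
  -- the phase `v₊` removes the remaining diagonal term `(i/2)(|u|² - q₀²)`. The remainder is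
  -- `wkbCoeff`.
  intro x
  have hv : HasDerivAt (fun x => exp (I * vPlus q0 u x))
      (exp (I * vPlus q0 u x) * (I * (((‖u x‖ ^ 2 - q0 ^ 2) / 2 : ℝ) : ℂ))) x :=
    ((hu.hasDerivAt_vPlus x).ofReal_comp.const_mul I).cexp
  have hv' : HasDerivAt (fun x => exp (-(I * vPlus q0 u x)))
      (exp (-(I * vPlus q0 u x)) * (-(I * (((‖u x‖ ^ 2 - q0 ^ 2) / 2 : ℝ) : ℂ)))) x :=
    ((hu.hasDerivAt_vPlus x).ofReal_comp.const_mul I).neg.cexp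
  have hth : HasDerivAt (fun x : ℝ => exp (I * theta q0 x t z))
      (exp (I * theta q0 x t z) * (I * (kz q0 z * lamz q0 z))) x := by
    refine HasDerivAt.cexp (HasDerivAt.const_mul I ?_)
    unfold theta
    exact (((hasDerivAt_id x).ofReal_comp.sub_const _).const_mul _).congr_deriv (by simp)
  have hud := hu.hasDerivAt x
  have hudc : HasDerivAt (fun x => conj (u x)) (conj (deriv u x)) x := hud.star
  have hp : (((‖u x‖ ^ 2 - q0 ^ 2) / 2 : ℝ) : ℂ) = (u x * conj (u x) - (q0 : ℂ) ^ 2) / 2 := by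
    rw [sq_sub_eq]; push_cast; ring
  have hee : exp (I * vPlus q0 u x) * exp (-(I * vPlus q0 u x)) = 1 := by
    rw [← Complex.exp_add, add_neg_cancel, Complex.exp_zero]
  rw [hp] at hv hv'
  have hD := hden x
  have hkl : kz q0 z * lamz q0 z = (z ^ 2 - (q0 : ℂ) ^ 4 / z ^ 2) / 4 := kz_mul_lamz hz
  have A0 := h0 x
  have A1 := h1 x
  simp only [wkbCoeff, Matrix.cons_val_zero, Matrix.cons_val_one] at A0 A1
  set e := exp (I * vPlus q0 u x) with he
  set e' := exp (-(I * vPlus q0 u x)) with he'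
  set T := exp (I * theta q0 x t z) with hT
  have hene : e ≠ 0 := exp_ne_zero _
  have heinv : e' = e⁻¹ := exp_neg _
  -- From here the exponentials are opaque, and `u`, its conjugate and their derivatives are
  -- independent variables: only an identity of rational functions is left.
  clear_value e e' T
  constructor
  · refine (((hv.mul A0).add (((hud.const_mul (I / z)).mul hv').mul A1)).mul hth).congr_deriv ?_
    simp only [Pi.mul_apply, Pi.add_apply, ← he, ← he', ← hT]
    rw [hkl, heinv]
    unfold kz
    generalize conj (u x) = v at *
    generalize conj (deriv u x) = w
    generalize deriv u x = d
    generalize u x = r at *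
    field_simp
    ring_nf
    simp only [I_sq]
    ring
  · refine ((((hudc.const_mul (I / z)).mul hv).mul A0).add (hv'.mul A1)).mul hth
      |>.congr_deriv ?_
    simp only [Pi.mul_apply, Pi.add_apply, ← he, ← he', ← hT]
    rw [hkl, heinv]
    unfold kz
    generalize conj (u x) = v at *
    generalize conj (deriv u x) = w
    generalize deriv u x = d
    generalize u x = r at *
    have hD' : z ^ 2 + v * r ≠ 0 := by rwa [mul_comm v r]
    field_simp
    ring_nf
    simp only [I_sq]
    ring

end Core

section Core

variable {q0 : ℝ} {u : ℝ → ℂ} {c : ℂ}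

/-- For large `z`, the renormalised system has a bounded solution near `(1, 0)`. -/
lemma RightPotential.exists_system_solution (hu : RightPotential q0 u c) :
    ∃ K L R : ℝ, 0 ≤ K ∧ 0 ≤ L ∧ 2 ≤ R ∧ 2 * q0 ≤ R ∧ 4 * K ≤ R ∧ (∀ x, ‖u x‖ ≤ K) ∧
      ∃ n : Fin 2 → ℝ → ℂ → ℂ,
        (∀ i x, ContinuousOn (n i x) ((Dp ∪ Sig) ∩ extReg R)) ∧
        (∀ i x, DifferentiableOn ℂ (n i x) (Dp ∩ extReg R)) ∧
        ∀ z ∈ (Dp ∪ Sig) ∩ extReg R,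
          (∀ x, HasDerivAt (fun x => n 0 x z)
            (wkbCoeff q0 u 0 0 x z * n 0 x z + wkbCoeff q0 u 0 1 x z * n 1 x z) x) ∧
          (∀ x, HasDerivAt (fun x => n 1 x z)
            (wkbCoeff q0 u 1 0 x z * n 0 x z + wkbCoeff q0 u 1 1 x z * n 1 x z
              - 2 * I * (kz q0 z * lamz q0 z) * n 1 x z) x) ∧
          Tendsto (fun x => n 0 x z) atTop (𝓝 1) ∧ Tendsto (fun x => n 1 x z) atTop (𝓝 0) ∧
          ∀ x, ‖n 0 x z - 1‖ ≤ L / ‖z‖ ∧ ‖n 1 x z‖ ≤ L / ‖z‖ ∧ ‖n 0 x z‖ ≤ 2 ∧ ‖n 1 x z‖ ≤ 2 := by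
  obtain ⟨K, hK⟩ := hu.bounded
  have hK0 : 0 ≤ K := (norm_nonneg _).trans (hK 0)
  have h0 := hu.pos
  set w0 : ℝ → ℝ := fun x => |‖u x‖ ^ 2 - q0 ^ 2| + ‖deriv u x‖ with hw0
  have hw0i : Integrable w0 := hu.int_sq.abs.add hu.int_deriv.norm
  set W := ∫ x, w0 x with hW
  have hW0 : 0 ≤ W := integral_nonneg fun x => by positivity
  set A : ℝ := 2 * (q0 ^ 2 + K ^ 2 + K + 1) with hA
  have hA0 : 0 ≤ A := by positivity
  -- The summand `16AW` gives `A W / (R/2) ≤ 1/8`, the smallness required of the Volterra system. As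
  -- `extReg R` forces `‖z‖ > R/2`, the other summands give `‖z‖ ≥ 1`, `‖z‖ ≥ q0` and `‖z‖ ≥ 2K`.
  set R : ℝ := 2 + 2 * q0 + 4 * K + 16 * A * W with hR
  have hAW : 0 ≤ A * W := mul_nonneg hA0 hW0
  have hR1 : 2 ≤ R := by linarith
  have hRq : 2 * q0 ≤ R := by linarith
  have hRK : 4 * K ≤ R := by linarith
  have hnz : ∀ z ∈ extReg R, z ≠ 0 := fun z hz =>
    norm_pos_iff.1 (by linarith [extReg_lt_norm hz])
  have him : ∀ z ∈ (Dp ∪ Sig) ∩ extReg R, 0 ≤ (kz q0 z * lamz q0 z).im := by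
    intro z hz
    rw [kz_mul_lamz_im (hnz z hz.2)]
    have : 0 ≤ z.re * z.im := by
      rcases hz.1 with h | h
      · exact le_of_lt h
      · exact (Sig_re_mul_im h).ge
    positivity
  have hκd : DifferentiableOn ℂ (fun z => kz q0 z * lamz q0 z) (extReg R) := fun z hz =>
    ((differentiableAt_kz (hnz z hz)).mul
      (differentiableAt_lamz (hnz z hz))).differentiableWithinAt
  have H : VolterraData ((Dp ∪ Sig) ∩ extReg R) (Dp ∩ extReg R) (fun x => A / (R / 2) * w0 x)
      (fun z => kz q0 z * lamz q0 z) (wkbCoeff q0 u) := by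
    refine ⟨isOpen_Dp.inter (isOpen_extReg R), inter_subset_inter_left _ subset_union_left,
      hw0i.const_mul _, ?_, him, (hκd.continuousOn).mono inter_subset_right,
      hκd.mono inter_subset_right, fun i j => hu.wkb_family hK hR1 hRq hRK inter_subset_right
        inter_subset_right i j⟩
    rw [integral_const_mul, div_mul_eq_mul_div, div_le_iff₀ (by linarith)]
    linarith
  obtain ⟨n, hn, heq⟩ := H.exists_solution
  refine ⟨K, 4 * (A * W), R, hK0, by positivity, hR1, hRq, hRK, hK, n, fun i x => (hn i).contOn x,
    fun i x => (hn i).diffOn x, fun z hz => ?_⟩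
  have hz0 := hnz z hz.2
  have hzn := extReg_lt_norm hz.2
  have e0 : ∀ x, n 0 x z = _ := fun x => (heq z hz x).1
  have e1 : ∀ x, n 1 x z = _ := fun x => (heq z hz x).2
  have hrow := H.row hn
  have hri := H.row_integrable 2
  have hr0 : ∀ x, ‖wkbCoeff q0 u 0 0 x z * n 0 x z + wkbCoeff q0 u 0 1 x z * n 1 x z‖ ≤ _ :=
    fun x => (hrow 0).bound x z hz
  have hr1 : ∀ x, ‖wkbCoeff q0 u 1 0 x z * n 0 x z + wkbCoeff q0 u 1 1 x z * n 1 x z‖ ≤ _ :=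
    fun x => (hrow 1).bound x z hz
  -- Existence used a profile uniform in `z`; this sharper bound keeps the factor `1/‖z‖`, from
  -- which the rate `O(1/z)` follows.
  have hbd : ∀ i x, ‖wkbCoeff q0 u i 0 x z * n 0 x z + wkbCoeff q0 u i 1 x z * n 1 x z‖
      ≤ 4 * A / ‖z‖ * w0 x := by
    intro i x
    have hc := fun j => norm_wkbCoeff_le (z := z) h0 (hK x) (by linarith) (by linarith)
      (by have : (2 * K) ^ 2 ≤ ‖z‖ ^ 2 := pow_le_pow_left₀ (by positivity) (by linarith) 2
          nlinarith [sq_nonneg K]) i j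
    refine (norm_add_le _ _).trans ?_
    rw [norm_mul, norm_mul]
    have b0 := mul_le_mul (hc 0) ((hn 0).bound x z hz) (norm_nonneg _)
      ((norm_nonneg _).trans (hc 0))
    have b1 := mul_le_mul (hc 1) ((hn 1).bound x z hz) (norm_nonneg _)
      ((norm_nonneg _).trans (hc 1))
    refine (add_le_add b0 b1).trans (le_of_eq ?_)
    simp only [hw0, hA]
    ring
  have hI : ∫ x, 4 * A / ‖z‖ * w0 x = 4 * (A * W) / ‖z‖ := by
    rw [integral_const_mul]; ring
  refine ⟨fun x => ?_, fun x => ?_, ?_, ?_, fun x => ⟨?_, ?_, (hn 0).bound x z hz,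
    (hn 1).bound x z hz⟩⟩
  · have := (hasDerivAt_volterra (κ := fun _ => 0) (z := z)
      (h := fun x z => wkbCoeff q0 u 0 0 x z * n 0 x z + wkbCoeff q0 u 0 1 x z * n 1 x z) hri le_rfl ((hrow 0).cont z hz)
      hr0 x).const_sub 1
    refine (this.congr_of_eventuallyEq (Eventually.of_forall e0)).congr_deriv ?_
    ring
  · have := (hasDerivAt_volterra (κ := fun z => kz q0 z * lamz q0 z) (z := z)
      (h := fun x z => wkbCoeff q0 u 1 0 x z * n 0 x z + wkbCoeff q0 u 1 1 x z * n 1 x z) hri (him z hz) ((hrow 1).cont z hz) hr1 x).neg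
    refine (this.congr_of_eventuallyEq (Eventually.of_forall e1)).congr_deriv ?_
    rw [e1 x]
    ring
  · have := (tendsto_volterra (κ := fun _ => 0) (z := z)
      (h := fun x z => wkbCoeff q0 u 0 0 x z * n 0 x z + wkbCoeff q0 u 0 1 x z * n 1 x z) hri le_rfl hr0).const_sub 1
    rw [sub_zero] at this
    exact this.congr fun x => (e0 x).symm
  · have := (tendsto_volterra (κ := fun z => kz q0 z * lamz q0 z) (z := z)
      (h := fun x z => wkbCoeff q0 u 1 0 x z * n 0 x z + wkbCoeff q0 u 1 1 x z * n 1 x z) hri (him z hz) hr1).neg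
    rw [neg_zero] at this
    exact this.congr fun x => (e1 x).symm
  · have := norm_volterra_le' (κ := fun _ => 0) (z := z)
      (h := fun x z => wkbCoeff q0 u 0 0 x z * n 0 x z + wkbCoeff q0 u 0 1 x z * n 1 x z) (x := x) (hw0i.const_mul _) le_rfl (hbd 0)
    rw [hI] at this
    rw [e0 x, sub_sub_cancel_left, norm_neg]
    exact this
  · have := norm_volterra_le' (κ := fun z => kz q0 z * lamz q0 z) (z := z)
      (h := fun x z => wkbCoeff q0 u 1 0 x z * n 0 x z + wkbCoeff q0 u 1 1 x z * n 1 x z) (x := x) (hw0i.const_mul _) (him z hz) (hbd 1)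
    rw [hI] at this
    rw [e1 x, norm_neg]
    exact this

/-- The first right Jost column is `e^{iv_+} e₁ + O(1/z)` (after removing `e^{iθ}`) in `D⁺`. -/
theorem RightPotential.jost_asymptotics (hu : RightPotential q0 u c) {t : ℝ} {F : ℝ → ℂ → Mat}
    (hF : IsJostMat q0 t u c atTop F) (hext : ∀ x i, ExtendsTo (fun z => F x z i 0) Dp Sig)
    (x : ℝ) : ∃ C R : ℝ, 0 < R ∧ ∀ z ∈ Dp, R ≤ ‖z‖ →
      ‖F x z 0 0 * exp (-(I * theta q0 x t z)) - exp (I * vPlus q0 u x)‖ ≤ C / ‖z‖ ∧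
      ‖F x z 1 0 * exp (-(I * theta q0 x t z))‖ ≤ C / ‖z‖ := by
  obtain ⟨K, L, R, hK0, hL0, hR1, hRq, hRK, hK, n, hnc, hnd, hn⟩ := hu.exists_system_solution
  have h0 := hu.pos
  have hnz : ∀ z ∈ extReg R, z ≠ 0 := fun z hz =>
    norm_pos_iff.1 (by linarith [extReg_lt_norm hz])
  set φ : Fin 2 → ℝ → ℂ → ℂ := ![
    fun x z => (exp (I * vPlus q0 u x) * n 0 x z + I / z * u x * exp (-(I * vPlus q0 u x))
      * n 1 x z) * exp (I * theta q0 x t z),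
    fun x z => (I / z * conj (u x) * exp (I * vPlus q0 u x) * n 0 x z
      + exp (-(I * vPlus q0 u x)) * n 1 x z) * exp (I * theta q0 x t z)] with hφ
  have hcanc : ∀ (a : ℂ) (x : ℝ) (z : ℂ),
      a * exp (I * theta q0 x t z) * exp (-(I * theta q0 x t z)) = a := by
    intro a x z
    rw [mul_assoc, ← Complex.exp_add, add_neg_cancel, Complex.exp_zero, mul_one]
  have hvl : Tendsto (fun x => exp (I * vPlus q0 u x)) atTop (𝓝 1) := by
    have hc : Continuous fun r : ℝ => exp (I * r) := by fun_prop
    simpa [Function.comp_def] using (hc.tendsto 0).comp hu.tendsto_vPlus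
  have hvl' : Tendsto (fun x => exp (-(I * vPlus q0 u x))) atTop (𝓝 1) := by
    have := hvl.inv₀ one_ne_zero
    simpa [exp_neg] using this
  -- agreement on `Σ`
  have hSig : ∀ z ∈ Sig ∩ extReg R, ∀ x i, F x z i 0 = φ i x z := by
    rintro z ⟨hz, hzR⟩ x i
    obtain ⟨d0, d1, l0, l1, -⟩ := hn z ⟨Or.inr hz, hzR⟩
    have hzn := extReg_lt_norm hzR
    have hden : ∀ x, z ^ 2 + u x * conj (u x) ≠ 0 := by
      intro x
      have : (2 * K) ^ 2 ≤ ‖z‖ ^ 2 := pow_le_pow_left₀ (by positivity) (by linarith) 2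
      have h := wkb_denom (z := z) (hK x) (by nlinarith [sq_nonneg K])
      have : 0 < ‖z‖ := by linarith
      exact norm_pos_iff.1 (lt_of_lt_of_le (by positivity) h)
    have hb : z ∉ branch q0 := by
      refine branch_not_extReg ?_
      rw [abs_of_pos h0]
      exact lt_of_le_of_lt (by linarith : q0 ≤ R) hzR
    have hsol := hu.laxSol_of_system t (hnz z hzR) hden d0 d1
    have hu' : Tendsto (fun x => conj (u x)) atTop (𝓝 (conj c)) :=
      (continuous_conj.tendsto c).comp hu.lim
    have := hF.col_zero_unique hu.norm_eq hz hb hsol (by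
        simp only [hcanc]
        have := (hvl.mul l0).add (((hu.lim.const_mul (I / z)).mul hvl').mul l1)
        simpa using this) (by
        simp only [hcanc]
        have := (((hu'.const_mul (I / z)).mul hvl).mul l0).add (hvl'.mul l1)
        rw [Ebg_10]
        convert this using 2
        ring) x
    fin_cases i
    · exact this.1
    · exact this.2
  have hφd : ∀ x i, DifferentiableOn ℂ (φ i x) (Dp ∩ extReg R) := by
    intro x i z hz
    have hz0 := hnz z hz.2
    have hth := (differentiableAt_theta (q0 := q0) (x := x) (t := t) hz0).differentiableWithinAt
      (s := Dp ∩ extReg R)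
    have e0 := hnd 0 x z hz
    have e1 := hnd 1 x z hz
    have hinv : DifferentiableWithinAt ℂ (fun z : ℂ => I / z) (Dp ∩ extReg R) z :=
      ((differentiableAt_const I).div differentiableAt_id hz0).differentiableWithinAt
    fin_cases i
    · exact ((e0.const_mul _).add (((hinv.mul_const _).mul_const _).mul e1)).mul
        (hth.const_mul I).cexp
    · exact ((((hinv.mul_const _).mul_const _).mul e0).add (e1.const_mul _)).mul
        (hth.const_mul I).cexp
  have hφc : ∀ x i, ContinuousOn (φ i x) ((Dp ∪ Sig) ∩ extReg R) := by
    intro x i z hz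
    have hz0 := hnz z hz.2
    have hth := (differentiableAt_theta (q0 := q0) (x := x) (t := t)
      hz0).continuousAt.continuousWithinAt (s := (Dp ∪ Sig) ∩ extReg R)
    have e0 := hnc 0 x z hz
    have e1 := hnc 1 x z hz
    have hinv : ContinuousWithinAt (fun z : ℂ => I / z) ((Dp ∪ Sig) ∩ extReg R) z :=
      (continuousAt_const.div continuousAt_id hz0).continuousWithinAt
    fin_cases i
    · exact ((continuousWithinAt_const.mul e0).add (((hinv.mul continuousWithinAt_const).mul
        continuousWithinAt_const).mul e1)).mul (continuousWithinAt_const.mul hth).cexp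
    · exact ((((hinv.mul continuousWithinAt_const).mul continuousWithinAt_const).mul e0).add
        (continuousWithinAt_const.mul e1)).mul (continuousWithinAt_const.mul hth).cexp
  -- The Jost column in `D⁺` is determined only by its boundary values, so agreement with `φ` on the
  -- outer part of `Σ` is carried inside by boundary uniqueness.
  have hDp : ∀ z ∈ Dp ∩ extReg R, ∀ i, F x z i 0 = φ i x z := by
    intro z hz i
    refine sub_eq_zero.1 (eqOn_zero_Dp (f := fun z => F x z i 0 - φ i x z) (R := R) (R' := R) ?_
      (by linarith) le_rfl ?_ ?_ z hz)
    · exact ((hext x i).1.mono inter_subset_left).sub (hφd x i)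
    · rw [← union_inter_distrib_right]
      exact ((hext x i).2.mono inter_subset_left).sub (hφc x i)
    · intro z hz
      exact sub_eq_zero.2 (hSig z hz x i)
  refine ⟨L + 2 * K, R + 1, by linarith, fun z hz hzR => ?_⟩
  have hzR' : z ∈ extReg R := mem_extReg_of_lt_norm (by linarith)
  have hzp : 0 < ‖z‖ := by linarith
  obtain ⟨-, -, -, -, hb⟩ := hn z ⟨Or.inl hz, hzR'⟩
  obtain ⟨b0, b1, hn0, b2⟩ := hb x
  rw [hDp z ⟨hz, hzR'⟩ 0, hDp z ⟨hz, hzR'⟩ 1]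
  simp only [hφ, Matrix.cons_val_zero, Matrix.cons_val_one, hcanc]
  have hLz : 0 ≤ L / ‖z‖ := by positivity
  constructor
  · have e : exp (I * vPlus q0 u x) * n 0 x z + I / z * u x * exp (-(I * vPlus q0 u x)) * n 1 x z
        - exp (I * vPlus q0 u x) = exp (I * vPlus q0 u x) * (n 0 x z - 1)
        + I / z * u x * exp (-(I * vPlus q0 u x)) * n 1 x z := by ring
    rw [e]
    refine (norm_add_le _ _).trans ?_
    rw [norm_mul, norm_mul, norm_mul, norm_mul, norm_exp_I_mul_real, norm_exp_neg_I_mul_real,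
      norm_div, norm_I]
    have : 1 / ‖z‖ * ‖u x‖ * 1 * ‖n 1 x z‖ ≤ 1 / ‖z‖ * K * 1 * 2 := by
      gcongr; exact hK x
    calc _ ≤ 1 * (L / ‖z‖) + 1 / ‖z‖ * K * 1 * 2 := by gcongr
      _ = (L + 2 * K) / ‖z‖ := by ring
  · refine (norm_add_le _ _).trans ?_
    rw [norm_mul, norm_mul, norm_mul, norm_mul, norm_exp_I_mul_real, norm_exp_neg_I_mul_real,
      norm_div, norm_I, RCLike.norm_conj]
    have : 1 / ‖z‖ * ‖u x‖ * 1 * ‖n 0 x z‖ ≤ 1 / ‖z‖ * K * 1 * 2 := by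
      gcongr; exact hK x
    calc _ ≤ 1 / ‖z‖ * K * 1 * 2 + 1 * (L / ‖z‖) := by gcongr
      _ = (L + 2 * K) / ‖z‖ := by ring

end Core

/-! ### Integrals along `Σ` -/

lemma mul_mem_Sig {ω : ℂ} (hω : ω ∈ Sig) {s : ℝ} (hs : 0 < s) : ω * s ∈ Sig := by
  refine ⟨?_, mul_ne_zero hω.2 (by exact_mod_cast hs.ne')⟩
  rcases hω.1 with h | h
  · left; simp [h]
  · right; simp [h]

lemma one_mem_Sig : (1 : ℂ) ∈ Sig := ⟨Or.inl (by simp), one_ne_zero⟩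
lemma neg_one_mem_Sig : (-1 : ℂ) ∈ Sig := Sig_neg one_mem_Sig
lemma I_mem_Sig : I ∈ Sig := ⟨Or.inr (by simp), I_ne_zero⟩
lemma neg_I_mem_Sig : -I ∈ Sig := Sig_neg I_mem_Sig

lemma norm_mul_ofReal {ω : ℂ} (h1 : ‖ω‖ = 1) {s : ℝ} (hs : 0 < s) : ‖ω * s‖ = s := by
  rw [norm_mul, h1, one_mul, norm_real, Real.norm_of_nonneg hs.le]

lemma continuousOn_ray {f : ℂ → ℂ} (hf : ContinuousOn f Sig) {ω : ℂ} (hω : ω ∈ Sig) :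
    ContinuousOn (fun s : ℝ => f (ω * s)) (Ioi 0) :=
  hf.comp (by fun_prop) fun _ hs => mul_mem_Sig hω hs

lemma integrable_one_add_sq (C : ℝ) : IntegrableOn (fun s : ℝ => C * (1 + s ^ 2)⁻¹) (Ioi 0) :=
  (integrable_inv_one_add_sq.const_mul C).integrableOn

lemma le_inv_one_add_sq {C a s : ℝ} (hs : 0 < s) (ha : 0 ≤ a) (h : a * (1 + s) ^ 2 ≤ C) :
    a ≤ C * (1 + s ^ 2)⁻¹ := by
  rw [← div_eq_mul_inv, le_div_iff₀ (by positivity)]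
  nlinarith [mul_nonneg ha hs.le]

lemma integrableOn_ray {f : ℂ → ℂ} {C : ℝ} (hf : ContinuousOn f Sig)
    (hb : ∀ ζ ∈ Sig, ‖f ζ‖ * (1 + ‖ζ‖) ^ 2 ≤ C) {ω : ℂ} (hω : ω ∈ Sig) (h1 : ‖ω‖ = 1) :
    IntegrableOn (fun s : ℝ => f (ω * s)) (Ioi 0) := by
  refine (integrable_one_add_sq C).mono'
    ((continuousOn_ray hf hω).aestronglyMeasurable measurableSet_Ioi) ?_
  refine (ae_restrict_iff' measurableSet_Ioi).2 (Eventually.of_forall fun s (hs : 0 < s) => ?_)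
  have := hb _ (mul_mem_Sig hω hs)
  rw [norm_mul_ofReal h1 hs] at this
  exact le_inv_one_add_sq hs (norm_nonneg _) this

lemma sigIntegrable_iff {f : ℂ → ℂ} : SigIntegrable f ↔
    IntegrableOn (fun s : ℝ => f (1 * s)) (Ioi 0) ∧ IntegrableOn (fun s : ℝ => f (-1 * s)) (Ioi 0) ∧
    IntegrableOn (fun s : ℝ => f (I * s)) (Ioi 0) ∧
    IntegrableOn (fun s : ℝ => f (-I * s)) (Ioi 0) := by
  simp only [SigIntegrable, one_mul, neg_mul]

lemma sigInt_eq (f : ℂ → ℂ) : sigInt f =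
    (∫ s in Ioi (0 : ℝ), f (1 * s)) - (∫ s in Ioi (0 : ℝ), f (-1 * s))
      - I * (∫ s in Ioi (0 : ℝ), f (I * s)) + I * (∫ s in Ioi (0 : ℝ), f (-I * s)) := by
  simp only [sigInt, one_mul, neg_mul]

lemma sigIntegrable_of_bound {f : ℂ → ℂ} {C : ℝ} (hf : ContinuousOn f Sig)
    (hb : ∀ ζ ∈ Sig, ‖f ζ‖ * (1 + ‖ζ‖) ^ 2 ≤ C) : SigIntegrable f :=
  sigIntegrable_iff.2 ⟨integrableOn_ray hf hb one_mem_Sig (by simp),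
    integrableOn_ray hf hb neg_one_mem_Sig (by simp), integrableOn_ray hf hb I_mem_Sig (by simp),
    integrableOn_ray hf hb neg_I_mem_Sig (by simp)⟩

lemma isOpen_DpDm : IsOpen (Dp ∪ Dm) := isOpen_Dp.union isOpen_Dm

lemma not_Sig_of_mem {z : ℂ} (hz : z ∈ Dp ∪ Dm) : z ∉ Sig :=
  hz.elim Dp_not_Sig Dm_not_Sig

lemma ne_zero_of_mem {z : ℂ} (hz : z ∈ Dp ∪ Dm) : z ≠ 0 :=
  hz.elim ne_zero_of_mem_Dp ne_zero_of_mem_Dm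

/-- Off `Σ` the Cauchy kernel is `O(1/ζ)`, locally uniformly. -/
lemma exists_kernel_bound {z : ℂ} (hz : z ∈ Dp ∪ Dm) :
    ∃ r B : ℝ, 0 < r ∧ 0 ≤ B ∧ Metric.ball z r ⊆ Dp ∪ Dm ∧
      ∀ w ∈ Metric.ball z r, ∀ ζ ∈ Sig, ‖(ζ - w)⁻¹‖ * (1 + ‖ζ‖) ≤ B := by
  obtain ⟨d, hd, hball⟩ := Metric.isOpen_iff.1 isOpen_DpDm z hz
  refine ⟨d / 2, (1 + ‖z‖ + d / 2) / (d / 2) + 1, by linarith, by positivity,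
    (Metric.ball_subset_ball (by linarith)).trans hball, fun w hw ζ hζ => ?_⟩
  have h1 : ‖w - z‖ < d / 2 := mem_ball_iff_norm.1 hw
  have h2 : d ≤ ‖ζ - z‖ := by
    by_contra hh
    exact not_Sig_of_mem (hball (mem_ball_iff_norm.2 (not_le.1 hh))) hζ
  have h3 : ‖ζ - z‖ ≤ ‖ζ - w‖ + ‖w - z‖ := norm_sub_le_norm_sub_add_norm_sub _ _ _
  have h4 : d / 2 ≤ ‖ζ - w‖ := by linarith
  have h5 : ‖ζ‖ ≤ ‖ζ - w‖ + ‖w‖ := norm_le_norm_sub_add _ _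
  have h6 : ‖w‖ ≤ ‖w - z‖ + ‖z‖ := norm_le_norm_sub_add _ _
  have hp : 0 < ‖ζ - w‖ := by linarith
  have hd2 : 0 < d / 2 := by linarith
  rw [norm_inv, inv_mul_le_iff₀ hp]
  have h7 : 1 + ‖z‖ + d / 2 ≤ ‖ζ - w‖ * ((1 + ‖z‖ + d / 2) / (d / 2)) := by
    rw [mul_div_assoc', le_div_iff₀ hd2]
    have : 0 ≤ 1 + ‖z‖ + d / 2 := by positivity
    nlinarith
  linarith

/-- Between the two given regimes lies the part of `Σ` with `r ≤ ‖ζ‖ ≤ max R 1`, which is compact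
because a disc about the origin is cut out. -/
lemma exists_decay_bound {g : ℂ → ℂ} (hg : ContinuousOn g Sig)
    (hinf : ∃ C R : ℝ, ∀ ζ ∈ Sig, R ≤ ‖ζ‖ → ‖g ζ‖ ≤ C / ‖ζ‖)
    (h0 : ∃ C r : ℝ, 0 < r ∧ ∀ ζ ∈ Sig, ‖ζ‖ ≤ r → ‖g ζ‖ ≤ C) :
    ∃ C, 0 ≤ C ∧ ∀ ζ ∈ Sig, ‖g ζ‖ * (1 + ‖ζ‖) ≤ C := by
  obtain ⟨C1, R, hR⟩ := hinf
  obtain ⟨C2, r, hr, hC2⟩ := h0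
  have hcl : IsClosed {ζ : ℂ | ζ.im = 0 ∨ ζ.re = 0} :=
    (isClosed_eq continuous_im continuous_const).union (isClosed_eq continuous_re continuous_const)
  have hK : IsCompact ({ζ : ℂ | ζ.im = 0 ∨ ζ.re = 0} ∩
      (Metric.closedBall 0 (max R 1) \ Metric.ball 0 r)) :=
    ((isCompact_closedBall _ _).diff Metric.isOpen_ball).inter_left hcl
  have hsub : {ζ : ℂ | ζ.im = 0 ∨ ζ.re = 0} ∩ (Metric.closedBall 0 (max R 1) \ Metric.ball 0 r)
      ⊆ Sig := by
    rintro ζ ⟨h1, -, h3⟩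
    refine ⟨h1, ?_⟩
    rintro rfl
    exact h3 (Metric.mem_ball_self hr)
  obtain ⟨C3, hC3⟩ := hK.exists_bound_of_continuousOn (hg.mono hsub)
  refine ⟨max (|C1| * 2) (max (|C2| * (1 + r)) (|C3| * (1 + max R 1))), by positivity,
    fun ζ hζ => ?_⟩
  rcases le_or_gt ‖ζ‖ r with h | h
  · refine le_trans ?_ ((le_max_left _ _).trans (le_max_right _ _))
    exact mul_le_mul ((hC2 ζ hζ h).trans (le_abs_self _)) (by linarith) (by positivity)
      (abs_nonneg _)
  rcases le_or_gt ‖ζ‖ (max R 1) with h' | h'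
  · refine le_trans ?_ ((le_max_right _ _).trans (le_max_right _ _))
    refine mul_le_mul ((hC3 ζ ⟨hζ.1, ?_, ?_⟩).trans (le_abs_self _)) (by linarith) (by positivity)
      (abs_nonneg _)
    · simpa using h'
    · simpa using h.le
  · refine le_trans ?_ (le_max_left _ _)
    have h1 := le_max_right R 1
    have h2 := hR ζ hζ ((le_max_left R 1).trans h'.le)
    have hp : 0 < ‖ζ‖ := hr.trans h
    calc ‖g ζ‖ * (1 + ‖ζ‖) ≤ |C1| / ‖ζ‖ * (2 * ‖ζ‖) := by
          refine mul_le_mul (h2.trans ?_) (by linarith) (by positivity) (by positivity)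
          gcongr
          exact le_abs_self _
      _ = |C1| * 2 := by field_simp

section Kernel

variable {g : ℂ → ℂ} {C : ℝ} {z : ℂ}

lemma continuousOn_kernel (hg : ContinuousOn g Sig) (hz : z ∈ Dp ∪ Dm) (m : ℕ) :
    ContinuousOn (fun ζ => g ζ / (ζ - z) ^ m) Sig :=
  hg.div (by fun_prop) fun ζ hζ => pow_ne_zero _ (sub_ne_zero.2 fun h =>
    not_Sig_of_mem hz (h ▸ hζ))

/-- Density and Cauchy kernel each decay only like `1/(1 + ‖ζ‖)`; their product decays quadratically
and is integrable along `Σ`. -/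
lemma kernel_bound_one {ζ : ℂ} {B : ℝ} (hgζ : ‖g ζ‖ * (1 + ‖ζ‖) ≤ C)
    (hB : ‖(ζ - z)⁻¹‖ * (1 + ‖ζ‖) ≤ B) : ‖g ζ / (ζ - z)‖ * (1 + ‖ζ‖) ^ 2 ≤ C * B := by
  have hC : 0 ≤ C := le_trans (by positivity) hgζ
  rw [div_eq_mul_inv, norm_mul]
  calc _ = (‖g ζ‖ * (1 + ‖ζ‖)) * (‖(ζ - z)⁻¹‖ * (1 + ‖ζ‖)) := by ring
    _ ≤ C * B := mul_le_mul hgζ hB (by positivity) hC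

lemma kernel_bound_two {ζ : ℂ} {B : ℝ} (hgζ : ‖g ζ‖ * (1 + ‖ζ‖) ≤ C)
    (hB : ‖(ζ - z)⁻¹‖ * (1 + ‖ζ‖) ≤ B) : ‖g ζ / (ζ - z) ^ 2‖ * (1 + ‖ζ‖) ^ 2 ≤ C * B * B := by
  have h1 := kernel_bound_one hgζ hB
  have hB0 : 0 ≤ B := le_trans (by positivity) hB
  have h2 : ‖(ζ - z)⁻¹‖ ≤ B := by
    refine le_trans ?_ hB
    exact le_mul_of_one_le_right (norm_nonneg _) (by linarith [norm_nonneg ζ])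
  have e : g ζ / (ζ - z) ^ 2 = (ζ - z)⁻¹ * (g ζ / (ζ - z)) := by
    rw [pow_two, ← div_div, div_eq_inv_mul _ (ζ - z)]
  rw [e, norm_mul]
  have h3 : 0 ≤ ‖g ζ / (ζ - z)‖ * (1 + ‖ζ‖) ^ 2 := by positivity
  calc _ = ‖(ζ - z)⁻¹‖ * (‖g ζ / (ζ - z)‖ * (1 + ‖ζ‖) ^ 2) := by ring
    _ ≤ B * (C * B) := mul_le_mul h2 h1 h3 hB0
    _ = C * B * B := by ring

lemma sigIntegrable_kernel (hg : ContinuousOn g Sig) (hC : ∀ ζ ∈ Sig, ‖g ζ‖ * (1 + ‖ζ‖) ≤ C)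
    (hz : z ∈ Dp ∪ Dm) : SigIntegrable (fun ζ => g ζ / (ζ - z)) := by
  obtain ⟨r, B, hr, -, -, hB⟩ := exists_kernel_bound hz
  refine sigIntegrable_of_bound (by simpa using continuousOn_kernel hg hz 1) fun ζ hζ =>
    kernel_bound_one (hC ζ hζ) (hB z (Metric.mem_ball_self hr) ζ hζ)

lemma sigIntegrable_kernel_sq (hg : ContinuousOn g Sig) (hC : ∀ ζ ∈ Sig, ‖g ζ‖ * (1 + ‖ζ‖) ≤ C)
    (hz : z ∈ Dp ∪ Dm) : SigIntegrable (fun ζ => g ζ / (ζ - z) ^ 2) := by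
  obtain ⟨r, B, hr, -, -, hB⟩ := exists_kernel_bound hz
  exact sigIntegrable_of_bound (continuousOn_kernel hg hz 2) fun ζ hζ =>
    kernel_bound_two (hC ζ hζ) (hB z (Metric.mem_ball_self hr) ζ hζ)

lemma hasDerivAt_ray_kernel (hg : ContinuousOn g Sig) (hC : ∀ ζ ∈ Sig, ‖g ζ‖ * (1 + ‖ζ‖) ≤ C)
    (hz : z ∈ Dp ∪ Dm) {ω : ℂ} (hω : ω ∈ Sig) (h1 : ‖ω‖ = 1) :
    HasDerivAt (fun w => ∫ s in Ioi (0 : ℝ), g (ω * s) / (ω * s - w))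
      (∫ s in Ioi (0 : ℝ), g (ω * s) / (ω * s - z) ^ 2) z := by
  obtain ⟨r, B, hr, hB0, hball, hB⟩ := exists_kernel_bound hz
  have hzr := Metric.mem_ball_self (x := z) hr
  refine (hasDerivAt_integral_of_dominated_loc_of_deriv_le
    (F := fun w (s : ℝ) => g (ω * s) / (ω * s - w))
    (F' := fun w (s : ℝ) => g (ω * s) / (ω * s - w) ^ 2)
    (bound := fun s => C * B * B * (1 + s ^ 2)⁻¹)
    (Metric.ball_mem_nhds z hr) ?_ ?_ ?_ ?_ (integrable_one_add_sq _) ?_).2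
  · filter_upwards [isOpen_DpDm.mem_nhds hz] with w hw
    have := continuousOn_ray (continuousOn_kernel hg hw 1) hω
    simp only [pow_one] at this
    exact this.aestronglyMeasurable measurableSet_Ioi
  · have := continuousOn_kernel hg hz 1
    simp only [pow_one] at this
    exact integrableOn_ray this (fun ζ hζ => kernel_bound_one (hC ζ hζ) (hB z hzr ζ hζ)) hω h1
  · exact (continuousOn_ray (continuousOn_kernel hg hz 2) hω).aestronglyMeasurable
      measurableSet_Ioi
  · refine (ae_restrict_iff' measurableSet_Ioi).2
      (Eventually.of_forall fun s (hs : 0 < s) w hw => ?_)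
    have hm := mul_mem_Sig hω hs
    have := kernel_bound_two (hC _ hm) (hB w hw _ hm)
    rw [norm_mul_ofReal h1 hs] at this
    exact le_inv_one_add_sq hs (norm_nonneg _) this
  · refine (ae_restrict_iff' measurableSet_Ioi).2
      (Eventually.of_forall fun s (hs : 0 < s) w hw => ?_)
    have hne : ω * s - w ≠ 0 := sub_ne_zero.2 fun h =>
      not_Sig_of_mem (hball hw) (h ▸ mul_mem_Sig hω hs)
    have := (hasDerivAt_const w (g (ω * s))).div ((hasDerivAt_id w).const_sub (ω * s)) hne
    refine this.congr_deriv ?_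
    simp

/-- Differentiation under the integral sign, needed to differentiate the solution formula at `ηₖ`
for the second half of the linear system. -/
lemma hasDerivAt_sigInt_kernel (hg : ContinuousOn g Sig)
    (hC : ∀ ζ ∈ Sig, ‖g ζ‖ * (1 + ‖ζ‖) ≤ C) (hz : z ∈ Dp ∪ Dm) :
    HasDerivAt (fun w => sigInt (fun ζ => g ζ / (ζ - w)))
      (sigInt fun ζ => g ζ / (ζ - z) ^ 2) z := by
  simp only [sigInt_eq]
  exact (((hasDerivAt_ray_kernel hg hC hz one_mem_Sig (by simp)).sub
    (hasDerivAt_ray_kernel hg hC hz neg_one_mem_Sig (by simp))).sub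
    ((hasDerivAt_ray_kernel hg hC hz I_mem_Sig (by simp)).const_mul I)).add
    ((hasDerivAt_ray_kernel hg hC hz neg_I_mem_Sig (by simp)).const_mul I)

end Kernel

/-- These truncations are the radial sides of the annulus with radii `1/(n+1)` and `n+1`, in which
Cauchy's theorem is applied. -/
lemma tendsto_intervalIntegral_Ioi_zero {h : ℝ → ℂ} (hh : IntegrableOn h (Ioi 0)) :
    Tendsto (fun n : ℕ => ∫ s in ((n : ℝ) + 1)⁻¹..((n : ℝ) + 1), h s) atTop
      (𝓝 (∫ s in Ioi (0 : ℝ), h s)) := by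
  have hlim : Tendsto (fun n : ℕ => (n : ℝ) + 1) atTop atTop :=
    tendsto_natCast_atTop_atTop.atTop_add tendsto_const_nhds
  have hcov : AECover (volume.restrict (Ioi (0 : ℝ))) atTop
      (fun n : ℕ => Ioc (((n : ℝ) + 1)⁻¹) ((n : ℝ) + 1)) := by
    refine ⟨(ae_restrict_iff' measurableSet_Ioi).2 (Eventually.of_forall fun s (hs : 0 < s) => ?_),
      fun _ => measurableSet_Ioc⟩
    filter_upwards [hlim.eventually_ge_atTop s,
      (tendsto_inv_atTop_zero.comp hlim).eventually_lt_const hs] with n h1 h2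
    exact ⟨h2, h1⟩
  refine (hcov.integral_tendsto_of_countably_generated hh).congr fun n => ?_
  have hn : (0 : ℝ) < (n : ℝ) + 1 := by positivity
  have hle : ((n : ℝ) + 1)⁻¹ ≤ (n : ℝ) + 1 := by
    have : (1 : ℝ) ≤ (n : ℝ) + 1 := by linarith [(Nat.cast_nonneg n : (0 : ℝ) ≤ n)]
    exact (inv_le_one_of_one_le₀ this).trans this
  rw [intervalIntegral.integral_of_le hle, Measure.restrict_restrict measurableSet_Ioc,
    inter_eq_left.2 (show Ioc ((n : ℝ) + 1)⁻¹ ((n : ℝ) + 1) ⊆ Ioi 0 from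
      fun s hs => (inv_pos.2 hn).trans hs.1)]

/-! ### Cauchy's formula in the sectors cut out by `Σ` -/

/-- The closed first quadrant without the origin. -/
def closedQuad : Set ℂ := {z | 0 ≤ z.re ∧ 0 ≤ z.im ∧ z ≠ 0}

/-- The integral of `G` over the quarter of the circle of radius `r` starting at `ω r`. -/
def arcInt (G : ℂ → ℂ) (ω : ℂ) (r : ℝ) : ℂ :=
  ∫ y in (0 : ℝ)..(Real.pi / 2), G (ω * (r * exp (y * I))) * (I * (ω * (r * exp (y * I))))

/-- The integral of `G` over the segment from `ω a` to `ω b`. -/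
def segInt (G : ℂ → ℂ) (ω : ℂ) (a b : ℝ) : ℂ := ∫ s in a..b, ω * G (ω * s)

lemma polar_mem_closedQuad {r y : ℝ} (hr : 0 < r) (hy : y ∈ Icc 0 (Real.pi / 2)) :
    (r : ℂ) * exp (y * I) ∈ closedQuad := by
  refine ⟨?_, ?_, mul_ne_zero (by exact_mod_cast hr.ne') (exp_ne_zero _)⟩
  · rw [re_ofReal_mul, exp_ofReal_mul_I_re]
    exact mul_nonneg hr.le (Real.cos_nonneg_of_mem_Icc ⟨by linarith [hy.1, Real.pi_pos], hy.2⟩)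
  · rw [im_ofReal_mul, exp_ofReal_mul_I_im]
    exact mul_nonneg hr.le (Real.sin_nonneg_of_mem_Icc ⟨hy.1, by linarith [hy.2, Real.pi_pos]⟩)

lemma segInt_eq_log {G : ℂ → ℂ} {η : ℂ} {a b : ℝ} (ha : 0 < a) (hb : 0 < b)
    (hc : ContinuousOn (fun s : ℝ => G (η * s)) (Ioi 0)) :
    ∫ x in Real.log a..Real.log b, η * G (η * exp (x : ℂ)) * exp (x : ℂ) = segInt G η a b := by
  have := intervalIntegral.integral_deriv_smul_comp' (a := Real.log a) (b := Real.log b)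
    (f := Real.exp) (f' := Real.exp) (g := fun s : ℝ => η * G (η * s))
    (fun x _ => Real.hasDerivAt_exp x) Real.continuous_exp.continuousOn
    (continuousOn_const.mul (hc.mono (by rintro _ ⟨x, -, rfl⟩; exact Real.exp_pos x)))
  rw [Real.exp_log ha, Real.exp_log hb] at this
  unfold segInt
  rw [← this]
  refine intervalIntegral.integral_congr fun x _ => ?_
  simp only [Function.comp_apply, real_smul, ofReal_exp]
  ring

/-- Cauchy's theorem for the boundary of a quarter of an annulus. -/
theorem sector_integral_eq_zero {G : ℂ → ℂ} {ω : ℂ} (hω : ω ≠ 0) {s : Set ℂ} (hs : s.Countable)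
    (hc : ContinuousOn (fun z => G (ω * z)) closedQuad)
    (hd : ∀ z : ℂ, 0 < z.re → 0 < z.im → ω * z ∉ s → DifferentiableAt ℂ G (ω * z))
    {a b : ℝ} (ha : 0 < a) (hab : a ≤ b) :
    segInt G ω a b - segInt G (ω * I) a b + arcInt G ω b - arcInt G ω a = 0 := by
  have hb : 0 < b := ha.trans_le hab
  have hpi := Real.pi_pos
  have hlog : Real.log a ≤ Real.log b := Real.log_le_log ha hab
  -- The exponential maps a rectangle of height `π/2` onto the quarter annulus, so Cauchy's theorem
  -- for rectangles applies to the pulled-back integrand.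
  set h : ℂ → ℂ := fun w => ω * G (ω * exp w) * exp w with hh
  set T : Set ℂ := {w | 0 < w.im ∧ w.im < Real.pi / 2 ∧ ω * exp w ∈ s} with hT
  -- The exponential is injective on the strip, so the pulled-back exceptional set remains
  -- countable.
  have hTc : T.Countable := by
    refine MapsTo.countable_of_injOn (f := fun w => ω * exp w) (t := s) (fun w hw => hw.2.2) ?_ hs
    intro w hw v hv hwv
    exact exp_inj_of_neg_pi_lt_of_le_pi (by linarith [hw.1]) (by linarith [hw.2.1])
      (by linarith [hv.1]) (by linarith [hv.2.1]) (mul_left_cancel₀ hω hwv)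
  have hexp : ∀ w : ℂ, 0 ≤ w.im → w.im ≤ Real.pi / 2 → exp w ∈ closedQuad := by
    intro w h1 h2
    have := polar_mem_closedQuad (Real.exp_pos w.re) (y := w.im) ⟨h1, h2⟩
    rwa [ofReal_exp, ← Complex.exp_add, re_add_im] at this
  have hpol : ∀ (r y : ℝ), 0 < r → exp ((Real.log r : ℝ) + y * I) = r * exp (y * I) := by
    intro r y hr
    rw [Complex.exp_add, ← ofReal_exp, Real.exp_log hr]
  have key : (∫ x : ℝ in Real.log a..Real.log b, h (x + (0 : ℝ) * I))
      - (∫ x : ℝ in Real.log a..Real.log b, h (x + (Real.pi / 2 : ℝ) * I))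
      + I • (∫ y : ℝ in (0 : ℝ)..(Real.pi / 2), h ((Real.log b : ℝ) + y * I))
      - I • (∫ y : ℝ in (0 : ℝ)..(Real.pi / 2), h ((Real.log a : ℝ) + y * I)) = 0 := by
    refine integral_boundary_rect_eq_zero_of_differentiable_on_off_countable h
      ⟨Real.log a, 0⟩ ⟨Real.log b, Real.pi / 2⟩ T hTc ?_ ?_
    · have hmaps : MapsTo exp 
          (uIcc (Real.log a) (Real.log b) ×ℂ uIcc 0 (Real.pi / 2)) closedQuad := by
        intro w hw
        have h2 := hw.2
        rw [uIcc_of_le (by positivity)] at h2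
        exact hexp w h2.1 h2.2
      exact (continuousOn_const.mul (hc.comp continuous_exp.continuousOn hmaps)).mul
        continuous_exp.continuousOn
    · rintro w ⟨⟨-, hw⟩, hwT⟩
      simp only [mem_preimage, min_eq_left (show (0 : ℝ) ≤ Real.pi / 2 by positivity),
        max_eq_right (show (0 : ℝ) ≤ Real.pi / 2 by positivity)] at hw
      have hre : 0 < (exp w).re := by
        rw [exp_re]
        exact mul_pos (Real.exp_pos _) (Real.cos_pos_of_mem_Ioo ⟨by linarith [hw.1], hw.2⟩)
      have him : 0 < (exp w).im := by
        rw [exp_im]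
        exact mul_pos (Real.exp_pos _) (Real.sin_pos_of_pos_of_lt_pi hw.1 (by linarith [hw.2]))
      have hG := hd (exp w) hre him fun hs' => hwT ⟨hw.1, hw.2, hs'⟩
      have h1 : DifferentiableAt ℂ (fun w => G (ω * exp w)) w :=
        DifferentiableAt.comp w (g := G) (f := fun w => ω * exp w) hG (by fun_prop)
      exact (h1.const_mul ω).mul differentiableAt_exp
  have e1 : (∫ x : ℝ in Real.log a..Real.log b, h (x + (0 : ℝ) * I)) = segInt G ω a b := by
    rw [← segInt_eq_log ha hb (hc.comp (by fun_prop) fun s (hs : 0 < s) => ?_)]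
    · simp only [hh, ofReal_zero, zero_mul, add_zero]
    · exact ⟨by simpa using hs.le, by simp, by exact_mod_cast hs.ne'⟩
  have e2 : (∫ x : ℝ in Real.log a..Real.log b, h (x + (Real.pi / 2 : ℝ) * I))
      = segInt G (ω * I) a b := by
    have hexpI : ∀ x : ℝ, exp (x + (Real.pi / 2 : ℝ) * I) = exp x * I := by
      intro x
      rw [Complex.exp_add]
      push_cast
      rw [exp_pi_div_two_mul_I]
    rw [← segInt_eq_log ha hb]
    · refine intervalIntegral.integral_congr fun x _ => ?_
      simp only [hh, hexpI]
      rw [show ω * (exp (x : ℂ) * I) = ω * I * exp (x : ℂ) by ring]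
      ring
    · have : ContinuousOn (fun s : ℝ => G (ω * (I * s))) (Ioi 0) := by
        refine hc.comp (f := fun s : ℝ => I * (s : ℂ)) (by fun_prop) fun s (hs : 0 < s) => ?_
        exact ⟨by simp, by simpa using hs.le,
          mul_ne_zero I_ne_zero (by exact_mod_cast hs.ne')⟩
      simpa only [mul_assoc] using this
  have e3 : ∀ r : ℝ, 0 < r → I • (∫ y : ℝ in (0 : ℝ)..(Real.pi / 2), h ((Real.log r : ℝ) + y * I))
      = arcInt G ω r := by
    intro r hr
    unfold arcInt
    rw [smul_eq_mul, ← intervalIntegral.integral_const_mul]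
    refine intervalIntegral.integral_congr fun y _ => ?_
    simp only [hh, hpol r y hr]
    ring
  rw [e1, e2, e3 a ha, e3 b hb] at key
  exact key

lemma circleIntegral_eq_arcs (z0 : ℂ) (r : ℝ) (hr : ∀ ζ : ℂ, ‖ζ‖ = |r| → ζ ≠ z0) :
    (∮ ζ in C(0, r), (ζ - z0)⁻¹) = arcInt (fun ζ => (ζ - z0)⁻¹) 1 r
      + arcInt (fun ζ => (ζ - z0)⁻¹) I r + arcInt (fun ζ => (ζ - z0)⁻¹) (-1) r
      + arcInt (fun ζ => (ζ - z0)⁻¹) (-I) r := by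
  set ψ : ℝ → ℂ := fun y => (r * exp (y * I) - z0)⁻¹ * (I * (r * exp (y * I))) with hψ
  have hψc : Continuous ψ := by
    refine Continuous.mul (Continuous.inv₀ (by fun_prop) fun y => sub_ne_zero.2 (hr _ ?_))
      (by fun_prop)
    rw [norm_mul, norm_exp_ofReal_mul_I, mul_one, norm_real, Real.norm_eq_abs]
  have hint : ∀ a b, IntervalIntegrable ψ volume a b := fun a b => hψc.intervalIntegrable a b
  have hshift : ∀ (ω : ℂ) (c : ℝ), exp (c * I) = ω →
      arcInt (fun ζ => (ζ - z0)⁻¹) ω r = ∫ y in c..(c + Real.pi / 2), ψ y := by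
    intro ω c hω
    have := intervalIntegral.integral_comp_add_right (a := 0) (b := Real.pi / 2) ψ c
    rw [zero_add, add_comm (Real.pi / 2)] at this
    rw [← this]
    unfold arcInt
    refine intervalIntegral.integral_congr fun y _ => ?_
    simp only [hψ]
    push_cast
    rw [add_mul, Complex.exp_add, hω]
    ring_nf
  rw [hshift 1 0 (by simp), hshift I (Real.pi / 2) (by push_cast; exact exp_pi_div_two_mul_I),
    hshift (-1) Real.pi exp_pi_mul_I, hshift (-I) (Real.pi + Real.pi / 2) (by
      push_cast
      rw [add_mul, Complex.exp_add, exp_pi_mul_I, exp_pi_div_two_mul_I]; ring)]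
  rw [zero_add, show Real.pi / 2 + Real.pi / 2 = Real.pi by ring,
    intervalIntegral.integral_add_adjacent_intervals (hint _ _) (hint _ _),
    intervalIntegral.integral_add_adjacent_intervals (hint _ _) (hint _ _),
    intervalIntegral.integral_add_adjacent_intervals (hint _ _) (hint _ _),
    show Real.pi + Real.pi / 2 + Real.pi / 2 = 2 * Real.pi by ring]
  unfold circleIntegral
  refine intervalIntegral.integral_congr fun y _ => ?_
  simp only [hψ, deriv_circleMap, circleMap, zero_add, smul_eq_mul]
  ring

lemma circleIntegral_inv_of_lt {z0 : ℂ} {r : ℝ} (h : ‖z0‖ < r) :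
    (∮ ζ in C(0, r), (ζ - z0)⁻¹) = 2 * Real.pi * I :=
  circleIntegral.integral_sub_inv_of_mem_ball (by simpa using h)

lemma circleIntegral_inv_of_gt {z0 : ℂ} {r : ℝ} (hr : 0 ≤ r) (h : r < ‖z0‖) :
    (∮ ζ in C(0, r), (ζ - z0)⁻¹) = 0 := by
  have hne : ∀ ζ ∈ Metric.closedBall (0 : ℂ) r, ζ - z0 ≠ 0 := by
    intro ζ hζ hh
    rw [sub_eq_zero.1 hh] at hζ
    exact absurd (by simpa using hζ) (not_le.2 h)
  refine Complex.circleIntegral_eq_zero_of_differentiable_on_off_countable hr countable_empty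
    (ContinuousOn.inv₀ (by fun_prop) hne) fun ζ hζ => ?_
  exact DifferentiableAt.inv (by fun_prop) (hne ζ (Metric.ball_subset_closedBall hζ.1))

lemma continuous_polar (ω : ℂ) (r : ℝ) : Continuous fun y : ℝ => ω * (r * exp (y * I)) := by
  fun_prop

lemma norm_polar {ω : ℂ} (hω : ‖ω‖ = 1) {r : ℝ} (hr : 0 < r) (y : ℝ) :
    ‖ω * (r * exp (y * I))‖ = r := by
  rw [norm_mul, norm_mul, hω, norm_exp_ofReal_mul_I, norm_real, Real.norm_of_nonneg hr.le]
  ring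

/-- Adding `c/(ζ - z0)` to `G` restores `E/(ζ - z0)`, so the size of `E` alone controls the arc; `|r
- ‖z0‖|` bounds the distance from the arc to `z0` from below. -/
lemma norm_arcInt_add_le {E G : ℂ → ℂ} {V : Set ℂ} {ω c z0 : ℂ} {r B : ℝ} (hω : ‖ω‖ = 1)
    (hV : ∀ ζ ∈ closedQuad, ω * ζ ∈ V) (hG : ContinuousOn G V)
    (hGE : ∀ ζ, ζ ≠ z0 → G ζ = (E ζ - c) / (ζ - z0)) (hr : 0 < r) (hrz : r ≠ ‖z0‖)
    (hB : ∀ ζ ∈ V, ‖ζ‖ = r → ‖E ζ‖ ≤ B) :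
    ‖arcInt G ω r + c * arcInt (fun ζ => (ζ - z0)⁻¹) ω r‖
      ≤ B * r / |r - ‖z0‖| * (Real.pi / 2) := by
  have hpi := Real.pi_pos
  have hmem : ∀ y ∈ uIcc (0 : ℝ) (Real.pi / 2), ω * (r * exp (y * I)) ∈ V := by
    intro y hy
    rw [uIcc_of_le (by positivity)] at hy
    exact hV _ (polar_mem_closedQuad hr hy)
  have hne : ∀ y : ℝ, ω * (r * exp (y * I)) ≠ z0 := by
    intro y h
    have := norm_polar hω hr y
    rw [h] at this
    exact hrz this.symm
  have hpos : 0 < |r - ‖z0‖| := abs_pos.2 (sub_ne_zero.2 hrz)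
  have i1 : IntervalIntegrable (fun y : ℝ => G (ω * (r * exp (y * I))) *
      (I * (ω * (r * exp (y * I))))) volume 0 (Real.pi / 2) :=
    ((hG.comp (continuous_polar ω r).continuousOn hmem).mul
      (by fun_prop)).intervalIntegrable
  have i2 : IntervalIntegrable (fun y : ℝ => (ω * (r * exp (y * I)) - z0)⁻¹ *
      (I * (ω * (r * exp (y * I))))) volume 0 (Real.pi / 2) :=
    (Continuous.mul (Continuous.inv₀ (by fun_prop) fun y => sub_ne_zero.2 (hne y))
      (by fun_prop)).intervalIntegrable _ _
  unfold arcInt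
  rw [← intervalIntegral.integral_const_mul, ← intervalIntegral.integral_add i1 (i2.const_mul c)]
  have hle := intervalIntegral.norm_integral_le_of_norm_le_const (a := 0) (b := Real.pi / 2)
    (C := B * r / |r - ‖z0‖|) (f := fun y : ℝ => G (ω * (r * exp (y * I))) *
      (I * (ω * (r * exp (y * I)))) + c * ((ω * (r * exp (y * I)) - z0)⁻¹ *
      (I * (ω * (r * exp (y * I)))))) ?_
  · rwa [sub_zero, abs_of_pos (by positivity : 0 < Real.pi / 2)] at hle
  · intro y hy
    have hy' := hmem y (uIoc_subset_uIcc hy)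
    have hn := norm_polar hω hr y
    have hn0 := sub_ne_zero.2 (hne y)
    set ζ := ω * (r * exp (y * I)) with hζ
    have e : G ζ * (I * ζ) + c * ((ζ - z0)⁻¹ * (I * ζ)) = E ζ * ((ζ - z0)⁻¹ * (I * ζ)) := by
      rw [hGE ζ (hne y)]
      field_simp
      ring
    rw [e, norm_mul, norm_mul, norm_mul, norm_I, one_mul, norm_inv, hn]
    have h1 := hB ζ hy' hn
    have h2 : |r - ‖z0‖| ≤ ‖ζ - z0‖ := by
      rw [← hn]; exact abs_norm_sub_norm_le ζ z0
    have h3 : ‖ζ - z0‖⁻¹ ≤ |r - ‖z0‖|⁻¹ := inv_anti₀ hpos h2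
    calc ‖E ζ‖ * (‖ζ - z0‖⁻¹ * r) ≤ B * (|r - ‖z0‖|⁻¹ * r) :=
          mul_le_mul h1 (by gcongr) (by positivity) ((norm_nonneg _).trans h1)
      _ = B * r / |r - ‖z0‖| := by ring

lemma quad_one : ∀ ζ ∈ closedQuad, 1 * ζ ∈ Dp ∪ Sig := by
  rintro ζ ⟨h1, h2, h3⟩
  rw [one_mul]
  rcases h1.eq_or_lt with h | h
  · exact Or.inr ⟨Or.inr h.symm, h3⟩
  rcases h2.eq_or_lt with h' | h'
  · exact Or.inr ⟨Or.inl h'.symm, h3⟩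
  · exact Or.inl (mul_pos h h')

lemma quad_neg_one : ∀ ζ ∈ closedQuad, -1 * ζ ∈ Dp ∪ Sig := by
  intro ζ h
  have := quad_one ζ h
  rw [one_mul] at this
  rw [neg_one_mul]
  exact this.imp neg_mem_Dp Sig_neg

lemma I_mul_mem {ζ : ℂ} (h : ζ ∈ Dp ∪ Sig) : I * ζ ∈ Dm ∪ Sig := by
  rcases h with h | h
  · left
    have h' : 0 < ζ.re * ζ.im := h
    simp only [Dm, mem_ofPred_eq, mul_re, mul_im, I_re, I_im]
    linarith
  · right
    refine ⟨?_, mul_ne_zero I_ne_zero h.2⟩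
    rcases h.1 with h | h
    · right; simp [h]
    · left; simp [h]

lemma quad_I : ∀ ζ ∈ closedQuad, I * ζ ∈ Dm ∪ Sig := by
  intro ζ h
  have := quad_one ζ h
  rw [one_mul] at this
  exact I_mul_mem this

lemma quad_neg_I : ∀ ζ ∈ closedQuad, -I * ζ ∈ Dm ∪ Sig := by
  intro ζ h
  have := I_mul_mem (quad_neg_one ζ h)
  rwa [show I * (-1 * ζ) = -I * ζ by ring] at this

section Cauchy

variable {Ep Em Gp Gm : ℂ → ℂ} {c z0 : ℂ} {s : Set ℂ}

/-- On a ray shared by two sectors the constant `c` cancels between the two sides, and only the jump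
`Ep - Em` survives. -/
lemma tendsto_segInt_sub (hz0 : z0 ∉ Sig) {ω : ℂ} (hω : ω ∈ Sig)
    (hGp : ∀ ζ, ζ ≠ z0 → Gp ζ = (Ep ζ - c) / (ζ - z0))
    (hGm : ∀ ζ, ζ ≠ z0 → Gm ζ = (Em ζ - c) / (ζ - z0))
    (hcp : ContinuousOn Gp Sig) (hcm : ContinuousOn Gm Sig)
    (hJ : IntegrableOn (fun s : ℝ => (Ep (ω * s) - Em (ω * s)) / (ω * s - z0)) (Ioi 0)) :
    Tendsto (fun n : ℕ => segInt Gp ω ((n : ℝ) + 1)⁻¹ ((n : ℝ) + 1)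
      - segInt Gm ω ((n : ℝ) + 1)⁻¹ ((n : ℝ) + 1)) atTop
      (𝓝 (ω * ∫ s in Ioi (0 : ℝ), (Ep (ω * s) - Em (ω * s)) / (ω * s - z0))) := by
  refine ((tendsto_intervalIntegral_Ioi_zero hJ).const_mul ω).congr fun n => ?_
  have hn : (0 : ℝ) < (n : ℝ) + 1 := by positivity
  have hsub : uIcc (((n : ℝ) + 1)⁻¹) ((n : ℝ) + 1) ⊆ Ioi 0 := by
    intro s hs
    exact lt_of_lt_of_le (lt_min (inv_pos.2 hn) hn) hs.1
  unfold segInt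
  rw [← intervalIntegral.integral_sub, ← intervalIntegral.integral_const_mul]
  · refine intervalIntegral.integral_congr fun s hs => ?_
    have hs' : 0 < s := hsub hs
    have hne : ω * s ≠ z0 := fun h => hz0 (h ▸ mul_mem_Sig hω hs')
    rw [hGp _ hne, hGm _ hne]
    ring
  · exact (continuousOn_const.mul ((continuousOn_ray hcp hω).mono hsub)).intervalIntegrable
  · exact (continuousOn_const.mul ((continuousOn_ray hcm hω).mono hsub)).intervalIntegrable

/-- Summation of Cauchy's theorem over the four sectors. -/
theorem sigInt_eq_of_sectors (hz0 : z0 ∈ Dp ∪ Dm) (hs : s.Countable)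
    (hGpc : ContinuousOn Gp (Dp ∪ Sig)) (hGmc : ContinuousOn Gm (Dm ∪ Sig))
    (hGpd : ∀ z ∈ Dp, z ∉ s → DifferentiableAt ℂ Gp z)
    (hGmd : ∀ z ∈ Dm, z ∉ s → DifferentiableAt ℂ Gm z)
    (hGp : ∀ ζ, ζ ≠ z0 → Gp ζ = (Ep ζ - c) / (ζ - z0))
    (hGm : ∀ ζ, ζ ≠ z0 → Gm ζ = (Em ζ - c) / (ζ - z0))
    {C R r : ℝ} (hr : 0 < r)
    (hpinf : ∀ ζ ∈ Dp ∪ Sig, R ≤ ‖ζ‖ → ‖Ep ζ‖ ≤ C / ‖ζ‖)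
    (hminf : ∀ ζ ∈ Dm ∪ Sig, R ≤ ‖ζ‖ → ‖Em ζ‖ ≤ C / ‖ζ‖)
    (hp0 : ∀ ζ ∈ Dp ∪ Sig, ‖ζ‖ ≤ r → ‖Ep ζ‖ ≤ C)
    (hm0 : ∀ ζ ∈ Dm ∪ Sig, ‖ζ‖ ≤ r → ‖Em ζ‖ ≤ C)
    (hJ : SigIntegrable fun ζ => (Ep ζ - Em ζ) / (ζ - z0)) :
    sigInt (fun ζ => (Ep ζ - Em ζ) / (ζ - z0)) = 2 * Real.pi * I * c := by
  have hzS := not_Sig_of_mem hz0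
  have hz00 : 0 < ‖z0‖ := norm_pos_iff.2 (ne_zero_of_mem hz0)
  have hcp := hGpc.mono (subset_union_right (s := Dp) (t := Sig))
  have hcm := hGmc.mono (subset_union_right (s := Dm) (t := Sig))
  obtain ⟨J1, J2, J3, J4⟩ := sigIntegrable_iff.1 hJ
  have T1 := tendsto_segInt_sub hzS one_mem_Sig hGp hGm hcp hcm J1
  have T2 := tendsto_segInt_sub hzS neg_one_mem_Sig hGp hGm hcp hcm J2
  have T3 := tendsto_segInt_sub hzS I_mem_Sig hGp hGm hcp hcm J3
  have T4 := tendsto_segInt_sub hzS neg_I_mem_Sig hGp hGm hcp hcm J4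
  have hlim : Tendsto (fun n : ℕ => (n : ℝ) + 1) atTop atTop :=
    tendsto_natCast_atTop_atTop.atTop_add tendsto_const_nhds
  have hlim0 : Tendsto (fun n : ℕ => ((n : ℝ) + 1)⁻¹) atTop (𝓝 0) :=
    tendsto_inv_atTop_zero.comp hlim
  -- the arcs at infinity and at the origin
  have hbig : ∀ {E G : ℂ → ℂ} {V : Set ℂ} {ω : ℂ}, ‖ω‖ = 1 → (∀ ζ ∈ closedQuad, ω * ζ ∈ V) →
      ContinuousOn G V → (∀ ζ, ζ ≠ z0 → G ζ = (E ζ - c) / (ζ - z0)) →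
      (∀ ζ ∈ V, R ≤ ‖ζ‖ → ‖E ζ‖ ≤ C / ‖ζ‖) →
      Tendsto (fun n : ℕ => arcInt G ω ((n : ℝ) + 1)
        + c * arcInt (fun ζ => (ζ - z0)⁻¹) ω ((n : ℝ) + 1)) atTop (𝓝 0) := by
    intro E G V ω hω hV hG hGE hE
    have h1 : Tendsto (fun n : ℕ => C / |((n : ℝ) + 1) - ‖z0‖| * (Real.pi / 2)) atTop (𝓝 0) := by
      have h2 : Tendsto (fun n : ℕ => |((n : ℝ) + 1) - ‖z0‖|) atTop atTop :=
        tendsto_abs_atTop_atTop.comp (hlim.atTop_add tendsto_const_nhds)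
      simpa using (h2.const_div_atTop C).mul_const (Real.pi / 2)
    refine squeeze_zero_norm' ?_ h1
    filter_upwards [hlim.eventually_ge_atTop R, hlim.eventually_gt_atTop ‖z0‖] with n hn hn'
    have hpos : (0 : ℝ) < (n : ℝ) + 1 := by positivity
    refine (norm_arcInt_add_le hω hV hG hGE hpos hn'.ne' (B := C / ((n : ℝ) + 1))
      fun ζ hζ hζn => ?_).trans (le_of_eq ?_)
    · rw [← hζn]; exact hE ζ hζ (by rw [hζn]; exact hn)
    · rw [div_mul_cancel₀ _ hpos.ne']
  have hsmall : ∀ {E G : ℂ → ℂ} {V : Set ℂ} {ω : ℂ}, ‖ω‖ = 1 → (∀ ζ ∈ closedQuad, ω * ζ ∈ V) →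
      ContinuousOn G V → (∀ ζ, ζ ≠ z0 → G ζ = (E ζ - c) / (ζ - z0)) →
      (∀ ζ ∈ V, ‖ζ‖ ≤ r → ‖E ζ‖ ≤ C) →
      Tendsto (fun n : ℕ => arcInt G ω ((n : ℝ) + 1)⁻¹
        + c * arcInt (fun ζ => (ζ - z0)⁻¹) ω ((n : ℝ) + 1)⁻¹) atTop (𝓝 0) := by
    intro E G V ω hω hV hG hGE hE
    have h1 : Tendsto (fun n : ℕ => C * ((n : ℝ) + 1)⁻¹ / |((n : ℝ) + 1)⁻¹ - ‖z0‖|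
        * (Real.pi / 2)) atTop (𝓝 0) := by
      have h2 := ((hlim0.const_mul C).div (hlim0.sub_const ‖z0‖).abs
        (by simpa using hz00.ne')).mul_const (Real.pi / 2)
      simpa using h2
    refine squeeze_zero_norm' ?_ h1
    filter_upwards [hlim0.eventually_le_const hr, hlim0.eventually_lt_const hz00] with n hn hn'
    have hpos : (0 : ℝ) < ((n : ℝ) + 1)⁻¹ := by positivity
    exact norm_arcInt_add_le hω hV hG hGE hpos hn'.ne (B := C)
      fun ζ hζ hζn => hE ζ hζ (by rw [hζn]; exact hn)
  have n1 : ‖(1 : ℂ)‖ = 1 := norm_one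
  have n2 : ‖(-1 : ℂ)‖ = 1 := by simp
  have n3 : ‖(I : ℂ)‖ = 1 := norm_I
  have n4 : ‖(-I : ℂ)‖ = 1 := by simp
  have A := ((hbig n1 quad_one hGpc hGp hpinf).add (hbig n3 quad_I hGmc hGm hminf)).add
    ((hbig n2 quad_neg_one hGpc hGp hpinf).add (hbig n4 quad_neg_I hGmc hGm hminf))
  have B := ((hsmall n1 quad_one hGpc hGp hp0).add (hsmall n3 quad_I hGmc hGm hm0)).add
    ((hsmall n2 quad_neg_one hGpc hGp hp0).add (hsmall n4 quad_neg_I hGmc hGm hm0))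
  have Tot := (((T1.sub T3).add (T2.sub T4)).add A).sub B
  have hval : sigInt (fun ζ => (Ep ζ - Em ζ) / (ζ - z0)) =
      1 * (∫ s in Ioi (0 : ℝ), (Ep (1 * s) - Em (1 * s)) / (1 * s - z0))
      - I * (∫ s in Ioi (0 : ℝ), (Ep (I * s) - Em (I * s)) / (I * s - z0))
      + (-1 * (∫ s in Ioi (0 : ℝ), (Ep (-1 * s) - Em (-1 * s)) / (-1 * s - z0))
      - -I * (∫ s in Ioi (0 : ℝ), (Ep (-I * s) - Em (-I * s)) / (-I * s - z0)))
      + (0 + 0 + (0 + 0)) - (0 + 0 + (0 + 0)) := by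
    rw [sigInt_eq]; ring
  rw [hval]
  -- For large `n` this sequence is constant. The four sector integrals vanish, each ray being
  -- traversed once from either side, and the arcs of `c/(ζ - z0)` add up to `2πi c` on the large
  -- circle and to `0` on the small one.
  refine tendsto_nhds_unique Tot (tendsto_const_nhds.congr' ?_)
  filter_upwards [hlim.eventually_gt_atTop ‖z0‖, hlim0.eventually_lt_const hz00] with n hn hn'
  have hpos : (0 : ℝ) < (n : ℝ) + 1 := by positivity
  have hipos : (0 : ℝ) < ((n : ℝ) + 1)⁻¹ := by positivity
  have hle : ((n : ℝ) + 1)⁻¹ ≤ (n : ℝ) + 1 := by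
    have : (1 : ℝ) ≤ (n : ℝ) + 1 := by linarith [(Nat.cast_nonneg n : (0 : ℝ) ≤ n)]
    exact (inv_le_one_of_one_le₀ this).trans this
  have K1 := circleIntegral_inv_of_lt hn
  rw [circleIntegral_eq_arcs _ _ fun ζ hζ h => by
    rw [h, abs_of_pos hpos] at hζ; exact hn.ne hζ] at K1
  have K2 := circleIntegral_inv_of_gt hipos.le hn'
  rw [circleIntegral_eq_arcs _ _ fun ζ hζ h => by
    rw [h, abs_of_pos hipos] at hζ; exact hn'.ne' hζ] at K2
  have hopen : ∀ (ω : ℂ) (V : Set ℂ), (∀ ζ ∈ closedQuad, ω * ζ ∈ V ∪ Sig) → ω ∈ Sig →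
      ∀ z : ℂ, 0 < z.re → 0 < z.im → ω * z ∈ V := by
    intro ω V hV hω z h1 h2
    refine (hV z ⟨h1.le, h2.le, fun h => by simp [h] at h1⟩).resolve_right fun h => ?_
    have e1 := Sig_re_mul_im h
    have e2 := Sig_re_mul_im hω
    have e3 : 0 < ω.re ^ 2 + ω.im ^ 2 := by
      have := normSq_pos.2 hω.2
      rw [normSq_apply] at this
      nlinarith
    simp only [mul_re, mul_im] at e1
    rcases hω.1 with h | h
    · simp only [h] at e1 e3
      have : ω.re ^ 2 * (z.re * z.im) = 0 := by linarith
      have : 0 < ω.re ^ 2 * (z.re * z.im) := mul_pos (by simpa using e3) (mul_pos h1 h2)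
      linarith
    · simp only [h] at e1 e3
      have : ω.im ^ 2 * (z.re * z.im) = 0 := by linarith
      have : 0 < ω.im ^ 2 * (z.re * z.im) := mul_pos (by simpa using e3) (mul_pos h1 h2)
      linarith
  have S : ∀ {G : ℂ → ℂ} {V : Set ℂ} {ω : ℂ}, (∀ ζ ∈ closedQuad, ω * ζ ∈ V ∪ Sig) → ω ∈ Sig →
      ContinuousOn G (V ∪ Sig) → (∀ z ∈ V, z ∉ s → DifferentiableAt ℂ G z) →
      segInt G ω ((n : ℝ) + 1)⁻¹ ((n : ℝ) + 1) - segInt G (ω * I) ((n : ℝ) + 1)⁻¹ ((n : ℝ) + 1)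
        + arcInt G ω ((n : ℝ) + 1) - arcInt G ω ((n : ℝ) + 1)⁻¹ = 0 := by
    intro G V ω hV hω hG hd
    exact sector_integral_eq_zero hω.2 hs (hG.comp (by fun_prop) hV)
      (fun z h1 h2 h3 => hd _ (hopen ω V hV hω z h1 h2) h3) hipos hle
  have S1 := S quad_one one_mem_Sig hGpc hGpd
  have S2 := S quad_I I_mem_Sig hGmc hGmd
  have S3 := S quad_neg_one neg_one_mem_Sig hGpc hGpd
  have S4 := S quad_neg_I neg_I_mem_Sig hGmc hGmd
  rw [one_mul] at S1
  rw [I_mul_I] at S2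
  rw [neg_one_mul] at S3
  rw [show -I * I = 1 by rw [neg_mul, I_mul_I, neg_neg]] at S4
  linear_combination -S1 - S2 - S3 - S4 - c * K1 + c * K2

end Cauchy

/-! ### Boundary values from the two sides of `Σ`, and Cauchy's formula off `Σ` -/

lemma mem_closure_of_eventually {V : Set ℂ} {ζ c : ℂ}
    (h : ∀ᶠ ε : ℝ in 𝓝[>] 0, ζ * (1 + ε * c) ∈ V) : ζ ∈ closure V := by
  have h1 : Tendsto (fun ε : ℝ => ζ * (1 + ε * c)) (𝓝[>] 0) (𝓝 ζ) := by
    have h2 : Continuous fun ε : ℝ => ζ * (1 + ε * c) := by fun_prop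
    simpa using (h2.tendsto 0).mono_left (nhdsWithin_le_nhds (s := Ioi 0))
  exact mem_closure_of_tendsto h1 h

/-- A small rotation moves a point of `Σ` into `D⁺` or `D⁻`, according to the sense of rotation and
to the axis on which the point lies. -/
lemma Sig_rotate {ζ : ℂ} (hζ : ζ ∈ Sig) (a : ℝ) :
    (ζ * (1 + a * I)).re * (ζ * (1 + a * I)).im = a * (ζ.re ^ 2 - ζ.im ^ 2) := by
  have := Sig_re_mul_im hζ
  simp only [mul_re, mul_im, add_re, add_im, one_re, one_im, ofReal_re, ofReal_im, I_re, I_im]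
  linear_combination (1 - a ^ 2) * this

lemma Sig_sq_ne {ζ : ℂ} (hζ : ζ ∈ Sig) : ζ.re ^ 2 - ζ.im ^ 2 ≠ 0 := by
  intro h
  have h1 := Sig_re_mul_im hζ
  refine hζ.2 (Complex.ext ?_ ?_)
  · rcases mul_eq_zero.1 h1 with h2 | h2
    · exact h2
    · simpa [h2] using h
  · rcases mul_eq_zero.1 h1 with h2 | h2
    · simpa [h2] using h
    · exact h2

lemma Sig_subset_closure : Sig ⊆ closure Dp ∧ Sig ⊆ closure Dm := by
  constructor <;> intro ζ hζ <;> rcases (Sig_sq_ne hζ).lt_or_gt with h | h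
  · refine mem_closure_of_eventually (c := -I) ?_
    filter_upwards [self_mem_nhdsWithin] with ε hε
    have := Sig_rotate hζ (-ε)
    rw [show ((-ε : ℝ) : ℂ) * I = ε * -I by push_cast; ring] at this
    rw [Dp, mem_ofPred_eq]
    rw [this]; nlinarith [mem_Ioi.1 hε]
  · refine mem_closure_of_eventually (c := I) ?_
    filter_upwards [self_mem_nhdsWithin] with ε hε
    rw [Dp, mem_ofPred_eq]
    rw [Sig_rotate hζ ε]; exact mul_pos hε h
  · refine mem_closure_of_eventually (c := I) ?_
    filter_upwards [self_mem_nhdsWithin] with ε hε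
    rw [Dm, mem_ofPred_eq]
    rw [Sig_rotate hζ ε]; exact mul_neg_of_pos_of_neg hε h
  · refine mem_closure_of_eventually (c := -I) ?_
    filter_upwards [self_mem_nhdsWithin] with ε hε
    have := Sig_rotate hζ (-ε)
    rw [show ((-ε : ℝ) : ℂ) * I = ε * -I by push_cast; ring] at this
    rw [Dm, mem_ofPred_eq]
    rw [this]; nlinarith [mem_Ioi.1 hε]

lemma norm_boundary_le {f : ℂ → ℂ} {V : Set ℂ} {ζ L : ℂ} (hζ : ζ ∈ closure V)
    (hf : Tendsto f (𝓝[V] ζ) (𝓝 L)) {B : ℂ → ℝ} (hB : ContinuousAt B ζ)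
    (h : ∀ᶠ z in 𝓝[V] ζ, ‖f z‖ ≤ B z) : ‖L‖ ≤ B ζ := by
  have := mem_closure_iff_nhdsWithin_neBot.1 hζ
  exact le_of_tendsto_of_tendsto hf.norm (hB.mono_left nhdsWithin_le_nhds) h

/-- The extension of `f` from `V` to its boundary. -/
lemma continuousOn_extendFrom_union {f fb : ℂ → ℂ} {V : Set ℂ}
    (hS : Sig ⊆ closure V) (hc : ∀ z ∈ V, ContinuousAt f z)
    (hb : ∀ ζ ∈ Sig, Tendsto f (𝓝[V] ζ) (𝓝 (fb ζ))) :
    ContinuousOn (extendFrom V f) (V ∪ Sig) ∧ (∀ z ∈ V, extendFrom V f z = f z) ∧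
      ∀ ζ ∈ Sig, extendFrom V f ζ = fb ζ := by
  refine ⟨continuousOn_extendFrom (union_subset subset_closure hS) ?_, fun z hz => ?_, fun ζ hζ => ?_⟩
  · rintro z (hz | hz)
    · exact ⟨f z, (hc z hz).tendsto.mono_left nhdsWithin_le_nhds⟩
    · exact ⟨_, hb z hz⟩
  · exact extendFrom_eq (subset_closure hz) ((hc z hz).tendsto.mono_left nhdsWithin_le_nhds)
  · exact extendFrom_eq (hS hζ) (hb ζ hζ)

/-- The Cauchy kernel of the boundary value, with the removable point filled in. -/
lemma kernel_quotient {E : ℂ → ℂ} {V s : Set ℂ} {z0 c : ℂ} (hzS : z0 ∉ Sig)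
    (hE : ContinuousOn E (V ∪ Sig)) (hEd : ∀ z ∈ V, z ∉ s → DifferentiableAt ℂ E z)
    (hz : z0 ∈ V → z0 ∉ s ∧ E z0 = c) :
    ∃ G : ℂ → ℂ, (∀ ζ, ζ ≠ z0 → G ζ = (E ζ - c) / (ζ - z0)) ∧ ContinuousOn G (V ∪ Sig) ∧
      ∀ z ∈ V, z ∉ insert z0 s → DifferentiableAt ℂ G z := by
  classical
  have key : ∀ ζ, ζ ≠ z0 → (fun ζ => (E ζ - c) / (ζ - z0)) =ᶠ[𝓝 ζ]
      Function.update (fun ζ => (E ζ - c) / (ζ - z0)) z0 (deriv E z0) := by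
    intro ζ hζ
    filter_upwards [isOpen_ne.mem_nhds hζ] with w hw
    rw [Function.update_of_ne hw]
  refine ⟨Function.update (fun ζ => (E ζ - c) / (ζ - z0)) z0 (deriv E z0),
    fun ζ hζ => by rw [Function.update_of_ne hζ], fun ζ hζ => ?_, fun z hz hzs => ?_⟩
  · by_cases h : ζ = z0
    · subst h
      have hζV := hζ.resolve_right hzS
      obtain ⟨h1, rfl⟩ := hz hζV
      have := (hEd ζ hζV h1).hasDerivAt
      refine ContinuousAt.continuousWithinAt ?_
      rw [hasDerivAt_iff_tendsto_slope] at this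
      refine continuousAt_update_same.2 (this.congr fun w => ?_)
      rw [slope_def_field]
    · have h1 : ContinuousWithinAt (fun ζ => (E ζ - c) / (ζ - z0)) (V ∪ Sig) ζ :=
        ((hE ζ hζ).sub continuousWithinAt_const).div
          (continuousWithinAt_id.sub continuousWithinAt_const) (sub_ne_zero.2 h)
      exact h1.congr_of_eventuallyEq (nhdsWithin_le_nhds (key ζ h).symm) (key ζ h).symm.self_of_nhds
  · have h1 : z ≠ z0 := fun h => hzs (Or.inl h)
    have h2 : DifferentiableAt ℂ (fun ζ => (E ζ - c) / (ζ - z0)) z :=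
      ((hEd z hz fun h => hzs (Or.inr h)).sub_const c).div (by fun_prop) (sub_ne_zero.2 h1)
    exact h2.congr_of_eventuallyEq (key z h1).symm

/-- Cauchy's formula for a sectionally continuous function, holomorphic off a countable set. -/
theorem cauchy_formula_of_continuousAt {f fp fm : ℂ → ℂ} {P : Set ℂ} (hP : P.Countable)
    (hc : ∀ z ∈ Dp ∪ Dm, ContinuousAt f z)
    (hd : ∀ z ∈ Dp ∪ Dm, z ∉ P → DifferentiableAt ℂ f z)
    (hbp : ∀ ζ ∈ Sig, Tendsto f (𝓝[Dp] ζ) (𝓝 (fp ζ)))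
    (hbm : ∀ ζ ∈ Sig, Tendsto f (𝓝[Dm] ζ) (𝓝 (fm ζ)))
    (hinf : ∃ C R : ℝ, ∀ z ∈ Dp ∪ Dm, R ≤ ‖z‖ → ‖f z‖ ≤ C / ‖z‖)
    (h0 : ∃ C r : ℝ, 0 < r ∧ ∀ z ∈ Dp ∪ Dm, ‖z‖ ≤ r → ‖f z‖ ≤ C) :
    ContinuousOn (fun ζ => fp ζ - fm ζ) Sig ∧
    (∃ C, 0 ≤ C ∧ ∀ ζ ∈ Sig, ‖fp ζ - fm ζ‖ * (1 + ‖ζ‖) ≤ C) ∧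
    ∀ z ∈ Dp ∪ Dm, z ∉ P →
      sigInt (fun ζ => (fp ζ - fm ζ) / (ζ - z)) = 2 * Real.pi * I * f z := by
  obtain ⟨cp, ep, sp⟩ := continuousOn_extendFrom_union Sig_subset_closure.1
    (fun z hz => hc z (Or.inl hz)) hbp
  obtain ⟨cm, em, sm⟩ := continuousOn_extendFrom_union Sig_subset_closure.2
    (fun z hz => hc z (Or.inr hz)) hbm
  obtain ⟨C1, R, hR⟩ := hinf
  obtain ⟨C2, r, hr, hC2⟩ := h0
  -- The radii become `R + 1` and `r / 2` so that every interior point close to a boundary point in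
  -- question satisfies the original estimate.
  have bnd : ∀ {V : Set ℂ} {fb : ℂ → ℂ}, V ⊆ Dp ∪ Dm → Sig ⊆ closure V →
      (∀ ζ ∈ Sig, Tendsto f (𝓝[V] ζ) (𝓝 (fb ζ))) → (∀ z ∈ V, extendFrom V f z = f z) →
      (∀ ζ ∈ Sig, extendFrom V f ζ = fb ζ) →
      (∀ ζ ∈ V ∪ Sig, R + 1 ≤ ‖ζ‖ → ‖extendFrom V f ζ‖ ≤ max C1 C2 / ‖ζ‖) ∧
      (∀ ζ ∈ V ∪ Sig, ‖ζ‖ ≤ r / 2 → ‖extendFrom V f ζ‖ ≤ max C1 C2) := by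
    intro V fb hV hcl hb e s
    constructor
    · rintro ζ (hζ | hζ) hn
      · rw [e ζ hζ]
        exact (hR ζ (hV hζ) (by linarith)).trans (by gcongr; exact le_max_left _ _)
      · rw [s ζ hζ]
        refine norm_boundary_le (hcl hζ) (hb ζ hζ) (B := fun z => max C1 C2 / ‖z‖)
          (continuousAt_const.div continuousAt_id.norm (norm_ne_zero_iff.2 hζ.2)) ?_
        have : ∀ᶠ z in 𝓝 ζ, R < ‖z‖ := continuousAt_id.norm.eventually_const_lt (by simp; linarith)
        filter_upwards [self_mem_nhdsWithin, nhdsWithin_le_nhds this] with z hz hzR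
        exact (hR z (hV hz) hzR.le).trans (by gcongr; exact le_max_left _ _)
    · rintro ζ (hζ | hζ) hn
      · rw [e ζ hζ]
        exact (hC2 ζ (hV hζ) (by linarith)).trans (le_max_right _ _)
      · rw [s ζ hζ]
        refine norm_boundary_le (hcl hζ) (hb ζ hζ) (B := fun z => max C1 C2) continuousAt_const ?_
        have : ∀ᶠ z in 𝓝 ζ, ‖z‖ < r := continuousAt_id.norm.eventually_lt_const (by simp; linarith)
        filter_upwards [self_mem_nhdsWithin, nhdsWithin_le_nhds this] with z hz hzR
        exact (hC2 z (hV hz) hzR.le).trans (le_max_right _ _)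
  obtain ⟨ip, op⟩ := bnd subset_union_left Sig_subset_closure.1 hbp ep sp
  obtain ⟨im, om⟩ := bnd subset_union_right Sig_subset_closure.2 hbm em sm
  have cj : ContinuousOn (fun ζ => fp ζ - fm ζ) Sig :=
    ((cp.mono subset_union_right).sub (cm.mono subset_union_right)).congr fun ζ hζ => by
      simp only [Pi.sub_apply, sp ζ hζ, sm ζ hζ]
  obtain ⟨K, hK0, hK⟩ := exists_decay_bound cj
    ⟨max C1 C2 + max C1 C2, R + 1, fun ζ hζ hn => by
      rw [← sp ζ hζ, ← sm ζ hζ, add_div]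
      exact (norm_sub_le _ _).trans (add_le_add (ip ζ (Or.inr hζ) hn) (im ζ (Or.inr hζ) hn))⟩
    ⟨max C1 C2 + max C1 C2, r / 2, by positivity, fun ζ hζ hn => by
      rw [← sp ζ hζ, ← sm ζ hζ]
      exact (norm_sub_le _ _).trans (add_le_add (op ζ (Or.inr hζ) hn) (om ζ (Or.inr hζ) hn))⟩
  refine ⟨cj, ⟨K, hK0, hK⟩, fun z0 hz0 hz0P => ?_⟩
  have hzS := not_Sig_of_mem hz0
  have dext : ∀ {V : Set ℂ}, IsOpen V → V ⊆ Dp ∪ Dm → (∀ z ∈ V, extendFrom V f z = f z) →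
      ∀ z ∈ V, z ∉ P → DifferentiableAt ℂ (extendFrom V f) z := by
    intro V hV hsub e z hz hzP
    refine (hd z (hsub hz) hzP).congr_of_eventuallyEq ?_
    filter_upwards [hV.mem_nhds hz] with w hw using e w hw
  -- Subtracting the constant `f z0` makes the quotient regular at `z0` on the side that contains
  -- `z0`; the other side does not contain it.
  obtain ⟨Gp, g1, g2, g3⟩ := kernel_quotient (c := f z0) hzS cp
    (dext isOpen_Dp subset_union_left ep) fun h => ⟨hz0P, ep z0 h⟩
  obtain ⟨Gm, m1, m2, m3⟩ := kernel_quotient (c := f z0) hzS cm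
    (dext isOpen_Dm subset_union_right em) fun h => ⟨hz0P, em z0 h⟩
  have hcongr : ∀ ω ∈ Sig, ∀ s ∈ Ioi (0 : ℝ), (fp (ω * s) - fm (ω * s)) / (ω * s - z0) =
      (extendFrom Dp f (ω * s) - extendFrom Dm f (ω * s)) / (ω * s - z0) := fun ω hω s hs => by
    rw [sp _ (mul_mem_Sig hω hs), sm _ (mul_mem_Sig hω hs)]
  have hJ := sigIntegrable_kernel cj hK hz0
  rw [sigIntegrable_iff] at hJ
  have key := sigInt_eq_of_sectors hz0 (hP.insert z0) g2 m2 g3 m3 g1 m1 (r := r / 2) (by positivity)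
    ip im op om (sigIntegrable_iff.2
      ⟨hJ.1.congr_fun (hcongr 1 one_mem_Sig) measurableSet_Ioi,
        hJ.2.1.congr_fun (hcongr (-1) neg_one_mem_Sig) measurableSet_Ioi,
        hJ.2.2.1.congr_fun (hcongr I I_mem_Sig) measurableSet_Ioi,
        hJ.2.2.2.congr_fun (hcongr (-I) neg_I_mem_Sig) measurableSet_Ioi⟩)
  rw [← key, sigInt_eq, sigInt_eq]
  rw [setIntegral_congr_fun measurableSet_Ioi (hcongr 1 one_mem_Sig),
    setIntegral_congr_fun measurableSet_Ioi (hcongr (-1) neg_one_mem_Sig),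
    setIntegral_congr_fun measurableSet_Ioi (hcongr I I_mem_Sig),
    setIntegral_congr_fun measurableSet_Ioi (hcongr (-I) neg_I_mem_Sig)]

/-- Cauchy's formula for a sectionally holomorphic function with removable singularities. -/
theorem cauchy_formula {f fp fm : ℂ → ℂ} {P : Set ℂ} (hP : P.Finite) (hPsub : P ⊆ Dp ∪ Dm)
    (hd : ∀ z ∈ Dp ∪ Dm, z ∉ P → DifferentiableAt ℂ f z)
    (hlim : ∀ p ∈ P, ∃ L, Tendsto f (𝓝[≠] p) (𝓝 L))
    (hbp : ∀ ζ ∈ Sig, Tendsto f (𝓝[Dp] ζ) (𝓝 (fp ζ)))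
    (hbm : ∀ ζ ∈ Sig, Tendsto f (𝓝[Dm] ζ) (𝓝 (fm ζ)))
    (hinf : ∃ C R : ℝ, ∀ z ∈ Dp ∪ Dm, R ≤ ‖z‖ → ‖f z‖ ≤ C / ‖z‖)
    (h0 : ∃ C r : ℝ, 0 < r ∧ ∀ z ∈ Dp ∪ Dm, ‖z‖ ≤ r → ‖f z‖ ≤ C) :
    ContinuousOn (fun ζ => fp ζ - fm ζ) Sig ∧
    (∃ C, 0 ≤ C ∧ ∀ ζ ∈ Sig, ‖fp ζ - fm ζ‖ * (1 + ‖ζ‖) ≤ C) ∧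
    ∀ z ∈ Dp ∪ Dm, z ∉ P →
      sigInt (fun ζ => (fp ζ - fm ζ) / (ζ - z)) = 2 * Real.pi * I * f z := by
  classical
  choose! L hL using hlim
  -- Filling in the limits makes the function continuous at the points of `P`. Holomorphy there need
  -- not be proved, since Cauchy's theorem tolerates a countable set of points of mere continuity.
  set g : ℂ → ℂ := fun z => if z ∈ P then L z else f z with hg
  have hgf : ∀ z, z ∉ P → g z = f z := fun z hz => by simp [hg, hz]
  have hev : ∀ z, z ∉ P → g =ᶠ[𝓝 z] f := fun z hz => by
    filter_upwards [hP.isClosed.isOpen_compl.mem_nhds hz] with w hw using hgf w hw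
  have hev' : ∀ z, g =ᶠ[𝓝[≠] z] f := fun z => by
    have : (P \ {z})ᶜ ∈ 𝓝 z :=
      (hP.subset sdiff_subset).isClosed.isOpen_compl.mem_nhds fun h => h.2 rfl
    filter_upwards [nhdsWithin_le_nhds this, self_mem_nhdsWithin] with w hw hw'
    exact hgf w fun h => hw ⟨h, hw'⟩
  have hnP : ∀ ζ ∈ Sig, ζ ∉ P := fun ζ hζ h => not_Sig_of_mem (hPsub h) hζ
  have hbg : ∀ {V : Set ℂ} {ζ L : ℂ}, ζ ∈ Sig → Tendsto f (𝓝[V] ζ) (𝓝 L) →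
      Tendsto g (𝓝[V] ζ) (𝓝 L) := fun hζ h =>
    h.congr' (nhdsWithin_le_nhds (hev _ (hnP _ hζ)).symm)
  obtain ⟨C1, R, hR⟩ := hinf
  obtain ⟨C2, r, hr, hC2⟩ := h0
  obtain ⟨R', hR'⟩ := hP.isBounded.exists_norm_le
  obtain ⟨r', hr', hball⟩ := Metric.isOpen_iff.1 hP.isClosed.isOpen_compl 0
    fun h => ne_zero_of_mem (hPsub h) rfl
  obtain ⟨h1, h2, h3⟩ := cauchy_formula_of_continuousAt (f := g) (fp := fp) (fm := fm) hP.countable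
    (fun z hz => by
      by_cases hzP : z ∈ P
      · rw [continuousAt_iff_punctured_nhds]
        have : g z = L z := by simp [hg, hzP]
        rw [this]
        exact (hL z hzP).congr' (hev' z).symm
      · exact ((hd z hz hzP).continuousAt).congr (hev z hzP).symm)
    (fun z hz hzP => (hd z hz hzP).congr_of_eventuallyEq (hev z hzP))
    (fun ζ hζ => hbg hζ (hbp ζ hζ)) (fun ζ hζ => hbg hζ (hbm ζ hζ))
    ⟨C1, max R (R' + 1), fun z hz hn => by
      rw [hgf z fun h => by have := hR' z h; have := (le_max_right _ _).trans hn; linarith]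
      exact hR z hz ((le_max_left _ _).trans hn)⟩
    ⟨C2, min r (r' / 2), by positivity, fun z hz hn => by
      rw [hgf z fun h => hball (mem_ball_zero_iff.2 (by
        have := hn.trans (min_le_right _ _); linarith)) h]
      exact hC2 z hz (hn.trans (min_le_left _ _))⟩
  refine ⟨h1, h2, fun z hz hzP => ?_⟩
  rw [h3 z hz hzP, hgf z hzP]

/-! ### Symmetries continued from `Σ` into `D⁺` and `D⁻` -/

section Extension

variable {q0 : ℝ} {f g : ℂ → ℂ} {U V Γ Γ' : Set ℂ}

lemma ExtendsTo.mono (hf : ExtendsTo f U Γ) (h : Γ' ⊆ Γ) : ExtendsTo f U Γ' :=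
  ⟨hf.1, hf.2.mono (union_subset_union_right U h)⟩

lemma ExtendsTo.mul (hf : ExtendsTo f U Γ) (hg : ExtendsTo g U Γ) :
    ExtendsTo (fun z => f z * g z) U Γ := ⟨hf.1.mul hg.1, hf.2.mul hg.2⟩

lemma ExtendsTo.sub (hf : ExtendsTo f U Γ) (hg : ExtendsTo g U Γ) :
    ExtendsTo (fun z => f z - g z) U Γ := ⟨hf.1.sub hg.1, hf.2.sub hg.2⟩

lemma ExtendsTo.neg (hf : ExtendsTo f U Γ) : ExtendsTo (fun z => -f z) U Γ := ⟨hf.1.neg, hf.2.neg⟩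

lemma ExtendsTo.const_mul (hf : ExtendsTo f U Γ) (a : ℂ) : ExtendsTo (fun z => a * f z) U Γ :=
  ⟨hf.1.const_mul a, continuousOn_const.mul hf.2⟩

lemma extendsTo_of_differentiableAt (h : ∀ z ∈ U ∪ Γ, DifferentiableAt ℂ f z) : ExtendsTo f U Γ :=
  ⟨fun z hz => (h z (Or.inl hz)).differentiableWithinAt,
    fun z hz => (h z hz).continuousAt.continuousWithinAt⟩

lemma ExtendsTo.comp {φ : ℂ → ℂ} (hf : ExtendsTo f V Γ) (hφ : ∀ z ∈ U ∪ Γ, DifferentiableAt ℂ φ z)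
    (hU : MapsTo φ U V) (hΓ : MapsTo φ Γ Γ) : ExtendsTo (fun z => f (φ z)) U Γ :=
  ⟨hf.1.comp (fun z hz => (hφ z (Or.inl hz)).differentiableWithinAt) hU,
    hf.2.comp (fun z hz => (hφ z hz).continuousAt.continuousWithinAt) fun _ hz =>
      hz.elim (fun h => Or.inl (hU h)) fun h => Or.inr (hΓ h)⟩

lemma ExtendsTo.conj (hV : IsOpen V) (hf : ExtendsTo f V Γ)
    (hU : ∀ z ∈ U, conj z ∈ V)
    (hΓ : ∀ z ∈ Γ, conj z ∈ Γ) : ExtendsTo (fun z => conj (f (conj z))) U Γ := by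
  refine ⟨fun z hz => ?_, ?_⟩
  · have := (hf.1.differentiableAt (hV.mem_nhds (hU z hz))).conj_conj
    rw [conj_conj] at this
    exact this.differentiableWithinAt
  · exact continuous_conj.comp_continuousOn (hf.2.comp continuous_conj.continuousOn fun z hz =>
      hz.elim (fun h => Or.inl (hU z h)) fun h => Or.inr (hΓ z h))

/-- `U` and `V` are the two regions `D⁺`, `D⁻`, in some order. -/
def IsRegionPair (U V : Set ℂ) : Prop := (U = Dp ∧ V = Dm) ∨ (U = Dm ∧ V = Dp)

lemma IsRegionPair.symm (h : IsRegionPair U V) : IsRegionPair V U :=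
  h.elim (fun h => Or.inr h.symm) fun h => Or.inl h.symm

lemma IsRegionPair.isOpen (h : IsRegionPair U V) : IsOpen U := by
  rcases h with ⟨rfl, -⟩ | ⟨rfl, -⟩
  exacts [isOpen_Dp, isOpen_Dm]

lemma IsRegionPair.ne_zero (h : IsRegionPair U V) {z : ℂ} (hz : z ∈ U) : z ≠ 0 := by
  rcases h with ⟨rfl, -⟩ | ⟨rfl, -⟩
  exacts [ne_zero_of_mem_Dp hz, ne_zero_of_mem_Dm hz]

lemma IsRegionPair.conj_mem (h : IsRegionPair U V) {z : ℂ} (hz : z ∈ U) : conj z ∈ V := by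
  rcases h with ⟨rfl, rfl⟩ | ⟨rfl, rfl⟩
  exacts [conj_mem_Dm hz, conj_mem_Dp hz]

lemma IsRegionPair.hatz_mem (h : IsRegionPair U V) (h0 : 0 < q0) {z : ℂ} (hz : z ∈ U) :
    hatz q0 z ∈ V := by
  rcases h with ⟨rfl, rfl⟩ | ⟨rfl, rfl⟩
  exacts [hatz_mem_Dm h0 hz, hatz_mem_Dp h0 hz]

lemma IsRegionPair.eqOn (h : IsRegionPair U V) (hf : ExtendsTo f U (Sig \ branch q0))
    (hg : ExtendsTo g U (Sig \ branch q0)) (hfg : ∀ z ∈ Sig \ branch q0, f z = g z) :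
    ∀ z ∈ U, f z = g z := by
  rcases h with ⟨rfl, -⟩ | ⟨rfl, -⟩
  exacts [hf.eqOn_Dp hg hfg, hf.eqOn_Dm hg hfg]

lemma arc_conj {z : ℂ} (hz : z ∈ Sig \ branch q0) : conj z ∈ Sig \ branch q0 :=
  ⟨Sig_conj hz.1, fun h => hz.2 (branch_conj h)⟩

lemma arc_neg {z : ℂ} (hz : z ∈ Sig \ branch q0) : -z ∈ Sig \ branch q0 :=
  ⟨Sig_neg hz.1, fun h => hz.2 (branch_neg h)⟩

lemma arc_hatz (h0 : 0 < q0) {z : ℂ} (hz : z ∈ Sig \ branch q0) : hatz q0 z ∈ Sig \ branch q0 :=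
  ⟨Sig_hatz h0 hz.1, fun h => hz.2 (branch_hatz h0 hz.1.2 h)⟩

lemma differentiableAt_hatz {z : ℂ} (hz : z ≠ 0) : DifferentiableAt ℂ (hatz q0) z := by
  unfold hatz; fun_prop (disch := assumption)

lemma ExtendsTo.comp_conj (h : IsRegionPair U V) (hf : ExtendsTo f V (Sig \ branch q0)) :
    ExtendsTo (fun z => starRingEnd ℂ (f (starRingEnd ℂ z))) U (Sig \ branch q0) :=
  hf.conj h.symm.isOpen (fun _ hz => h.conj_mem hz) fun _ hz => arc_conj hz

lemma ExtendsTo.comp_hatz (h : IsRegionPair U V) (h0 : 0 < q0)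
    (hf : ExtendsTo f V (Sig \ branch q0)) :
    ExtendsTo (fun z => f (hatz q0 z)) U (Sig \ branch q0) :=
  hf.comp (fun _ hz => differentiableAt_hatz (hz.elim (fun hz => h.ne_zero hz) fun hz => hz.1.2))
    (fun _ hz => h.hatz_mem h0 hz) fun _ hz => arc_hatz h0 hz

lemma extendsTo_const_div (h : IsRegionPair U V) (a : ℂ) :
    ExtendsTo (fun z => a / z) U (Sig \ branch q0) :=
  extendsTo_of_differentiableAt fun z hz => by
    have : z ≠ 0 := hz.elim (fun hz => h.ne_zero hz) fun hz => hz.1.2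
    fun_prop (disch := assumption)

end Extension

/-- The symmetries of a Jost matrix, in the regions of analyticity of its columns. -/
lemma IsJostMat.symm_region {q0 t x : ℝ} {u : ℝ → ℂ} {c : ℂ} {l : Filter ℝ} [l.NeBot]
    {F : ℝ → ℂ → Mat} {U V : Set ℂ} (hF : IsJostMat q0 t u c l F) (h0 : 0 < q0) (hc : ‖c‖ = q0)
    (h : IsRegionPair U V) (e0 : ∀ i, ExtendsTo (fun z => F x z i 0) U Sig)
    (e1 : ∀ i, ExtendsTo (fun z => F x z i 1) V Sig) :
    (∀ z ∈ U, F x z 0 0 = conj (F x (conj z) 1 1) ∧ F x z 1 0 = -conj (F x (conj z) 0 1)) ∧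
    (∀ z ∈ U, ∀ i, F x z i 0 = I * conj c / z * F x (hatz q0 z) i 1) ∧
    (∀ z ∈ V, ∀ i, F x z i 1 = I * c / z * F x (hatz q0 z) i 0) := by
  have f0 := fun i => (e0 i).mono (sdiff_subset (s := Sig) (t := branch q0))
  have f1 := fun i => (e1 i).mono (sdiff_subset (s := Sig) (t := branch q0))
  refine ⟨fun z hz => ⟨?_, ?_⟩, fun z hz i => ?_, fun z hz i => ?_⟩
  · exact h.eqOn (f0 0) ((f1 1).comp_conj h) (fun z hz => (hF.conj_symm hc hz.1 hz.2 x).1.1) z hz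
  · exact h.eqOn (f0 1) ((f1 0).comp_conj h).neg (fun z hz => (hF.conj_symm hc hz.1 hz.2 x).1.2) z hz
  · exact h.eqOn (f0 i) ((extendsTo_const_div h _).mul ((f1 i).comp_hatz h h0))
      (fun z hz => (hF.hat_symm h0 hc hz.1 hz.2 x i).1) z hz
  · exact h.symm.eqOn (f1 i) ((extendsTo_const_div h.symm _).mul ((f0 i).comp_hatz h.symm h0))
      (fun z hz => (hF.hat_symm h0 hc hz.1 hz.2 x i).2) z hz

/-- The relations between the Jost matrices `P = Φ₊` and `N = Φ₋`, for fixed `(x, t)`, and the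
scattering matrix `S`. -/
structure ScatteringRelations (q0 : ℝ) (qm qp : ℂ) (P N S : ℂ → Mat) : Prop where
  pos : 0 < q0
  norm_minus : ‖qm‖ = q0
  norm_plus : ‖qp‖ = q0
  rel : ∀ z ∈ Sig \ branch q0, P z = N z * S z
  extP0 : ∀ i, ExtendsTo (fun z => P z i 0) Dp Sig
  extP1 : ∀ i, ExtendsTo (fun z => P z i 1) Dm Sig
  extN0 : ∀ i, ExtendsTo (fun z => N z i 0) Dm Sig
  extN1 : ∀ i, ExtendsTo (fun z => N z i 1) Dp Sig
  ext11 : ExtendsTo (fun z => S z 0 0) Dp (Sig \ branch q0)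
  ext22 : ExtendsTo (fun z => S z 1 1) Dm (Sig \ branch q0)
  conjP : ∀ z ∈ Dp, P z 0 0 = conj (P (conj z) 1 1) ∧ P z 1 0 = -conj (P (conj z) 0 1)
  conjN : ∀ z ∈ Dm, N z 0 0 = conj (N (conj z) 1 1) ∧ N z 1 0 = -conj (N (conj z) 0 1)
  hatP0 : ∀ z ∈ Dp, ∀ i, P z i 0 = I * conj qp / z * P (hatz q0 z) i 1
  hatP1 : ∀ z ∈ Dm, ∀ i, P z i 1 = I * qp / z * P (hatz q0 z) i 0
  hatN0 : ∀ z ∈ Dm, ∀ i, N z i 0 = I * conj qm / z * N (hatz q0 z) i 1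
  hatN1 : ∀ z ∈ Dp, ∀ i, N z i 1 = I * qm / z * N (hatz q0 z) i 0
  wronskian : ∀ z ∈ Dp, S z 0 0 * detE q0 z = P z 0 0 * N z 1 1 - P z 1 0 * N z 0 1
  s_neg : ∀ z ∈ Dp, S z 0 0 = S (-z) 0 0
  s_conj : ∀ z ∈ Dm, S z 1 1 = conj (S (conj z) 0 0)
  s_hat : ∀ z ∈ Dm, S z 1 1 = conj qm * qp / (q0 : ℂ) ^ 2 * S (hatz q0 z) 0 0

/-- On `Σ` off the branch points, `s₁₁ det E` and `s₂₂ det E` are Wronskians of a column of `Φ₊`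
with one of `Φ₋`. Dividing by `det E`, the symmetries of the columns pass to `S`, and boundary
uniqueness carries them into `D±`. -/
theorem scatteringRelations {q0 : ℝ} {qm qp : ℂ} {q : ℝ → ℝ → ℂ} (h0 : 0 < q0) (hm : ‖qm‖ = q0)
    (hp : ‖qp‖ = q0) {Φm Φp : ℝ → ℝ → ℂ → Mat} (hΦm : IsJostMinus q0 q qm Φm)
    (hΦp : IsJostPlus q0 q qp Φp) {S : ℂ → Mat} (hS : IsScatteringMatrix q0 Φm Φp S) (x t : ℝ) :
    ScatteringRelations q0 qm qp (Φp x t) (Φm x t) S := by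
  have JP := hΦp.onSig.isJostMat t
  have JN := hΦm.onSig.isJostMat t
  have pair : IsRegionPair Dp Dm := Or.inl ⟨rfl, rfl⟩
  obtain ⟨p1, p2, p3⟩ := JP.symm_region (x := x) h0 hp pair (hΦp.ext_one x t) (hΦp.ext_two x t)
  obtain ⟨n1, n2, n3⟩ := JN.symm_region (x := x) h0 hm pair.symm (hΦm.ext_one x t) (hΦm.ext_two x t)
  have dN := fun z (hz : z ∈ Sig) => JN.det_eq hm hz x
  have ent : ∀ z ∈ Sig \ branch q0, ∀ i j,
      Φp x t z i j = Φm x t z i 0 * S z 0 j + Φm x t z i 1 * S z 1 j := fun z hz i j => by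
    rw [hS.rel z hz x t, Matrix.mul_apply, Fin.sum_univ_two]
  have hdet : ∀ z ∈ Sig \ branch q0, detE q0 z ≠ 0 := fun z hz h =>
    hz.2 ((detE_eq_zero_iff hz.1.2).1 h)
  have w1 : ∀ z ∈ Sig \ branch q0, S z 0 0 * detE q0 z =
      Φp x t z 0 0 * Φm x t z 1 1 - Φp x t z 1 0 * Φm x t z 0 1 := fun z hz => by
    rw [← dN z hz.1, ent z hz, ent z hz]; ring
  have w2 : ∀ z ∈ Sig \ branch q0, S z 1 1 * detE q0 z =
      Φm x t z 0 0 * Φp x t z 1 1 - Φm x t z 1 0 * Φp x t z 0 1 := fun z hz => by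
    rw [← dN z hz.1, ent z hz, ent z hz]; ring
  have up := fun i => (hΦp.ext_one x t i).mono (sdiff_subset (s := Sig) (t := branch q0))
  have un := fun i => (hΦm.ext_two x t i).mono (sdiff_subset (s := Sig) (t := branch q0))
  have detE_neg : ∀ z, detE q0 (-z) = detE q0 z := fun z => by simp [detE]
  have detE_conj : ∀ z, conj (detE q0 (conj z)) = detE q0 z := fun z => by simp [detE]
  refine ⟨h0, hm, hp, fun z hz => hS.rel z hz x t, hΦp.ext_one x t, hΦp.ext_two x t,
    hΦm.ext_one x t, hΦm.ext_two x t, hS.ext_11, hS.ext_22, p1, n1, p2, p3, n2, n3, ?_, ?_, ?_, ?_⟩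
  · refine ExtendsTo.eqOn_Dp (q0 := q0) (hS.ext_11.mul ?_)
      (((up 0).mul (un 1)).sub ((up 1).mul (un 0))) w1
    refine extendsTo_of_differentiableAt fun z hz => ?_
    have hz0 : z ≠ 0 := hz.elim ne_zero_of_mem_Dp fun h => h.1.2
    unfold detE
    exact (differentiableAt_const _).add ((differentiableAt_const _).div (by fun_prop)
      (pow_ne_zero 2 hz0))
  · refine ExtendsTo.eqOn_Dp (q0 := q0) hS.ext_11 (hS.ext_11.comp
      (φ := fun z => -z) (fun z _ => differentiableAt_id.neg) (fun z hz => neg_mem_Dp hz) fun z hz => arc_neg hz)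
      fun z hz => mul_right_cancel₀ (hdet z hz) ?_
    have h1 := w1 (-z) (arc_neg hz)
    rw [detE_neg] at h1
    have h2 := JP.neg_symm hp hz.1 hz.2 x
    have h3 := JN.neg_symm hm hz.1 hz.2 x
    rw [w1 z hz, h1, h2.1.1, h2.1.2, h3.2.1, h3.2.2]; ring
  · refine ExtendsTo.eqOn_Dm (q0 := q0) hS.ext_22 (hS.ext_11.comp_conj pair.symm)
      fun z hz => mul_right_cancel₀ (hdet z hz) ?_
    have h1 := congrArg conj (w1 (conj z) (arc_conj hz))
    rw [map_mul, detE_conj] at h1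
    have h2 := JP.conj_symm hp hz.1 hz.2 x
    have h3 := JN.conj_symm hm hz.1 hz.2 x
    rw [w2 z hz, h1, h2.2.1, h2.2.2, h3.1.1, h3.1.2]
    simp only [map_sub, map_mul]; ring
  · refine ExtendsTo.eqOn_Dm (q0 := q0) hS.ext_22 ((hS.ext_11.comp_hatz pair.symm h0).const_mul _)
      fun z hz => mul_right_cancel₀ (hdet z hz) ?_
    have h1 := w1 _ (arc_hatz h0 hz)
    have hq : (q0 : ℂ) ≠ 0 := by exact_mod_cast h0.ne'
    have hz0 := hz.1.2
    -- The factor `z²/q₀²` gained by `det E` combines with the `z⁻²` from the two column symmetries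
    -- into the constant `conj q₋ q₊ / q₀²`.
    have hd : detE q0 (hatz q0 z) = z ^ 2 / (q0 : ℂ) ^ 2 * detE q0 z := by
      unfold detE hatz; field_simp; ring
    rw [hd] at h1
    have h2 := fun i => (JP.hat_symm h0 hp hz.1 hz.2 x i).2
    have h3 := fun i => (JN.hat_symm h0 hm hz.1 hz.2 x i).1
    rw [w2 z hz, h2, h2, h3, h3]
    have e : conj qm * qp / (q0 : ℂ) ^ 2 * S (hatz q0 z) 0 0 * detE q0 z = conj qm * qp / z ^ 2 *
      (S (hatz q0 z) 0 0 * (z ^ 2 / (q0 : ℂ) ^ 2 * detE q0 z)) := by field_simp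
    rw [e, h1]
    field_simp
    rw [I_sq]; ring

/-! ### The potential and its reflection -/

lemma exists_norm_le_of_tendsto {u : ℝ → ℂ} {a b : ℂ} (hu : Continuous u)
    (ha : Tendsto u atBot (𝓝 a)) (hb : Tendsto u atTop (𝓝 b)) : ∃ K, ∀ x, ‖u x‖ ≤ K := by
  obtain ⟨A, hA⟩ := eventually_atBot.1
    (ha.norm.eventually_le_const (lt_add_one ‖a‖))
  obtain ⟨B, hB⟩ := eventually_atTop.1
    (hb.norm.eventually_le_const (lt_add_one ‖b‖))
  obtain ⟨K, hK⟩ := (isCompact_Icc (a := A) (b := B)).exists_bound_of_continuousOn hu.continuousOn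
  refine ⟨max K (max (‖a‖ + 1) (‖b‖ + 1)), fun x => ?_⟩
  rcases le_total x A with h | h
  · exact (hA x h).trans ((le_max_left _ _).trans (le_max_right _ _))
  rcases le_total B x with h' | h'
  · exact (hB x h').trans ((le_max_right _ _).trans (le_max_right _ _))
  · exact (hK x ⟨h, h'⟩).trans (le_max_left _ _)

/-- Factor `|u|² - q₀²` as `(|u| + q₀)(|u| - q₀)`: the first factor is bounded, and the second is at
most `|u - c|` in modulus. -/
lemma integrableOn_sq_sub {u : ℝ → ℂ} {c : ℂ} {q0 K : ℝ} {s : Set ℝ}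
    (hu : Continuous u) (hK : ∀ x, ‖u x‖ ≤ K) (hc : ‖c‖ = q0)
    (h : IntegrableOn (fun x : ℝ => ((1 + |x| : ℝ) : ℂ) * (u x - c)) s) :
    IntegrableOn (fun x => ‖u x‖ ^ 2 - q0 ^ 2) s := by
  refine (h.norm.const_mul (K + q0)).mono' ?_ ?_
  · exact Continuous.aestronglyMeasurable (by fun_prop)
  · refine Eventually.of_forall fun x => ?_
    have h1 : |‖u x‖ - q0| ≤ ‖u x - c‖ := by rw [← hc]; exact abs_norm_sub_norm_le _ _
    have h2 : ‖u x - c‖ ≤ ‖((1 + |x| : ℝ) : ℂ) * (u x - c)‖ := by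
      rw [norm_mul, norm_real, Real.norm_of_nonneg (by positivity)]
      nlinarith [norm_nonneg (u x - c), abs_nonneg x]
    have h3 : 0 ≤ q0 := hc ▸ norm_nonneg c
    rw [Real.norm_eq_abs, show ‖u x‖ ^ 2 - q0 ^ 2 = (‖u x‖ + q0) * (‖u x‖ - q0) by ring, abs_mul,
      abs_of_nonneg (by positivity)]
    gcongr
    · linarith [(norm_nonneg (u x)).trans (hK x)]
    · exact hK x
    · exact h1.trans h2

section Potential

variable {q0 : ℝ} {qm qp : ℂ} {q : ℝ → ℝ → ℂ}

lemma IsPotential.integrable_sq_sub (hq : IsPotential q0 qm qp q) (t : ℝ) :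
    Integrable fun x => ‖q x t‖ ^ 2 - q0 ^ 2 := by
  have hc := (hq.smooth_x t).continuous
  obtain ⟨K, hK⟩ := exists_norm_le_of_tendsto hc (hq.lim_minus t) (hq.lim_plus t)
  have h1 := integrableOn_sq_sub hc hK hq.norm_minus (hq.weight_minus t)
  have h2 := integrableOn_sq_sub hc hK hq.norm_plus (hq.weight_plus t)
  rw [← integrableOn_Iic_iff_integrableOn_Iio] at h1
  have := h1.union h2
  rwa [Iic_union_Ioi, integrableOn_univ] at this

lemma IsPotential.rightPotential (hq : IsPotential q0 qm qp q) (t : ℝ) :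
    RightPotential q0 (fun x => q x t) qp where
  pos := hq.pos
  norm_eq := hq.norm_plus
  smooth := (hq.smooth_x t).of_le (by norm_num)
  lim := hq.lim_plus t
  bounded := exists_norm_le_of_tendsto (hq.smooth_x t).continuous (hq.lim_minus t) (hq.lim_plus t)
  int_sq := hq.integrable_sq_sub t
  int_deriv := hq.deriv_int t

lemma IsPotential.rightPotential_reflect (hq : IsPotential q0 qm qp q) (t : ℝ) :
    RightPotential q0 (fun x => conj (q (-x) t)) (conj qm) where
  pos := hq.pos
  norm_eq := by rw [RCLike.norm_conj, hq.norm_minus]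
  smooth := by
    have h1 : ContDiff ℝ 1 fun x => q (-x) t :=
      ((hq.smooth_x t).of_le (by norm_num)).comp contDiff_neg
    exact conjCLE.contDiff.comp h1
  lim := (continuous_conj.tendsto _).comp ((hq.lim_minus t).comp tendsto_neg_atTop_atBot)
  bounded := by
    obtain ⟨K, hK⟩ := exists_norm_le_of_tendsto (hq.smooth_x t).continuous (hq.lim_minus t)
      (hq.lim_plus t)
    exact ⟨K, fun x => by rw [RCLike.norm_conj]; exact hK _⟩
  int_sq := by simpa only [RCLike.norm_conj] using (hq.integrable_sq_sub t).comp_neg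
  int_deriv := by
    have hd : ∀ x, deriv (fun x => conj (q (-x) t)) x = -conj (deriv (fun x => q x t) (-x)) := by
      intro x
      have h1 : HasDerivAt (fun x => q x t) (deriv (fun x => q x t) (-x)) (-x) :=
        (((hq.smooth_x t).differentiable (by norm_num)) (-x)).hasDerivAt
      have h2 := (h1.scomp x (hasDerivAt_neg x)).star
      exact (h2.congr_deriv (by simp)).deriv
    have h3 := ((hq.deriv_int t).comp_neg).norm
    refine (integrable_norm_iff ?_).1 (h3.congr (Eventually.of_forall fun x => ?_))
    · exact (measurable_deriv _).aestronglyMeasurable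
    · simp only [hd, norm_neg, RCLike.norm_conj]

lemma vPlus_reflect (x t : ℝ) :
    vPlus q0 (fun x => conj (q (-x) t)) (-x) = -vMinus q0 q x t := by
  unfold vPlus vMinus
  have := integral_comp_neg_Ioi (-x) (fun y => ‖q y t‖ ^ 2 - q0 ^ 2)
  simp only [RCLike.norm_conj]
  rw [this, neg_neg]; ring

end Potential

/-! ### Entries of the Riemann–Hilbert matrix -/

section Entries

variable {q0 x t : ℝ} {Φm Φp : ℝ → ℝ → ℂ → Mat} {S : ℂ → Mat} {z : ℂ}

lemma modJost_zero (Φ : ℝ → ℝ → ℂ → Mat) (z : ℂ) (i : Fin 2) :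
    modJost q0 Φ x t z i 0 = Φ x t z i 0 * exp (-(I * theta q0 x t z)) := by
  simp [modJost, expSigma3, Matrix.mul_apply, Fin.sum_univ_two]

lemma modJost_one (Φ : ℝ → ℝ → ℂ → Mat) (z : ℂ) (i : Fin 2) :
    modJost q0 Φ x t z i 1 = Φ x t z i 1 * exp (I * theta q0 x t z) := by
  simp [modJost, expSigma3, Matrix.mul_apply, Fin.sum_univ_two]

lemma Mrhp_zero_Dp (hz : z ∈ Dp) (i : Fin 2) : Mrhp q0 Φm Φp S x t z i 0 =
    (S z 0 0)⁻¹ * (Φp x t z i 0 * exp (-(I * theta q0 x t z))) := by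
  simp [Mrhp, hz, colPair, col, modJost_zero]

lemma Mrhp_one_Dp (hz : z ∈ Dp) (i : Fin 2) : Mrhp q0 Φm Φp S x t z i 1 =
    Φm x t z i 1 * exp (I * theta q0 x t z) := by
  simp [Mrhp, hz, colPair, col, modJost_one]

lemma Mrhp_zero_Dm (hz : z ∈ Dm) (i : Fin 2) : Mrhp q0 Φm Φp S x t z i 0 =
    Φm x t z i 0 * exp (-(I * theta q0 x t z)) := by
  simp [Mrhp, Dm_not_Dp hz, colPair, col, modJost_zero]

lemma Mrhp_one_Dm (hz : z ∈ Dm) (i : Fin 2) : Mrhp q0 Φm Φp S x t z i 1 =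
    (S z 1 1)⁻¹ * (Φp x t z i 1 * exp (I * theta q0 x t z)) := by
  simp [Mrhp, Dm_not_Dp hz, colPair, col, modJost_one]

variable {qm qp : ℂ}

lemma conj_exp_theta (z : ℂ) : conj (exp (I * theta q0 x t (conj z))) =
    exp (-(I * theta q0 x t z)) := by
  rw [theta_conj, ← exp_conj]; simp

lemma conj_exp_neg_theta (z : ℂ) : conj (exp (-(I * theta q0 x t (conj z)))) =
    exp (I * theta q0 x t z) := by
  rw [theta_conj, ← exp_conj]; simp

/-- This transfers the estimates at infinity from `D⁺` to `D⁻`. -/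
lemma Mrhp_conj (h : ScatteringRelations q0 qm qp (Φp x t) (Φm x t) S) (hz : z ∈ Dm) :
    (Mrhp q0 Φm Φp S x t z 0 0 = conj (Mrhp q0 Φm Φp S x t (conj z) 1 1) ∧
      Mrhp q0 Φm Φp S x t z 1 0 = -conj (Mrhp q0 Φm Φp S x t (conj z) 0 1)) ∧
    (Mrhp q0 Φm Φp S x t z 0 1 = -conj (Mrhp q0 Φm Φp S x t (conj z) 1 0) ∧
      Mrhp q0 Φm Φp S x t z 1 1 = conj (Mrhp q0 Φm Φp S x t (conj z) 0 0)) := by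
  have hz' := conj_mem_Dp hz
  have h1 := h.conjN z hz
  have h2 := h.conjP _ hz'
  rw [conj_conj] at h2
  refine ⟨⟨?_, ?_⟩, ?_, ?_⟩
  · rw [Mrhp_zero_Dm hz, Mrhp_one_Dp hz', map_mul, conj_exp_theta, h1.1]
  · rw [Mrhp_zero_Dm hz, Mrhp_one_Dp hz', map_mul, conj_exp_theta, h1.2]; ring
  · rw [Mrhp_one_Dm hz, Mrhp_zero_Dp hz', map_mul, map_mul, conj_exp_neg_theta, h2.2, map_inv₀,
      ← h.s_conj z hz, map_neg, conj_conj]; ring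
  · rw [Mrhp_one_Dm hz, Mrhp_zero_Dp hz', map_mul, map_mul, conj_exp_neg_theta, h2.1, map_inv₀,
      ← h.s_conj z hz, conj_conj]

/-- This transfers the behaviour at infinity to the origin. The constant relating `s₂₂` to `s₁₁`
replaces `q₊` by `q₋`, so both columns of `M` transform with `q₋` only. -/
lemma Mrhp_hatz (h : ScatteringRelations q0 qm qp (Φp x t) (Φm x t) S) (hz : z ∈ Dp ∪ Dm)
    (i : Fin 2) :
    Mrhp q0 Φm Φp S x t z i 0 = I * conj qm / z * Mrhp q0 Φm Φp S x t (hatz q0 z) i 1 ∧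
    Mrhp q0 Φm Φp S x t z i 1 = I * qm / z * Mrhp q0 Φm Φp S x t (hatz q0 z) i 0 := by
  have hz0 := ne_zero_of_mem hz
  have hθ : theta q0 x t (hatz q0 z) = -theta q0 x t z := theta_hatz h.pos hz0 x t
  have hq : (q0 : ℂ) ≠ 0 := by exact_mod_cast h.pos.ne'
  have m1 := mul_conj_of_norm h.norm_minus
  have p1 := mul_conj_of_norm h.norm_plus
  have qm0 : conj qm ≠ 0 := fun hh => pow_ne_zero 2 hq (by rw [← m1, hh, mul_zero])
  have qp0 : qp ≠ 0 := fun hh => pow_ne_zero 2 hq (by rw [← p1, hh, zero_mul])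
  rcases hz with hz | hz
  · have hz' := hatz_mem_Dm h.pos hz
    have hs := h.s_hat _ hz'
    rw [hatz_hatz h.pos hz0] at hs
    constructor
    · rw [Mrhp_zero_Dp hz, Mrhp_one_Dm hz', hθ, h.hatP0 z hz, hs, mul_neg, mul_inv,
        ← p1, inv_div]
      field_simp
    · rw [Mrhp_one_Dp hz, Mrhp_zero_Dm hz', hθ, h.hatN1 z hz, mul_neg, neg_neg]; ring
  · have hz' := hatz_mem_Dp h.pos hz
    constructor
    · rw [Mrhp_zero_Dm hz, Mrhp_one_Dp hz', hθ, h.hatN0 z hz, mul_neg]; ring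
    · rw [Mrhp_one_Dm hz, Mrhp_zero_Dp hz', hθ, h.hatP1 z hz, h.s_hat z hz, mul_neg, neg_neg,
        mul_inv, ← m1, inv_div]
      field_simp

end Entries

/-! ### Asymptotic behaviour -/

/-- The asymptotics of the first column, from those of the Jost columns. -/
lemma quotient_asymptotics {L : Filter ℂ} {a b c d s D e : ℂ → ℂ} {α γ : ℂ} (hα : α ≠ 0) (hγ : γ ≠ 0)
    (he : Tendsto e L (𝓝 0)) (ha : (fun z => a z - α) =O[L] e) (hb : b =O[L] e)
    (hc : (fun z => c z - γ) =O[L] e) (hd : d =O[L] e) (hD : (fun z => D z - 1) =O[L] e)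
    (hs : ∀ᶠ z in L, s z * D z = a z * c z - b z * d z) :
    (fun z => (s z)⁻¹ * a z - γ⁻¹) =O[L] e ∧ (fun z => (s z)⁻¹ * b z) =O[L] e := by
  have ta : Tendsto a L (𝓝 α) := by simpa using (ha.trans_tendsto he).add_const α
  have tb := hb.trans_tendsto he
  have tc : Tendsto c L (𝓝 γ) := by simpa using (hc.trans_tendsto he).add_const γ
  have td := hd.trans_tendsto he
  have tD : Tendsto D L (𝓝 1) := by simpa using (hD.trans_tendsto he).add_const 1
  have ts : Tendsto s L (𝓝 (α * γ)) := by
    have h1 := ((ta.mul tc).sub (tb.mul td)).div tD one_ne_zero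
    simp only [mul_zero, sub_zero, div_one] at h1
    refine h1.congr' ?_
    filter_upwards [hs, tD.eventually_ne one_ne_zero] with z hz hz'
    simp only [Pi.div_apply]
    rw [← hz, mul_div_cancel_right₀ _ hz']
  have tsi : (fun z => (s z)⁻¹) =O[L] (fun _ => (1 : ℂ)) :=
    (ts.inv₀ (mul_ne_zero hα hγ)).isBigO_one ℂ
  constructor
  · have h1 : (fun z => a z * (γ - c z) + s z * (D z - 1) + b z * d z) =O[L] e := by
      have e1 : (fun z => γ - c z) =O[L] e := hc.neg_left.congr_left fun z => neg_sub _ _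
      have k1 := ((ta.isBigO_one ℂ).mul e1).congr_right (g₂ := e) fun z => one_mul _
      have k2 := ((ts.isBigO_one ℂ).mul hD).congr_right (g₂ := e) fun z => one_mul _
      have k3 := ((tb.isBigO_one ℂ).mul hd).congr_right (g₂ := e) fun z => one_mul _
      exact (k1.add k2).add k3
    have h2 := ((tsi.mul h1).congr_right (g₂ := e) fun z => one_mul _).const_mul_left γ⁻¹
    refine h2.congr' ?_ EventuallyEq.rfl
    filter_upwards [hs, ts.eventually_ne (mul_ne_zero hα hγ)] with z hz hz'
    field_simp
    linear_combination hz
  · exact (tsi.mul hb).congr_right (g₂ := e) fun z => one_mul _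

/-- The filter of large values in `V`. -/
def atInf (V : Set ℂ) : Filter ℂ := Bornology.cobounded ℂ ⊓ 𝓟 V

lemma tendsto_inv_atInf (V : Set ℂ) : Tendsto (fun z : ℂ => z⁻¹) (atInf V) (𝓝 0) :=
  tendsto_inv₀_cobounded.mono_left inf_le_left

lemma isBigO_atInf_of_bound {V : Set ℂ} {f : ℂ → ℂ} {C R : ℝ}
    (h : ∀ z ∈ V, R ≤ ‖z‖ → ‖f z‖ ≤ C / ‖z‖) : f =O[atInf V] fun z => z⁻¹ := by
  refine Asymptotics.IsBigO.of_bound C ?_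
  have h1 : ∀ᶠ z : ℂ in atInf V, R ≤ ‖z‖ :=
    (tendsto_norm_cobounded_atTop.eventually_ge_atTop R).filter_mono inf_le_left
  have h2 : ∀ᶠ z : ℂ in atInf V, z ∈ V := eventually_inf_principal.2 (Eventually.of_forall fun _ => id)
  filter_upwards [h1, h2] with z hz hV
  rw [norm_inv, ← div_eq_mul_inv]; exact h z hV hz

lemma exists_bound_of_isBigO_atInf {V : Set ℂ} {f : ℂ → ℂ} (h : f =O[atInf V] fun z => z⁻¹) :
    ∃ C R : ℝ, ∀ z ∈ V, R ≤ ‖z‖ → ‖f z‖ ≤ C / ‖z‖ := by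
  obtain ⟨C, hC⟩ := h.bound
  rw [atInf, eventually_inf_principal, ← comap_norm_atTop, eventually_comap] at hC
  obtain ⟨R, hR⟩ := eventually_atTop.1 hC
  exact ⟨C, R, fun z hz hn => by
    have := hR _ hn z rfl hz
    rwa [norm_inv, ← div_eq_mul_inv] at this⟩

/-- The leading term of `M` at infinity and at the origin. -/
def Mlead (q0 : ℝ) (q : ℝ → ℝ → ℂ) (qm : ℂ) (x t : ℝ) (z : ℂ) : Mat :=
  expSigma3 (I * (vMinus q0 q x t : ℂ)) * (1 + (I / z) • (sigma3 * potMat qm))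

section

variable {q0 x t : ℝ} {qm qp : ℂ} {q : ℝ → ℝ → ℂ} {Φm Φp : ℝ → ℝ → ℂ → Mat} {S : ℂ → Mat} {z : ℂ}

lemma Mlead_zero (z : ℂ) : Mlead q0 q qm x t z 0 0 = exp (I * vMinus q0 q x t) ∧
    Mlead q0 q qm x t z 1 0 = exp (-(I * vMinus q0 q x t)) * (I * conj qm / z) := by
  constructor
  · simp [Mlead, expSigma3, sigma3, potMat, Matrix.mul_apply, Fin.sum_univ_two]
  · simp [Mlead, expSigma3, sigma3, potMat, Matrix.mul_apply, Fin.sum_univ_two]; ring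

lemma Mlead_one (z : ℂ) : Mlead q0 q qm x t z 0 1 = exp (I * vMinus q0 q x t) * (I * qm / z) ∧
    Mlead q0 q qm x t z 1 1 = exp (-(I * vMinus q0 q x t)) := by
  constructor
  · simp [Mlead, expSigma3, sigma3, potMat, Matrix.mul_apply, Fin.sum_univ_two]; ring
  · simp [Mlead, expSigma3, sigma3, potMat, Matrix.mul_apply, Fin.sum_univ_two]

lemma detE_sub_one_isBigO (V : Set ℂ) : (fun z => detE q0 z - 1) =O[atInf V] fun z => z⁻¹ := by
  have h1 : (fun z : ℂ => z⁻¹) =O[atInf V] fun _ => (1 : ℂ) :=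
    (tendsto_inv_atInf V).isBigO_one ℂ
  have h2 := ((h1.mul (Asymptotics.isBigO_refl (fun z : ℂ => z⁻¹) (atInf V))).const_mul_left
    ((q0 : ℂ) ^ 2))
  refine (h2.congr_left fun z => ?_).congr_right fun z => one_mul _
  unfold detE; rw [add_sub_cancel_left, ← mul_inv, ← sq, div_eq_mul_inv]

lemma Mrhp_atInf_Dp (hq : IsPotential q0 qm qp q) (hΦm : IsJostMinus q0 q qm Φm)
    (hΦp : IsJostPlus q0 q qp Φp) (h : ScatteringRelations q0 qm qp (Φp x t) (Φm x t) S) :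
    ((fun z => Mrhp q0 Φm Φp S x t z 0 0 - exp (I * vMinus q0 q x t)) =O[atInf Dp] fun z => z⁻¹) ∧
    ((fun z => Mrhp q0 Φm Φp S x t z 1 0) =O[atInf Dp] fun z => z⁻¹) ∧
    ((fun z => Mrhp q0 Φm Φp S x t z 0 1) =O[atInf Dp] fun z => z⁻¹) ∧
    ((fun z => Mrhp q0 Φm Φp S x t z 1 1 - exp (-(I * vMinus q0 q x t)))
      =O[atInf Dp] fun z => z⁻¹) := by
  obtain ⟨C, R, -, hP⟩ := (hq.rightPotential t).jost_asymptotics (hΦp.onSig.isJostMat t)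
    (fun x i => hΦp.ext_one x t i) x
  -- The second column of `Φ₋` is the first column of the reflected matrix with its two entries
  -- exchanged.
  obtain ⟨C', R', -, hN⟩ := (hq.rightPotential_reflect t).jost_asymptotics
    (hΦm.onSig.isJostMat t).reflect (fun x i => by
      fin_cases i
      · exact hΦm.ext_two (-x) t 1
      · exact hΦm.ext_two (-x) t 0) (-x)
  have hθ : ∀ z, -(I * theta q0 (-x) (-t) z) = I * theta q0 x t z := fun z => by
    rw [theta_reflect]; simp
  have hv : exp (I * (vPlus q0 (fun x => conj (q (-x) t)) (-x) : ℂ)) =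
      exp (-(I * vMinus q0 q x t)) := by rw [vPlus_reflect]; simp
  simp only [hθ, hv, reflectJost, neg_neg, Matrix.of_apply, Matrix.cons_val', Matrix.cons_val_zero,
    Matrix.cons_val_one, Matrix.cons_val_fin_one] at hN
  have ev : ∀ᶠ z in atInf Dp, z ∈ Dp := eventually_inf_principal.2 (Eventually.of_forall fun _ => id)
  have hc := isBigO_atInf_of_bound fun z hz hR => (hN z hz hR).1
  have hd := isBigO_atInf_of_bound fun z hz hR => (hN z hz hR).2
  -- Here `α = e^{iv₊}` and `γ = e^{-iv₋}`. Thus `s₁₁` tends to `αγ`, the phase `v₊` drops out of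
  -- `μ₊₁/s₁₁`, and the limit is `γ⁻¹ = e^{iv₋}`.
  obtain ⟨k1, k2⟩ := quotient_asymptotics (s := fun z => S z 0 0) (exp_ne_zero _) (exp_ne_zero _)
    (tendsto_inv_atInf Dp)
    (isBigO_atInf_of_bound fun z hz hR => (hP z hz hR).1)
    (isBigO_atInf_of_bound fun z hz hR => (hP z hz hR).2) hc hd (detE_sub_one_isBigO (q0 := q0) Dp) (by
      filter_upwards [ev] with z hz
      have : exp (-(I * theta q0 x t z)) * exp (I * theta q0 x t z) = 1 := by
        rw [← Complex.exp_add, neg_add_cancel, Complex.exp_zero]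
      rw [h.wronskian z hz]
      linear_combination -(Φp x t z 0 0 * Φm x t z 1 1 - Φp x t z 1 0 * Φm x t z 0 1) * this)
  rw [← Complex.exp_neg, neg_neg] at k1
  refine ⟨k1.congr' ?_ EventuallyEq.rfl, k2.congr' ?_ EventuallyEq.rfl,
    hd.congr' ?_ EventuallyEq.rfl, hc.congr' ?_ EventuallyEq.rfl⟩ <;>
    filter_upwards [ev] with z hz
  · rw [Mrhp_zero_Dp hz]
  · rw [Mrhp_zero_Dp hz]
  · rw [Mrhp_one_Dp hz]
  · rw [Mrhp_one_Dp hz]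

lemma exp_sigma3_conj (v : ℝ) : conj (exp (I * v)) = exp (-(I * v)) := by
  rw [← exp_conj]; simp

/-- `M - e^{iv₋σ₃} = O(1/z)` at infinity. -/
theorem Mrhp_bound_atInf (hq : IsPotential q0 qm qp q) (hΦm : IsJostMinus q0 q qm Φm)
    (hΦp : IsJostPlus q0 q qp Φp) (h : ScatteringRelations q0 qm qp (Φp x t) (Φm x t) S) :
    ∃ C R : ℝ, 0 < R ∧ ∀ z ∈ Dp ∪ Dm, R ≤ ‖z‖ → ∀ i j,
      ‖Mrhp q0 Φm Φp S x t z i j - expSigma3 (I * vMinus q0 q x t) i j‖ ≤ C / ‖z‖ := by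
  obtain ⟨a, b, c, d⟩ := Mrhp_atInf_Dp hq hΦm hΦp h
  obtain ⟨C1, R1, h1⟩ := exists_bound_of_isBigO_atInf a
  obtain ⟨C2, R2, h2⟩ := exists_bound_of_isBigO_atInf b
  obtain ⟨C3, R3, h3⟩ := exists_bound_of_isBigO_atInf c
  obtain ⟨C4, R4, h4⟩ := exists_bound_of_isBigO_atInf d
  set C := max (max C1 C2) (max C3 C4)
  set R := max (max R1 R2) (max (max R3 R4) 1)
  have hDp : ∀ z ∈ Dp, R ≤ ‖z‖ → ∀ i j,
      ‖Mrhp q0 Φm Φp S x t z i j - expSigma3 (I * vMinus q0 q x t) i j‖ ≤ C / ‖z‖ := by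
    intro z hz hR i j
    simp only [R, max_le_iff] at hR
    have hC : ∀ c ≤ C, c / ‖z‖ ≤ C / ‖z‖ := fun c hc => by gcongr
    fin_cases i <;> fin_cases j
    · exact (by simpa [expSigma3] using h1 z hz hR.1.1 : _ ≤ C1 / ‖z‖).trans (hC _ (by simp [C]))
    · exact (by simpa [expSigma3] using h3 z hz hR.2.1.1 : _ ≤ C3 / ‖z‖).trans (hC _ (by simp [C]))
    · exact (by simpa [expSigma3] using h2 z hz hR.1.2 : _ ≤ C2 / ‖z‖).trans (hC _ (by simp [C]))
    · exact (by simpa [expSigma3] using h4 z hz hR.2.1.2 : _ ≤ C4 / ‖z‖).trans (hC _ (by simp [C]))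
  refine ⟨C, R, by simp [R], fun z hz hR i j => ?_⟩
  rcases hz with hz | hz
  · exact hDp z hz hR i j
  have hz' := conj_mem_Dp hz
  have hn : ‖conj z‖ = ‖z‖ := RCLike.norm_conj z
  have hh := hDp _ hz' (by rwa [hn])
  rw [hn] at hh
  obtain ⟨⟨m1, m2⟩, m3, m4⟩ := Mrhp_conj h hz
  have e := exp_sigma3_conj (vMinus q0 q x t)
  have e' : conj (exp (-(I * (vMinus q0 q x t : ℂ)))) = exp (I * vMinus q0 q x t) := by
    rw [← e, conj_conj]
  fin_cases i <;> fin_cases j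
  · refine le_of_eq_of_le ?_ (hh 1 1)
    simp only [expSigma3, Fin.zero_eta, Matrix.of_apply, Matrix.cons_val',
      Matrix.cons_val_zero, Matrix.cons_val_one, Matrix.cons_val_fin_one]
    rw [m1, ← e', ← map_sub, RCLike.norm_conj]
  · refine le_of_eq_of_le ?_ (hh 1 0)
    simp only [expSigma3, Fin.zero_eta, Fin.mk_one, Matrix.of_apply, Matrix.cons_val',
      Matrix.cons_val_zero, Matrix.cons_val_one, Matrix.cons_val_fin_one, sub_zero]
    rw [m3, norm_neg, RCLike.norm_conj]
  · refine le_of_eq_of_le ?_ (hh 0 1)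
    simp only [expSigma3, Fin.zero_eta, Fin.mk_one, Matrix.of_apply, Matrix.cons_val',
      Matrix.cons_val_zero, Matrix.cons_val_one, Matrix.cons_val_fin_one, sub_zero]
    rw [m2, norm_neg, RCLike.norm_conj]
  · refine le_of_eq_of_le ?_ (hh 0 0)
    simp only [expSigma3, Fin.mk_one, Matrix.of_apply, Matrix.cons_val',
      Matrix.cons_val_zero, Matrix.cons_val_one, Matrix.cons_val_fin_one]
    rw [m4, ← e, ← map_sub, RCLike.norm_conj]

lemma hatz_mem_union (h0 : 0 < q0) (hz : z ∈ Dp ∪ Dm) : hatz q0 z ∈ Dp ∪ Dm :=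
  hz.elim (fun h => Or.inr (hatz_mem_Dm h0 h)) fun h => Or.inl (hatz_mem_Dp h0 h)

lemma norm_hatz (z : ℂ) : ‖hatz q0 z‖ = q0 ^ 2 / ‖z‖ := by
  unfold hatz; rw [norm_neg, norm_div, norm_pow, norm_real, Real.norm_eq_abs, sq_abs]

/-- `M - e^{iv₋σ₃}(1 + (i/z)σ₃Q₋)` is bounded near the origin. -/
theorem Mrhp_bound_zero (hq : IsPotential q0 qm qp q) (hΦm : IsJostMinus q0 q qm Φm)
    (hΦp : IsJostPlus q0 q qp Φp) (h : ScatteringRelations q0 qm qp (Φp x t) (Φm x t) S) :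
    ∃ C r : ℝ, 0 < r ∧ ∀ z ∈ Dp ∪ Dm, ‖z‖ ≤ r → ∀ i j,
      ‖Mrhp q0 Φm Φp S x t z i j - Mlead q0 q qm x t z i j‖ ≤ C := by
  obtain ⟨C, R, hR, hb⟩ := Mrhp_bound_atInf hq hΦm hΦp h
  have h0 := h.pos
  refine ⟨C / q0 + 1, q0 ^ 2 / R, by positivity, fun z hz hn => ?_⟩
  have hzn : 0 < ‖z‖ := norm_pos_iff.2 (ne_zero_of_mem hz)
  -- The disc `‖z‖ ≤ q0²/R` is sent outside the disc of radius `R`. There the error at infinity is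
  -- `O(z)` in terms of the original `z`, and the prefactor `1/z` leaves a bounded remainder.
  have hb' := hb _ (hatz_mem_union h0 hz) (by rw [norm_hatz, le_div_iff₀ hzn]; rwa [le_div_iff₀' hR] at hn)
  rw [norm_hatz] at hb'
  have key : ∀ c w : ℂ, ‖c‖ = q0 → ‖w‖ ≤ C / (q0 ^ 2 / ‖z‖) → ‖I * c / z * w‖ ≤ C / q0 := by
    intro c w hc hw
    rw [norm_mul, norm_div, norm_mul, norm_I, one_mul, hc]
    calc q0 / ‖z‖ * ‖w‖ ≤ q0 / ‖z‖ * (C / (q0 ^ 2 / ‖z‖)) := by gcongr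
      _ = C / q0 := by field_simp
  have e1 : ‖exp (I * (vMinus q0 q x t : ℂ))‖ = 1 := norm_exp_I_mul_real _
  have e2 : ‖exp (-(I * (vMinus q0 q x t : ℂ)))‖ = 1 := norm_exp_neg_I_mul_real _
  have hm' : ‖conj qm‖ = q0 := by rw [RCLike.norm_conj, h.norm_minus]
  have hm := h.norm_minus
  have w := fun i => Mrhp_hatz h hz i
  obtain ⟨l1, l2⟩ := Mlead_zero (q0 := q0) (q := q) (qm := qm) (x := x) (t := t) z
  obtain ⟨l3, l4⟩ := Mlead_one (q0 := q0) (q := q) (qm := qm) (x := x) (t := t) z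
  intro i j
  fin_cases i <;> fin_cases j
  · refine (norm_sub_le _ _).trans (add_le_add ?_ (by simp [l1]))
    simp only [Fin.zero_eta]
    rw [(w 0).1]
    exact key _ _ hm' (by simpa [expSigma3] using hb' 0 1)
  · simp only [Fin.zero_eta, Fin.mk_one]
    rw [(w 0).2, l3, show I * qm / z * Mrhp q0 Φm Φp S x t (hatz q0 z) 0 0 -
      exp (I * vMinus q0 q x t) * (I * qm / z) = I * qm / z *
        (Mrhp q0 Φm Φp S x t (hatz q0 z) 0 0 - exp (I * vMinus q0 q x t)) by ring]
    exact (key _ _ hm (by simpa [expSigma3] using hb' 0 0)).trans (by linarith)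
  · simp only [Fin.zero_eta, Fin.mk_one]
    rw [(w 1).1, l2, show I * conj qm / z * Mrhp q0 Φm Φp S x t (hatz q0 z) 1 1 -
      exp (-(I * vMinus q0 q x t)) * (I * conj qm / z) = I * conj qm / z *
        (Mrhp q0 Φm Φp S x t (hatz q0 z) 1 1 - exp (-(I * vMinus q0 q x t))) by ring]
    exact (key _ _ hm' (by simpa [expSigma3] using hb' 1 1)).trans (by linarith)
  · refine (norm_sub_le _ _).trans (add_le_add ?_ (by simpa [l4] using e2.le))
    simp only [Fin.mk_one]
    rw [(w 1).2]
    exact key _ _ hm (by simpa [expSigma3] using hb' 1 0)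

end

/-! ### Boundary values of `M` on `Σ` and the jump relation -/

/-- The limit of `M` at a point of `Σ` from `D⁻`. -/
def minusLim (M : ℂ → Mat) (z : ℂ) : Mat := limUnder (𝓝[Dm] z) M

lemma norm_of_mem_branch {q0 : ℝ} (h0 : 0 < q0) {z : ℂ} (hz : z ∈ branch q0) : ‖z‖ = q0 := by
  rcases hz with h | h
  · rw [h]; simp [abs_of_pos h0]
  · rw [mem_singleton_iff.1 h]; simp [abs_of_pos h0]

/-- The scattering relation is imposed only off the branch points, so the jump relation is available
only there. A ray can meet them only at radius `q0`, a null set that integrals ignore. -/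
lemma ray_ae_eq {q0 : ℝ} (h0 : 0 < q0) {f g : ℂ → ℂ} (h : EqOn f g (Sig \ branch q0)) {ω : ℂ}
    (hω : ω ∈ Sig) (h1 : ‖ω‖ = 1) :
    (fun s : ℝ => f (ω * s)) =ᵐ[volume.restrict (Ioi 0)] fun s : ℝ => g (ω * s) := by
  have h2 : ∀ᵐ s : ℝ ∂volume.restrict (Ioi 0), s ≠ q0 :=
    ae_restrict_of_ae (Measure.ae_ne volume q0)
  filter_upwards [h2, ae_restrict_mem measurableSet_Ioi] with s hs hs0
  refine h ⟨mul_mem_Sig hω hs0, fun hb => hs ?_⟩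
  rw [← norm_of_mem_branch h0 hb, norm_mul_ofReal h1 hs0]

lemma sigInt_congr {q0 : ℝ} (h0 : 0 < q0) {f g : ℂ → ℂ} (h : EqOn f g (Sig \ branch q0)) :
    sigInt f = sigInt g := by
  rw [sigInt_eq, sigInt_eq, integral_congr_ae (ray_ae_eq h0 h one_mem_Sig (by simp)),
    integral_congr_ae (ray_ae_eq h0 h neg_one_mem_Sig (by simp)),
    integral_congr_ae (ray_ae_eq h0 h I_mem_Sig (by simp)),
    integral_congr_ae (ray_ae_eq h0 h neg_I_mem_Sig (by simp))]

lemma SigIntegrable.congr {q0 : ℝ} (h0 : 0 < q0) {f g : ℂ → ℂ} (hf : SigIntegrable f)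
    (h : EqOn f g (Sig \ branch q0)) : SigIntegrable g := by
  rw [sigIntegrable_iff] at hf ⊢
  exact ⟨Integrable.congr hf.1 (ray_ae_eq h0 h one_mem_Sig (by simp)),
    Integrable.congr hf.2.1 (ray_ae_eq h0 h neg_one_mem_Sig (by simp)),
    Integrable.congr hf.2.2.1 (ray_ae_eq h0 h I_mem_Sig (by simp)),
    Integrable.congr hf.2.2.2 (ray_ae_eq h0 h neg_I_mem_Sig (by simp))⟩

lemma ExtendsTo.tendsto {f : ℂ → ℂ} {U Γ : Set ℂ} (hf : ExtendsTo f U Γ) {ζ : ℂ} (hζ : ζ ∈ Γ) :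
    Tendsto f (𝓝[U] ζ) (𝓝 (f ζ)) :=
  (hf.2 ζ (Or.inr hζ)).mono_left (nhdsWithin_mono ζ subset_union_left)

section

variable {q0 x t : ℝ} {qm qp : ℂ} {Φm Φp : ℝ → ℝ → ℂ → Mat} {S : ℂ → Mat} {ζ : ℂ}

lemma tendsto_exp_theta (hζ : ζ ∈ Sig) (V : Set ℂ) :
    Tendsto (fun z => exp (I * theta q0 x t z)) (𝓝[V] ζ) (𝓝 (exp (I * theta q0 x t ζ))) := by
  have : ContinuousAt (fun z => exp (I * theta q0 x t z)) ζ :=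
    ((differentiableAt_theta hζ.2).continuousAt.const_mul I).cexp
  exact this.tendsto.mono_left nhdsWithin_le_nhds

lemma tendsto_exp_neg_theta (hζ : ζ ∈ Sig) (V : Set ℂ) :
    Tendsto (fun z => exp (-(I * theta q0 x t z))) (𝓝[V] ζ)
      (𝓝 (exp (-(I * theta q0 x t ζ)))) := by
  have : ContinuousAt (fun z => exp (-(I * theta q0 x t z))) ζ :=
    ((differentiableAt_theta hζ.2).continuousAt.const_mul I).neg.cexp
  exact this.tendsto.mono_left nhdsWithin_le_nhds

lemma tendsto_matrix {l : Filter ℂ} {M : ℂ → Mat} {L : Mat} :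
    Tendsto M l (𝓝 L) ↔ ∀ i j, Tendsto (fun z => M z i j) l (𝓝 (L i j)) :=
  ⟨fun h i j => ((continuous_id.matrix_elem i j).tendsto L).comp h,
    fun h => tendsto_pi_nhds.2 fun i => tendsto_pi_nhds.2 fun j => h i j⟩

lemma tendsto_Mrhp_Dp (h : ScatteringRelations q0 qm qp (Φp x t) (Φm x t) S) {c : ℂ}
    (hζ : ζ ∈ Sig) (hc : Tendsto (fun w => (S w 0 0)⁻¹) (𝓝[Dp] ζ) (𝓝 c)) :
    Tendsto (Mrhp q0 Φm Φp S x t) (𝓝[Dp] ζ)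
      (𝓝 (colPair (fun i => c * (Φp x t ζ i 0 * exp (-(I * theta q0 x t ζ))))
        fun i => Φm x t ζ i 1 * exp (I * theta q0 x t ζ))) := by
  rw [tendsto_matrix]
  intro i j
  fin_cases j
  · refine (hc.mul (((h.extP0 i).tendsto hζ).mul (tendsto_exp_neg_theta hζ Dp))).congr' ?_
    filter_upwards [self_mem_nhdsWithin] with z hz using (Mrhp_zero_Dp hz i).symm
  · refine (((h.extN1 i).tendsto hζ).mul (tendsto_exp_theta hζ Dp)).congr' ?_
    filter_upwards [self_mem_nhdsWithin] with z hz using (Mrhp_one_Dp hz i).symm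

lemma tendsto_Mrhp_Dm (h : ScatteringRelations q0 qm qp (Φp x t) (Φm x t) S) {c : ℂ}
    (hζ : ζ ∈ Sig) (hc : Tendsto (fun w => (S w 1 1)⁻¹) (𝓝[Dm] ζ) (𝓝 c)) :
    Tendsto (Mrhp q0 Φm Φp S x t) (𝓝[Dm] ζ)
      (𝓝 (colPair (fun i => Φm x t ζ i 0 * exp (-(I * theta q0 x t ζ)))
        fun i => c * (Φp x t ζ i 1 * exp (I * theta q0 x t ζ)))) := by
  rw [tendsto_matrix]
  intro i j
  fin_cases j
  · refine (((h.extN0 i).tendsto hζ).mul (tendsto_exp_neg_theta hζ Dm)).congr' ?_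
    filter_upwards [self_mem_nhdsWithin] with z hz using (Mrhp_zero_Dm hz i).symm
  · refine (hc.mul (((h.extP1 i).tendsto hζ).mul (tendsto_exp_theta hζ Dm))).congr' ?_
    filter_upwards [self_mem_nhdsWithin] with z hz using (Mrhp_one_Dm hz i).symm

/-- Off the branch points `1/s₁₁` has a limit because `s₁₁` is continuous and nonzero there; at the
branch points the limit is part of the hypothesis on spectral singularities. -/
lemma tendsto_plusLim (h : ScatteringRelations q0 qm qp (Φp x t) (Φm x t) S)
    (hreg : NoSpectralSingularities q0 S) (hζ : ζ ∈ Sig) :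
    Tendsto (Mrhp q0 Φm Φp S x t) (𝓝[Dp] ζ) (𝓝 (plusLim (Mrhp q0 Φm Φp S x t) ζ)) := by
  obtain ⟨c, hc⟩ : ∃ c, Tendsto (fun w => (S w 0 0)⁻¹) (𝓝[Dp] ζ) (𝓝 c) := by
    by_cases hb : ζ ∈ branch q0
    · exact hreg.lim_11 ζ hb
    · exact ⟨_, (h.ext11.tendsto ⟨hζ, hb⟩).inv₀ (hreg.ne_11 ζ ⟨hζ, hb⟩)⟩
  exact tendsto_nhds_limUnder ⟨_, tendsto_Mrhp_Dp h hζ hc⟩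

lemma tendsto_minusLim (h : ScatteringRelations q0 qm qp (Φp x t) (Φm x t) S)
    (hreg : NoSpectralSingularities q0 S) (hζ : ζ ∈ Sig) :
    Tendsto (Mrhp q0 Φm Φp S x t) (𝓝[Dm] ζ) (𝓝 (minusLim (Mrhp q0 Φm Φp S x t) ζ)) := by
  obtain ⟨c, hc⟩ : ∃ c, Tendsto (fun w => (S w 1 1)⁻¹) (𝓝[Dm] ζ) (𝓝 c) := by
    by_cases hb : ζ ∈ branch q0
    · exact hreg.lim_22 ζ hb
    · exact ⟨_, (h.ext22.tendsto ⟨hζ, hb⟩).inv₀ (hreg.ne_22 ζ ⟨hζ, hb⟩)⟩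
  exact tendsto_nhds_limUnder ⟨_, tendsto_Mrhp_Dm h hζ hc⟩

/-- The jump relation `M⁺ J = M⁺ - M⁻`. -/
theorem plusLim_mul_jumpJ (h : ScatteringRelations q0 qm qp (Φp x t) (Φm x t) S)
    (hreg : NoSpectralSingularities q0 S) (hζ : ζ ∈ Sig \ branch q0) (i j : Fin 2) :
    (plusLim (Mrhp q0 Φm Φp S x t) ζ * jumpJ q0 S x t ζ) i j =
      plusLim (Mrhp q0 Φm Φp S x t) ζ i j - minusLim (Mrhp q0 Φm Φp S x t) ζ i j := by
  have n1 : (𝓝[Dp] ζ).NeBot := mem_closure_iff_nhdsWithin_neBot.1 (Sig_subset_closure.1 hζ.1)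
  have n2 : (𝓝[Dm] ζ).NeBot := mem_closure_iff_nhdsWithin_neBot.1 (Sig_subset_closure.2 hζ.1)
  have s1 := hreg.ne_11 ζ hζ
  have s2 := hreg.ne_22 ζ hζ
  rw [tendsto_nhds_unique (tendsto_plusLim h hreg hζ.1)
      (tendsto_Mrhp_Dp h hζ.1 ((h.ext11.tendsto hζ).inv₀ s1)),
    tendsto_nhds_unique (tendsto_minusLim h hreg hζ.1)
      (tendsto_Mrhp_Dm h hζ.1 ((h.ext22.tendsto hζ).inv₀ s2))]
  have ent : ∀ i j, Φp x t ζ i j = Φm x t ζ i 0 * S ζ 0 j + Φm x t ζ i 1 * S ζ 1 j := fun i j => by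
    rw [h.rel ζ hζ, Matrix.mul_apply, Fin.sum_univ_two]
  have e1 : exp (-(I * theta q0 x t ζ)) * exp (I * theta q0 x t ζ) = 1 := by
    rw [← Complex.exp_add, neg_add_cancel, Complex.exp_zero]
  set a := exp (-(I * theta q0 x t ζ))
  set b := exp (I * theta q0 x t ζ)
  have hJ : jumpJ q0 S x t ζ = !![0, -(b * b * rhoTilde S ζ); a * a * rho S ζ,
      a * b * (rho S ζ * rhoTilde S ζ)] := by
    ext i j
    fin_cases i <;> fin_cases j <;>
      simp [jumpJ, expSigma3, Matrix.mul_apply, Fin.sum_univ_two] <;> ring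
  rw [hJ, e1, one_mul]
  simp only [Matrix.mul_apply, Fin.sum_univ_two, colPair, rho, rhoTilde]
  fin_cases j
  · simp only [Fin.zero_eta, Matrix.of_apply, Matrix.cons_val', Matrix.cons_val_zero,
      Matrix.cons_val_one, Matrix.cons_val_fin_one, ent i 0]
    field_simp
    linear_combination (a * Φm x t ζ i 1 * S ζ 1 0) * e1
  · simp only [Fin.mk_one, Matrix.of_apply, Matrix.cons_val', Matrix.cons_val_zero,
      Matrix.cons_val_one, Matrix.cons_val_fin_one, ent i 0, ent i 1]
    field_simp
    linear_combination (-b * S ζ 0 1 * (Φm x t ζ i 0 * S ζ 0 0 + Φm x t ζ i 1 * S ζ 1 0)) * e1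

end

/-! ### Double zeros -/

section DoubleZero

variable {f s F : ℂ → ℂ} {η : ℂ}

/-- The order of vanishing is easier to transport through the symmetries than conditions on iterated
derivatives, so double zeros are handled in this form. -/
lemma analyticOrderAt_eq_two_of_isDoubleZero (hf : AnalyticAt ℂ f η) (h : IsDoubleZero f η) :
    analyticOrderAt f η = 2 := by
  refine (analyticOrderAt_eq_nat_iff_iteratedDeriv_eq_zero hf (n := 2)).2 ⟨fun k hk => ?_, h.2.2⟩
  interval_cases k
  · simpa using h.1
  · exact h.2.1

/-- Conjugation is not holomorphic, so the rule for compositions is unavailable; instead the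
factorization `(z - η)² g` is itself conjugated. -/
lemma analyticOrderAt_conj_conj (f : ℂ → ℂ) (η : ℂ) (h : analyticOrderAt f η = 2) :
    analyticOrderAt (fun z => conj (f (conj z))) (conj η) = 2 := by
  have hf : AnalyticAt ℂ f η := by
    by_contra hh
    rw [analyticOrderAt_of_not_analyticAt hh] at h
    exact absurd h (by norm_num)
  have key : ∀ {g : ℂ → ℂ}, AnalyticAt ℂ g η →
      AnalyticAt ℂ (fun z => conj (g (conj z))) (conj η) := by
    intro g hg
    rw [analyticAt_iff_eventually_differentiableAt] at hg ⊢
    have : Tendsto (fun z : ℂ => conj z) (𝓝 (conj η)) (𝓝 η) := by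
      simpa using continuous_conj.tendsto (conj η)
    filter_upwards [this.eventually hg] with z hz
    have := hz.conj_conj
    rwa [conj_conj] at this
  obtain ⟨g, hg, hg0, hgf⟩ := (hf.analyticOrderAt_eq_natCast (n := 2)).1 h
  refine ((key hf).analyticOrderAt_eq_natCast (n := 2)).2 ⟨_, key hg, by simpa using hg0, ?_⟩
  have : Tendsto (fun z : ℂ => conj z) (𝓝 (conj η)) (𝓝 η) := by
    simpa using continuous_conj.tendsto (conj η)
  filter_upwards [this.eventually hgf] with z hz
  rw [hz]; simp

/-- Factorization at a double zero. -/
lemma exists_factor_of_order_two (h : analyticOrderAt s η = 2) :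
    ∃ g : ℂ → ℂ, AnalyticAt ℂ g η ∧ (∀ᶠ z in 𝓝 η, s z = (z - η) ^ 2 * g z) ∧
      iteratedDeriv 2 s η = 2 * g η ∧ iteratedDeriv 3 s η = 6 * deriv g η ∧ g η ≠ 0 := by
  have hf : AnalyticAt ℂ s η := by
    by_contra hh
    rw [analyticOrderAt_of_not_analyticAt hh] at h
    exact absurd h (by norm_num)
  obtain ⟨g, hg, hg0, hgf⟩ := (hf.analyticOrderAt_eq_natCast (n := 2)).1 h
  simp only [smul_eq_mul] at hgf
  have d1 := hg.eventually_analyticAt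
  have e1 : deriv s =ᶠ[𝓝 η] fun z => 2 * (z - η) * g z + (z - η) ^ 2 * deriv g z := by
    refine (show s =ᶠ[𝓝 η] fun z => (z - η) ^ 2 * g z from hgf).deriv.trans ?_
    filter_upwards [d1] with z hz
    have h1 : HasDerivAt (fun z => (z - η) ^ 2) (2 * (z - η)) z := by
      simpa using ((hasDerivAt_id z).sub_const η).fun_pow 2
    exact (h1.mul hz.differentiableAt.hasDerivAt).deriv
  have e2 : deriv (deriv s) =ᶠ[𝓝 η] fun z => 2 * g z + (4 * (z - η)) * deriv g z +
      (z - η) ^ 2 * deriv (deriv g) z := by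
    refine e1.deriv.trans ?_
    filter_upwards [d1] with z hz
    have h0 : HasDerivAt (fun z => z - η) 1 z := (hasDerivAt_id z).sub_const η
    have h1 : HasDerivAt (fun z => (z - η) ^ 2) (2 * (z - η)) z := by
      simpa using h0.fun_pow 2
    refine ((((h0.const_mul 2).mul hz.differentiableAt.hasDerivAt).add
      (h1.mul hz.deriv.differentiableAt.hasDerivAt)).congr_deriv ?_).deriv
    ring
  have e3 : deriv (deriv (deriv s)) η = 6 * deriv g η := by
    rw [e2.deriv_eq]
    have h0 : HasDerivAt (fun z => z - η) 1 η := (hasDerivAt_id η).sub_const η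
    have h1 : HasDerivAt (fun z => (z - η) ^ 2) (2 * (η - η)) η := by
      simpa using h0.fun_pow 2
    refine (((hg.differentiableAt.hasDerivAt.const_mul 2).add
      ((h0.const_mul 4).mul hg.deriv.differentiableAt.hasDerivAt)).add
      (h1.mul hg.deriv.deriv.differentiableAt.hasDerivAt)).deriv.trans ?_
    simp only [sub_self]; ring
  refine ⟨g, hg, hgf, ?_, ?_, hg0⟩
  · rw [iteratedDeriv_succ, iteratedDeriv_one, e2.self_of_nhds]; ring
  · rw [iteratedDeriv_succ, iteratedDeriv_succ, iteratedDeriv_one, e3]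

/-- The second-order Taylor quotient has a limit. -/
lemma tendsto_taylor_quotient {G : ℂ → ℂ} (hG : AnalyticAt ℂ G η) :
    ∃ L, Tendsto (fun z => (G z - G η - deriv G η * (z - η)) / (z - η) ^ 2) (𝓝[≠] η) (𝓝 L) := by
  set K : ℂ → ℂ := fun z => G z - G η - deriv G η * (z - η) with hK
  have hKa : AnalyticAt ℂ K η := by fun_prop
  have h0 : K η = 0 := by simp [hK]
  have h1 : deriv K η = 0 := by
    have : HasDerivAt K (deriv G η - deriv G η * 1) η :=
      (hG.differentiableAt.hasDerivAt.sub_const _).sub (((hasDerivAt_id η).sub_const η).const_mul _)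
    simpa using this.deriv
  obtain ⟨g, hg, hgK⟩ := (natCast_le_analyticOrderAt hKa (n := 2)).1
    ((natCast_le_analyticOrderAt_iff_iteratedDeriv_eq_zero hKa).2 fun i hi => by
      interval_cases i
      · simpa using h0
      · simpa using h1)
  refine ⟨g η, (hg.continuousAt.tendsto.mono_left nhdsWithin_le_nhds).congr' ?_⟩
  filter_upwards [nhdsWithin_le_nhds hgK, self_mem_nhdsWithin] with z hz hz'
  have : z - η ≠ 0 := sub_ne_zero.2 hz'
  show _ = K z / _
  rw [hz, smul_eq_mul]; field_simp

/-- The principal part of `F / s` at a double zero of `s`. -/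
theorem exists_tendsto_sub_principalPart (h : analyticOrderAt s η = 2) (hF : AnalyticAt ℂ F η) :
    ∃ L, Tendsto (fun z => (s z)⁻¹ * F z - 2 / iteratedDeriv 2 s η / (z - η) *
      (deriv F η + (1 / (z - η) - iteratedDeriv 3 s η / (3 * iteratedDeriv 2 s η)) * F η))
      (𝓝[≠] η) (𝓝 L) := by
  obtain ⟨g, hg, hs, h2, h3, hg0⟩ := exists_factor_of_order_two h
  -- Since `F/s = (F/g)/(z - η)²`, the principal part is the first-order Taylor polynomial of `F/g`
  -- divided by `(z - η)²`; its coefficients become the stated ones through `s'' = 2g` and `s''' =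
  -- 6g'`.
  obtain ⟨L, hL⟩ := tendsto_taylor_quotient (hF.div hg hg0)
  refine ⟨L, hL.congr' ?_⟩
  filter_upwards [nhdsWithin_le_nhds hs, self_mem_nhdsWithin,
    nhdsWithin_le_nhds (hg.continuousAt.eventually_ne hg0)] with z hz hz' hgz
  have hne : z - η ≠ 0 := sub_ne_zero.2 hz'
  rw [(hF.differentiableAt.hasDerivAt.div hg.differentiableAt.hasDerivAt hg0).deriv, hz, h2, h3]
  simp only [Pi.div_apply]
  field_simp
  ring

end DoubleZero

/-! ### The discrete spectrum -/

section Enumeration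

variable {q0 : ℝ} {N1 N2 : ℕ} {zs : Fin N1 → ℂ} {ws : Fin N2 → ℂ}

lemma eta_cases (n : Fin (4 * N1 + 2 * N2)) :
    (∃ i : Fin N1, n.1 = i.1 ∧ eta q0 zs ws n = zs i) ∨
    (∃ i : Fin N1, n.1 = N1 + i.1 ∧ eta q0 zs ws n = -zs i) ∨
    (∃ i : Fin N1, n.1 = 2 * N1 + i.1 ∧ eta q0 zs ws n = (q0 : ℂ) ^ 2 / conj (zs i)) ∨
    (∃ i : Fin N1, n.1 = 3 * N1 + i.1 ∧ eta q0 zs ws n = -((q0 : ℂ) ^ 2 / conj (zs i))) ∨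
    (∃ i : Fin N2, n.1 = 4 * N1 + i.1 ∧ eta q0 zs ws n = ws i) ∨
    (∃ i : Fin N2, n.1 = 4 * N1 + N2 + i.1 ∧ eta q0 zs ws n = -ws i) := by
  have hn := n.2
  unfold eta
  split_ifs with h1 h2 h3 h4 h5
  · exact Or.inl ⟨_, rfl, rfl⟩
  · exact Or.inr (Or.inl ⟨⟨n.1 - N1, by omega⟩, by simp only; omega, rfl⟩)
  · exact Or.inr (Or.inr (Or.inl ⟨⟨n.1 - 2 * N1, by omega⟩, by simp only; omega, rfl⟩))
  · exact Or.inr (Or.inr (Or.inr (Or.inl ⟨⟨n.1 - 3 * N1, by omega⟩, by simp only; omega, rfl⟩)))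
  · exact Or.inr (Or.inr (Or.inr (Or.inr (Or.inl
      ⟨⟨n.1 - 4 * N1, by omega⟩, by simp only; omega, rfl⟩))))
  · exact Or.inr (Or.inr (Or.inr (Or.inr (Or.inr
      ⟨⟨n.1 - 4 * N1 - N2, by omega⟩, by simp only; omega, rfl⟩))))

lemma exists_eta_z (i : Fin N1) : (∃ n, eta q0 zs ws n = zs i) ∧ (∃ n, eta q0 zs ws n = -zs i) ∧
    (∃ n, eta q0 zs ws n = (q0 : ℂ) ^ 2 / conj (zs i)) ∧
    ∃ n, eta q0 zs ws n = -((q0 : ℂ) ^ 2 / conj (zs i)) := by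
  have hi := i.2
  refine ⟨⟨⟨i.1, by omega⟩, ?_⟩, ⟨⟨N1 + i.1, by omega⟩, ?_⟩, ⟨⟨2 * N1 + i.1, by omega⟩, ?_⟩,
    ⟨⟨3 * N1 + i.1, by omega⟩, ?_⟩⟩
  · simp [eta]
  · simp [eta, show N1 + i.1 < 2 * N1 by omega]
  · simp [eta, show ¬2 * N1 + i.1 < N1 by omega, show 2 * N1 + i.1 < 3 * N1 by omega]
  · simp [eta, show ¬3 * N1 + i.1 < N1 by omega, show ¬3 * N1 + i.1 < 2 * N1 by omega,
      show 3 * N1 + i.1 < 4 * N1 by omega]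

lemma exists_eta_w (i : Fin N2) :
    (∃ n, eta q0 zs ws n = ws i) ∧ ∃ n, eta q0 zs ws n = -ws i := by
  have hi := i.2
  refine ⟨⟨⟨4 * N1 + i.1, by omega⟩, ?_⟩, ⟨⟨4 * N1 + N2 + i.1, by omega⟩, ?_⟩⟩
  · simp [eta, show ¬4 * N1 + i.1 < N1 by omega, show ¬4 * N1 + i.1 < 2 * N1 by omega,
      show ¬4 * N1 + i.1 < 3 * N1 by omega]
  · simp [eta, show ¬4 * N1 + N2 + i.1 < N1 by omega, show ¬4 * N1 + N2 + i.1 < 2 * N1 by omega,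
      show ¬4 * N1 + N2 + i.1 < 3 * N1 by omega, show ¬4 * N1 + N2 + i.1 < 4 * N1 by omega,
      show 4 * N1 + N2 + i.1 - 4 * N1 - N2 = i.1 by omega]

/-- Inversion in the circle `|z| = q₀` is composed of the three symmetries `z ↦ -q₀²/z`, conjugation
and sign change. It therefore maps zeros of `s₁₁` in `D⁺` to such zeros, with the same order. -/
lemma inv_conj_eq (z : ℂ) : (q0 : ℂ) ^ 2 / conj z = -conj (hatz q0 z) := by
  simp [hatz]

lemma inv_conj_re_im (z : ℂ) : ((q0 : ℂ) ^ 2 / conj z).re = q0 ^ 2 * z.re / normSq z ∧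
    ((q0 : ℂ) ^ 2 / conj z).im = q0 ^ 2 * z.im / normSq z := by
  rw [inv_conj_eq, neg_re, neg_im, conj_re, conj_im, hatz_re, hatz_im, neg_neg, neg_neg]
  exact ⟨rfl, rfl⟩

lemma norm_inv_conj (z : ℂ) : ‖(q0 : ℂ) ^ 2 / conj z‖ = q0 ^ 2 / ‖z‖ := by
  rw [inv_conj_eq, norm_neg, RCLike.norm_conj, norm_hatz]

lemma inv_conj_invol (h0 : 0 < q0) (z : ℂ) (hz : z ≠ 0) :
    (q0 : ℂ) ^ 2 / conj ((q0 : ℂ) ^ 2 / conj z) = z := by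
  have : (q0 : ℂ) ≠ 0 := by exact_mod_cast h0.ne'
  simp only [map_div₀, map_pow, conj_conj, conj_ofReal]
  field_simp

lemma eta_mem_discSpec (n : Fin (4 * N1 + 2 * N2)) : eta q0 zs ws n ∈ discSpec q0 zs ws := by
  rcases eta_cases (q0 := q0) (zs := zs) (ws := ws) n with
    ⟨i, -, h⟩ | ⟨i, -, h⟩ | ⟨i, -, h⟩ | ⟨i, -, h⟩ | ⟨i, -, h⟩ | ⟨i, -, h⟩ <;> rw [h]
  · exact Or.inl (mem_iUnion.2 ⟨i, by simp⟩)
  · exact Or.inl (mem_iUnion.2 ⟨i, by simp⟩)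
  · exact Or.inl (mem_iUnion.2 ⟨i, by simp⟩)
  · exact Or.inl (mem_iUnion.2 ⟨i, by simp⟩)
  · exact Or.inr (mem_iUnion.2 ⟨i, by simp⟩)
  · exact Or.inr (mem_iUnion.2 ⟨i, by simp⟩)

end Enumeration

section Zeros

variable {q0 : ℝ} {N1 N2 : ℕ} {zs : Fin N1 → ℂ} {ws : Fin N2 → ℂ} {S : ℂ → Mat} {z : ℂ}

lemma HasDoubleZeros.zs_mem (h : HasDoubleZeros q0 S zs ws) (i : Fin N1) :
    0 < (zs i).re ∧ 0 < (zs i).im ∧ q0 < ‖zs i‖ ∧ S (zs i) 0 0 = 0 := by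
  have : zs i ∈ range zs := mem_range_self i
  rwa [← h.zeros_z] at this

lemma HasDoubleZeros.ws_mem (h : HasDoubleZeros q0 S zs ws) (i : Fin N2) :
    0 < (ws i).re ∧ 0 < (ws i).im ∧ ‖ws i‖ = q0 ∧ S (ws i) 0 0 = 0 := by
  have : ws i ∈ range ws := mem_range_self i
  rwa [← h.zeros_w] at this

lemma inv_conj_quadrant (h0 : 0 < q0) (h1 : 0 < z.re) (h2 : 0 < z.im) :
    0 < ((q0 : ℂ) ^ 2 / conj z).re ∧ 0 < ((q0 : ℂ) ^ 2 / conj z).im := by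
  have hn : 0 < normSq z := normSq_pos.2 fun h => by simp [h] at h1
  obtain ⟨e1, e2⟩ := inv_conj_re_im (q0 := q0) z
  rw [e1, e2]
  constructor <;> positivity

lemma HasDoubleZeros.inv_conj_mem (h0 : 0 < q0) (h : HasDoubleZeros q0 S zs ws) (i : Fin N1) :
    0 < ((q0 : ℂ) ^ 2 / conj (zs i)).re ∧ 0 < ((q0 : ℂ) ^ 2 / conj (zs i)).im ∧
      ‖(q0 : ℂ) ^ 2 / conj (zs i)‖ < q0 := by
  obtain ⟨h1, h2, h3, -⟩ := h.zs_mem i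
  obtain ⟨e1, e2⟩ := inv_conj_quadrant h0 h1 h2
  refine ⟨e1, e2, ?_⟩
  rw [norm_inv_conj, div_lt_iff₀ (h0.trans h3)]
  nlinarith

lemma HasDoubleZeros.eta_mem_Dp (h0 : 0 < q0) (h : HasDoubleZeros q0 S zs ws)
    (n : Fin (4 * N1 + 2 * N2)) : eta q0 zs ws n ∈ Dp := by
  have quad : ∀ {z : ℂ}, 0 < z.re → 0 < z.im → z ∈ Dp := fun h1 h2 => mul_pos h1 h2
  rcases eta_cases (q0 := q0) (zs := zs) (ws := ws) n with
    ⟨i, -, e⟩ | ⟨i, -, e⟩ | ⟨i, -, e⟩ | ⟨i, -, e⟩ | ⟨i, -, e⟩ | ⟨i, -, e⟩ <;> rw [e]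
  · exact quad (h.zs_mem i).1 (h.zs_mem i).2.1
  · exact neg_mem_Dp (quad (h.zs_mem i).1 (h.zs_mem i).2.1)
  · exact quad (h.inv_conj_mem h0 i).1 (h.inv_conj_mem h0 i).2.1
  · exact neg_mem_Dp (quad (h.inv_conj_mem h0 i).1 (h.inv_conj_mem h0 i).2.1)
  · exact quad (h.ws_mem i).1 (h.ws_mem i).2.1
  · exact neg_mem_Dp (quad (h.ws_mem i).1 (h.ws_mem i).2.1)

lemma inv_conj_injective (h0 : 0 < q0) {z w : ℂ} (hz : z ≠ 0) (hw : w ≠ 0)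
    (h : (q0 : ℂ) ^ 2 / conj z = (q0 : ℂ) ^ 2 / conj w) : z = w := by
  rw [← inv_conj_invol h0 z hz, h, inv_conj_invol h0 w hw]

theorem HasDoubleZeros.eta_injective (h0 : 0 < q0) (h : HasDoubleZeros q0 S zs ws) :
    Function.Injective (eta q0 zs ws) := by
  intro m n hmn
  have ne : ∀ i, zs i ≠ 0 := fun i hh => by have := (h.zs_mem i).1; simp [hh] at this
  rcases eta_cases (q0 := q0) (zs := zs) (ws := ws) m with
    ⟨i, hi, e⟩ | ⟨i, hi, e⟩ | ⟨i, hi, e⟩ | ⟨i, hi, e⟩ | ⟨i, hi, e⟩ | ⟨i, hi, e⟩ <;>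
  rcases eta_cases (q0 := q0) (zs := zs) (ws := ws) n with
    ⟨j, hj, f⟩ | ⟨j, hj, f⟩ | ⟨j, hj, f⟩ | ⟨j, hj, f⟩ | ⟨j, hj, f⟩ | ⟨j, hj, f⟩ <;>
  rw [e, f] at hmn <;>
  have hre := congrArg re hmn <;>
  have hno := congrArg norm hmn <;>
  try simp only [neg_re, norm_neg] at hre hno
  -- The sign of the real part and the position relative to the circle `|z| = q₀` separate the six
  -- blocks, so only pairs within one block survive.
  all_goals first
    | (exfalso; linarith [(h.zs_mem i).1, (h.zs_mem j).1, (h.inv_conj_mem h0 i).1,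
        (h.inv_conj_mem h0 j).1, (h.zs_mem i).2.2.1, (h.zs_mem j).2.2.1,
        (h.inv_conj_mem h0 i).2.2, (h.inv_conj_mem h0 j).2.2])
    | (exfalso; linarith [(h.zs_mem i).1, (h.ws_mem j).1, (h.inv_conj_mem h0 i).1,
        (h.zs_mem i).2.2.1, (h.ws_mem j).2.2.1, (h.inv_conj_mem h0 i).2.2])
    | (exfalso; linarith [(h.zs_mem j).1, (h.ws_mem i).1, (h.inv_conj_mem h0 j).1,
        (h.zs_mem j).2.2.1, (h.ws_mem i).2.2.1, (h.inv_conj_mem h0 j).2.2])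
    | (exfalso; linarith [(h.ws_mem i).1, (h.ws_mem j).1])
    | skip
  · exact Fin.ext (by rw [hi, hj, h.inj_z hmn])
  · exact Fin.ext (by rw [hi, hj, h.inj_z (neg_injective hmn)])
  · exact Fin.ext (by rw [hi, hj, h.inj_z (inv_conj_injective h0 (ne i) (ne j) hmn)])
  · exact Fin.ext (by rw [hi, hj, h.inj_z (inv_conj_injective h0 (ne i) (ne j)
      (neg_injective hmn))])
  · exact Fin.ext (by rw [hi, hj, h.inj_w hmn])
  · exact Fin.ext (by rw [hi, hj, h.inj_w (neg_injective hmn)])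

lemma hatz_eq_neg_conj (z : ℂ) : hatz q0 z = -conj ((q0 : ℂ) ^ 2 / conj z) := by
  simp [hatz]

lemma HasDoubleZeros.etaHat_mem_discSpec (h0 : 0 < q0) (h : HasDoubleZeros q0 S zs ws)
    (n : Fin (4 * N1 + 2 * N2)) : hatz q0 (eta q0 zs ws n) ∈ discSpec q0 zs ws := by
  have hw : ∀ i, (q0 : ℂ) ^ 2 / conj (ws i) = ws i := fun i => by
    have h1 : ws i ≠ 0 := fun hh => by have := (h.ws_mem i).1; simp [hh] at this
    rw [div_eq_iff ((map_ne_zero _).2 h1), mul_conj_of_norm (h.ws_mem i).2.2.1]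
  have hz : ∀ i, conj ((q0 : ℂ) ^ 2 / conj (zs i)) = (q0 : ℂ) ^ 2 / zs i := fun i => by simp
  rcases eta_cases (q0 := q0) (zs := zs) (ws := ws) n with
    ⟨i, -, e⟩ | ⟨i, -, e⟩ | ⟨i, -, e⟩ | ⟨i, -, e⟩ | ⟨i, -, e⟩ | ⟨i, -, e⟩ <;>
    rw [e, hatz_eq_neg_conj]
  · exact Or.inl (mem_iUnion.2 ⟨i, by rw [hz]; simp⟩)
  · exact Or.inl (mem_iUnion.2 ⟨i, by rw [map_neg, div_neg, map_neg, hz]; simp⟩)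
  · refine Or.inl (mem_iUnion.2 ⟨i, ?_⟩)
    rw [inv_conj_invol h0 _ fun hh => by have := (h.zs_mem i).1; simp [hh] at this]; simp
  · refine Or.inl (mem_iUnion.2 ⟨i, ?_⟩)
    rw [map_neg, div_neg,
      inv_conj_invol h0 _ fun hh => by have := (h.zs_mem i).1; simp [hh] at this]; simp
  · exact Or.inr (mem_iUnion.2 ⟨i, by rw [hw]; simp⟩)
  · exact Or.inr (mem_iUnion.2 ⟨i, by rw [map_neg, div_neg, hw]; simp⟩)

variable {qm qp : ℂ} {P N : ℂ → Mat}

lemma ExtendsTo.analyticAt_diag (h : ExtendsTo (fun z => S z 0 0) Dp (Sig \ branch q0)) (hz : z ∈ Dp) :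
    AnalyticAt ℂ (fun z => S z 0 0) z := h.1.analyticAt (isOpen_Dp.mem_nhds hz)

lemma ScatteringRelations.order_neg (h : ScatteringRelations q0 qm qp P N S) (hz : z ∈ Dp)
    (ho : analyticOrderAt (fun z => S z 0 0) z = 2) :
    analyticOrderAt (fun z => S z 0 0) (-z) = 2 := by
  have h1 : (fun z => S z 0 0) =ᶠ[𝓝 (-z)] (fun z => S z 0 0) ∘ fun z => -z := by
    filter_upwards [isOpen_Dp.mem_nhds (neg_mem_Dp hz)] with w hw using h.s_neg w hw
  rw [analyticOrderAt_congr h1, analyticOrderAt_comp_of_deriv_ne_zero (g := fun z => -z)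
    (by fun_prop) (by simp), neg_neg, ho]

lemma hasDerivAt_hatz (hz : z ≠ 0) : HasDerivAt (hatz q0) ((q0 : ℂ) ^ 2 / z ^ 2) z := by
  have := ((hasDerivAt_inv hz).const_mul ((q0 : ℂ) ^ 2)).neg
  refine (this.congr_deriv (by ring)).congr_of_eventuallyEq (Eventually.of_forall fun w => ?_)
  simp [hatz, div_eq_mul_inv]

lemma analyticAt_hatz (hz : z ≠ 0) : AnalyticAt ℂ (hatz q0) z := by
  rw [analyticAt_iff_eventually_differentiableAt]
  filter_upwards [isOpen_ne.mem_nhds hz] with w hw using differentiableAt_hatz hw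

lemma ScatteringRelations.factor_ne (h : ScatteringRelations q0 qm qp P N S) :
    conj qm * qp / (q0 : ℂ) ^ 2 ≠ 0 := by
  have hq : (q0 : ℂ) ≠ 0 := by exact_mod_cast h.pos.ne'
  have m1 : qm ≠ 0 := norm_pos_iff.1 (h.norm_minus ▸ h.pos)
  have p1 : qp ≠ 0 := norm_pos_iff.1 (h.norm_plus ▸ h.pos)
  exact div_ne_zero (mul_ne_zero ((map_ne_zero _).2 m1) p1) (pow_ne_zero 2 hq)

/-- The map `z ↦ -q₀²/z` is locally biholomorphic and the coefficients are related by a nonzero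
constant, so the order of a zero is preserved. -/
lemma ScatteringRelations.order_hatz (h : ScatteringRelations q0 qm qp P N S) (hz : z ∈ Dp)
    (ho : analyticOrderAt (fun z => S z 0 0) z = 2) :
    analyticOrderAt (fun z => S z 1 1) (hatz q0 z) = 2 := by
  have hz0 := ne_zero_of_mem_Dp hz
  have hz' := hatz_ne_zero h.pos hz0
  have h1 : (fun z => S z 1 1) =ᶠ[𝓝 (hatz q0 z)] (fun _ => conj qm * qp / (q0 : ℂ) ^ 2) *
      ((fun z => S z 0 0) ∘ hatz q0) := by
    filter_upwards [isOpen_Dm.mem_nhds (hatz_mem_Dm h.pos hz)] with w hw using h.s_hat w hw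
  have hq : (q0 : ℂ) ≠ 0 := by exact_mod_cast h.pos.ne'
  have ha : AnalyticAt ℂ (fun z => S z 0 0) (hatz q0 (hatz q0 z)) := by
    rw [hatz_hatz h.pos hz0]; exact ExtendsTo.analyticAt_diag h.ext11 hz
  have hc : analyticOrderAt (fun _ : ℂ => conj qm * qp / (q0 : ℂ) ^ 2) (hatz q0 z) = 0 :=
    analyticOrderAt_eq_zero.2 (Or.inr h.factor_ne)
  rw [analyticOrderAt_congr h1, analyticOrderAt_mul analyticAt_const
    (ha.comp (analyticAt_hatz hz')), hc, zero_add,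
    analyticOrderAt_comp_of_deriv_ne_zero (analyticAt_hatz hz')
      (by rw [(hasDerivAt_hatz hz').deriv]; exact div_ne_zero (pow_ne_zero 2 hq)
            (pow_ne_zero 2 hz')), hatz_hatz h.pos hz0, ho]

lemma ScatteringRelations.order_conj (h : ScatteringRelations q0 qm qp P N S) (hz : z ∈ Dm)
    (ho : analyticOrderAt (fun z => S z 1 1) z = 2) :
    analyticOrderAt (fun z => S z 0 0) (conj z) = 2 := by
  have h1 : (fun z => S z 0 0) =ᶠ[𝓝 (conj z)] fun z => conj (S (conj z) 1 1) := by
    filter_upwards [isOpen_Dp.mem_nhds (conj_mem_Dp hz)] with w hw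
    rw [h.s_conj _ (conj_mem_Dm hw), conj_conj, conj_conj]
  rw [analyticOrderAt_congr h1]
  exact analyticOrderAt_conj_conj _ _ ho

lemma ScatteringRelations.order_inv_conj (h : ScatteringRelations q0 qm qp P N S) (hz : z ∈ Dp)
    (ho : analyticOrderAt (fun z => S z 0 0) z = 2) :
    analyticOrderAt (fun z => S z 0 0) ((q0 : ℂ) ^ 2 / conj z) = 2 := by
  rw [inv_conj_eq]
  have hz' := hatz_mem_Dm h.pos hz
  exact h.order_neg (conj_mem_Dp hz') (h.order_conj hz' (h.order_hatz hz ho))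

theorem ScatteringRelations.order_eta (h : ScatteringRelations q0 qm qp P N S)
    (hd : HasDoubleZeros q0 S zs ws) (n : Fin (4 * N1 + 2 * N2)) :
    analyticOrderAt (fun z => S z 0 0) (eta q0 zs ws n) = 2 := by
  have quad : ∀ {z : ℂ}, 0 < z.re → 0 < z.im → z ∈ Dp := fun h1 h2 => mul_pos h1 h2
  have oz : ∀ i, zs i ∈ Dp ∧ analyticOrderAt (fun z => S z 0 0) (zs i) = 2 := fun i =>
    have hm := quad (hd.zs_mem i).1 (hd.zs_mem i).2.1
    ⟨hm, analyticOrderAt_eq_two_of_isDoubleZero (ExtendsTo.analyticAt_diag h.ext11 hm) (hd.double_z i)⟩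
  have ow : ∀ i, ws i ∈ Dp ∧ analyticOrderAt (fun z => S z 0 0) (ws i) = 2 := fun i =>
    have hm := quad (hd.ws_mem i).1 (hd.ws_mem i).2.1
    ⟨hm, analyticOrderAt_eq_two_of_isDoubleZero (ExtendsTo.analyticAt_diag h.ext11 hm) (hd.double_w i)⟩
  rcases eta_cases (q0 := q0) (zs := zs) (ws := ws) n with
    ⟨i, -, e⟩ | ⟨i, -, e⟩ | ⟨i, -, e⟩ | ⟨i, -, e⟩ | ⟨i, -, e⟩ | ⟨i, -, e⟩ <;> rw [e]
  · exact (oz i).2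
  · exact h.order_neg (oz i).1 (oz i).2
  · exact h.order_inv_conj (oz i).1 (oz i).2
  · exact h.order_neg (quad (hd.inv_conj_mem h.pos i).1 (hd.inv_conj_mem h.pos i).2.1)
      (h.order_inv_conj (oz i).1 (oz i).2)
  · exact (ow i).2
  · exact h.order_neg (ow i).1 (ow i).2

lemma ScatteringRelations.zero_inv_conj (h : ScatteringRelations q0 qm qp P N S) (hz : z ∈ Dp)
    (h0 : S z 0 0 = 0) : S ((q0 : ℂ) ^ 2 / conj z) 0 0 = 0 := by
  have hz' := hatz_mem_Dm h.pos hz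
  have h1 := h.s_hat _ hz'
  rw [hatz_hatz h.pos (ne_zero_of_mem_Dp hz), h0, mul_zero, h.s_conj _ hz', map_eq_zero] at h1
  rw [inv_conj_eq, ← h.s_neg _ (conj_mem_Dp hz'), h1]

/-- In the first quadrant a zero outside the circle `|z| = q₀` is some `zₙ`, one on it is some `wₘ`,
and one inside is inverted to some `zₙ`. The third quadrant follows from evenness of `s₁₁`. -/
theorem ScatteringRelations.zero_Dp (h : ScatteringRelations q0 qm qp P N S)
    (hd : HasDoubleZeros q0 S zs ws) (hz : z ∈ Dp) (h0 : S z 0 0 = 0) :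
    ∃ n, z = eta q0 zs ws n := by
  have key : ∀ z : ℂ, 0 < z.re → 0 < z.im → S z 0 0 = 0 →
      (∃ n, z = eta q0 zs ws n) ∧ ∃ n, -z = eta q0 zs ws n := by
    intro z h1 h2 h3
    have hzp : z ∈ Dp := mul_pos h1 h2
    have hz0 := ne_zero_of_mem_Dp hzp
    rcases lt_trichotomy q0 ‖z‖ with h4 | h4 | h4
    · have : z ∈ range zs := by rw [← hd.zeros_z]; exact ⟨h1, h2, h4, h3⟩
      obtain ⟨i, rfl⟩ := this
      obtain ⟨⟨n, hn⟩, ⟨m, hm⟩, -⟩ := exists_eta_z (q0 := q0) (zs := zs) (ws := ws) i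
      exact ⟨⟨n, hn.symm⟩, ⟨m, hm.symm⟩⟩
    · have : z ∈ range ws := by rw [← hd.zeros_w]; exact ⟨h1, h2, h4.symm, h3⟩
      obtain ⟨i, rfl⟩ := this
      obtain ⟨⟨n, hn⟩, ⟨m, hm⟩⟩ := exists_eta_w (q0 := q0) (zs := zs) (ws := ws) i
      exact ⟨⟨n, hn.symm⟩, ⟨m, hm.symm⟩⟩
    · have : (q0 : ℂ) ^ 2 / conj z ∈ range zs := by
        rw [← hd.zeros_z]
        obtain ⟨e1, e2⟩ := inv_conj_quadrant h.pos h1 h2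
        refine ⟨e1, e2, ?_, h.zero_inv_conj hzp h3⟩
        rw [norm_inv_conj, lt_div_iff₀ (norm_pos_iff.2 hz0)]
        nlinarith [h.pos]
      obtain ⟨i, hi⟩ := this
      obtain ⟨-, -, ⟨n, hn⟩, ⟨m, hm⟩⟩ := exists_eta_z (q0 := q0) (zs := zs) (ws := ws) i
      rw [hi, inv_conj_invol h.pos z hz0] at hn hm
      exact ⟨⟨n, hn.symm⟩, ⟨m, hm.symm⟩⟩
  have hz2 : 0 < z.re * z.im := hz
  rcases pos_and_pos_or_neg_and_neg_of_mul_pos hz2 with ⟨h1, h2⟩ | ⟨h1, h2⟩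
  · exact (key z h1 h2 h0).1
  · have := (key (-z) (by simpa using h1) (by simpa using h2) (by rw [← h.s_neg z hz, h0])).2
    rwa [neg_neg] at this

theorem ScatteringRelations.zero_Dm (h : ScatteringRelations q0 qm qp P N S)
    (hd : HasDoubleZeros q0 S zs ws) (hz : z ∈ Dm) (h0 : S z 1 1 = 0) :
    ∃ n, z = hatz q0 (eta q0 zs ws n) := by
  rw [h.s_hat z hz, mul_eq_zero] at h0
  obtain ⟨n, hn⟩ := h.zero_Dp hd (hatz_mem_Dp h.pos hz) (h0.resolve_left h.factor_ne)
  exact ⟨n, by rw [← hn, hatz_hatz h.pos (ne_zero_of_mem_Dm hz)]⟩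

end Zeros

/-! ### Principal parts at the double poles -/

/-- A principal part with a double pole at `p`. -/
def doublePole (p α β z : ℂ) : ℂ := α / (z - p) + β / (z - p) ^ 2

section DoublePole

variable {p α β z : ℂ}

lemma hasDerivAt_doublePole (hz : z ≠ p) : HasDerivAt (doublePole p α β)
    (-(α / (z - p) ^ 2) - 2 * β / (z - p) ^ 3) z := by
  have h0 : z - p ≠ 0 := sub_ne_zero.2 hz
  have h1 : HasDerivAt (fun z => (z - p)⁻¹) (-1 / (z - p) ^ 2) z :=
    ((hasDerivAt_id z).sub_const p).fun_inv h0
  have h2 := (h1.const_mul α).add ((h1.fun_pow 2).const_mul β)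
  refine (h2.congr_deriv ?_).congr_of_eventuallyEq (Eventually.of_forall fun w => ?_)
  · simp only [Nat.cast_ofNat, Nat.add_one_sub_one, pow_one]
    field_simp
    ring
  · simp [doublePole, div_eq_mul_inv]

lemma doublePole_isBigO (V : Set ℂ) : doublePole p α β =O[atInf V] fun z => z⁻¹ := by
  have h1 : (fun z => (z - p)⁻¹) =O[atInf V] fun z => z⁻¹ := by
    refine isBigO_atInf_of_bound (C := 2) (R := 2 * ‖p‖ + 1) fun z _ hz => ?_
    have h2 : ‖z‖ / 2 ≤ ‖z - p‖ := by linarith [norm_sub_norm_le z p, norm_nonneg p]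
    have h3 : 0 < ‖z‖ := by linarith [norm_nonneg p]
    rw [norm_inv, ← one_div, div_le_div_iff₀ (by linarith) h3]
    linarith
  have h2 := ((h1.trans_tendsto (tendsto_inv_atInf V)).isBigO_one ℂ).mul h1
  have h3 := (h1.const_mul_left α).add ((h2.congr_right fun z => one_mul _).const_mul_left β)
  refine h3.congr_left fun z => ?_
  simp [doublePole, div_eq_mul_inv, sq]

end DoublePole

/-- Cauchy's formula for a sectionally meromorphic function with double poles. -/
theorem cauchy_formula_of_doublePoles {ι : Type*} [Fintype ι] {g lead gp gm : ℂ → ℂ} {p α β : ι → ℂ}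
    (hinj : Function.Injective p) (hpm : ∀ n, p n ∈ Dp ∪ Dm)
    (hg : ∀ z ∈ Dp ∪ Dm, z ∉ range p → DifferentiableAt ℂ g z)
    (hlead : ∀ z, z ≠ 0 → DifferentiableAt ℂ lead z)
    (hpole : ∀ n, ∃ L, Tendsto (fun z => g z - doublePole (p n) (α n) (β n) z)
      (𝓝[≠] (p n)) (𝓝 L))
    (hgp : ∀ ζ ∈ Sig, Tendsto g (𝓝[Dp] ζ) (𝓝 (gp ζ)))
    (hgm : ∀ ζ ∈ Sig, Tendsto g (𝓝[Dm] ζ) (𝓝 (gm ζ)))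
    (hinf : ∃ C R : ℝ, ∀ z ∈ Dp ∪ Dm, R ≤ ‖z‖ → ‖g z - lead z‖ ≤ C / ‖z‖)
    (h0 : ∃ C r : ℝ, 0 < r ∧ ∀ z ∈ Dp ∪ Dm, ‖z‖ ≤ r → ‖g z - lead z‖ ≤ C) :
    ContinuousOn (fun ζ => gp ζ - gm ζ) Sig ∧
    (∃ C, 0 ≤ C ∧ ∀ ζ ∈ Sig, ‖gp ζ - gm ζ‖ * (1 + ‖ζ‖) ≤ C) ∧
    ∀ z ∈ Dp ∪ Dm, z ∉ range p →
      g z = lead z + 1 / (2 * (Real.pi : ℂ) * I) * sigInt (fun ζ => (gp ζ - gm ζ) / (ζ - z)) +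
        ∑ n, doublePole (p n) (α n) (β n) z := by
  classical
  set T : ℂ → ℂ := fun z => ∑ n, doublePole (p n) (α n) (β n) z with hT
  have hTd : ∀ z, z ∉ range p → DifferentiableAt ℂ T z := fun z hz =>
    DifferentiableAt.fun_sum fun n _ =>
      (hasDerivAt_doublePole fun h => hz ⟨n, h.symm⟩).differentiableAt
  have hnr : ∀ ζ ∈ Sig, ζ ∉ range p := by
    rintro ζ hζ ⟨n, rfl⟩; exact not_Sig_of_mem (hpm n) hζ
  have hsub : ∀ {V : Set ℂ} {L : ℂ} {ζ}, ζ ∈ Sig → Tendsto g (𝓝[V] ζ) (𝓝 L) →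
      Tendsto (fun z => g z - lead z - T z) (𝓝[V] ζ) (𝓝 (L - lead ζ - T ζ)) := fun hζ h =>
    (h.sub ((hlead _ hζ.2).continuousAt.tendsto.mono_left nhdsWithin_le_nhds)).sub
      ((hTd _ (hnr _ hζ)).continuousAt.tendsto.mono_left nhdsWithin_le_nhds)
  obtain ⟨C1, R, hR⟩ := hinf
  obtain ⟨C2, r, hr, hC2⟩ := h0
  obtain ⟨h1, h2, h3⟩ := cauchy_formula (f := fun z => g z - lead z - T z) (finite_range p)
    (by rintro _ ⟨n, rfl⟩; exact hpm n)
    (fun z hz hzp => ((hg z hz hzp).sub (hlead z (ne_zero_of_mem hz))).sub (hTd z hzp))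
    (by
      rintro _ ⟨n, rfl⟩
      obtain ⟨L, hL⟩ := hpole n
      have k1 : ContinuousAt (fun z => ∑ m ∈ Finset.univ.erase n, doublePole (p m) (α m) (β m) z)
          (p n) := by
        refine (DifferentiableAt.fun_sum (𝕜 := ℂ) fun m hm => ?_).continuousAt
        exact (hasDerivAt_doublePole fun h =>
          (Finset.ne_of_mem_erase hm) (hinj h.symm)).differentiableAt
      have k2 := (hlead _ (ne_zero_of_mem (hpm n))).continuousAt
      refine ⟨_, ((hL.sub (k2.tendsto.mono_left nhdsWithin_le_nhds)).sub
        (k1.tendsto.mono_left nhdsWithin_le_nhds)).congr fun z => ?_⟩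
      rw [hT]
      simp only
      rw [← Finset.add_sum_erase _ _ (Finset.mem_univ n)]
      ring)
    (fun ζ hζ => hsub hζ (hgp ζ hζ)) (fun ζ hζ => hsub hζ (hgm ζ hζ))
    (by
      refine exists_bound_of_isBigO_atInf ((isBigO_atInf_of_bound hR).sub ?_)
      exact Asymptotics.IsBigO.fun_sum fun n _ => doublePole_isBigO _)
    (by
      have k0 : (0 : ℂ) ∉ range p := by rintro ⟨n, hn⟩; exact ne_zero_of_mem (hpm n) hn
      have k1 := (hTd 0 k0).continuousAt.norm.eventually_le_const (lt_add_one ‖T 0‖)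
      obtain ⟨r', hr', hb⟩ := Metric.eventually_nhds_iff.1 k1
      refine ⟨C2 + (‖T 0‖ + 1), min r (r' / 2), by positivity, fun z hz hn => ?_⟩
      refine (norm_sub_le _ _).trans (add_le_add (hC2 z hz (hn.trans (min_le_left _ _))) (hb ?_))
      rw [dist_zero_right]
      linarith [hn.trans (min_le_right _ _)])
  -- The background term and the principal parts are continuous across `Σ`, so they do not
  -- contribute to the jump.
  have e : (fun ζ => gp ζ - lead ζ - T ζ - (gm ζ - lead ζ - T ζ)) = fun ζ => gp ζ - gm ζ := by
    ext ζ; ring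
  refine ⟨e ▸ h1, ?_, fun z hz hzp => ?_⟩
  · obtain ⟨C, hC, hb⟩ := h2
    refine ⟨C, hC, fun ζ hζ => ?_⟩
    rw [show gp ζ - gm ζ = gp ζ - lead ζ - T ζ - (gm ζ - lead ζ - T ζ) by ring]
    exact hb ζ hζ
  · have h4 := h3 z hz hzp
    have e2 : (fun ζ => (gp ζ - lead ζ - T ζ - (gm ζ - lead ζ - T ζ)) / (ζ - z)) =
        fun ζ => (gp ζ - gm ζ) / (ζ - z) := by
      ext ζ; rw [congrFun e ζ]
    rw [e2] at h4
    rw [h4]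
    have hpi : (Real.pi : ℂ) ≠ 0 := by exact_mod_cast Real.pi_ne_zero
    field_simp
    rw [hT]; ring

/-- The principal part of an entry of `M`. -/
lemma exists_tendsto_sub_doublePole {s f n ε : ℂ → ℂ} {η b d : ℂ} (hs : analyticOrderAt s η = 2)
    (hf : AnalyticAt ℂ f η) (hn : AnalyticAt ℂ n η) (hε : AnalyticAt ℂ ε η) (hb : b ≠ 0)
    (h1 : f η = b * n η) (h2 : deriv f η - b * deriv n η = d * n η) :
    ∃ L, Tendsto (fun z => (s z)⁻¹ * (f z * exp (-ε z)) -
      2 * b / iteratedDeriv 2 s η / (z - η) * exp (-(2 * ε η)) *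
        (deriv (fun w => n w * exp (ε w)) η +
          (d / b - iteratedDeriv 3 s η / (3 * iteratedDeriv 2 s η) - 2 * deriv ε η + 1 / (z - η)) *
            (n η * exp (ε η)))) (𝓝[≠] η) (𝓝 L) := by
  -- The relations with `b` and `d` replace `f` and its derivative at `η` by `n` and its derivative.
  -- Writing `n e^{-ε} = e^{-2ε} (n e^{ε})` then produces the factor `e^{-2ε}` and the shift `-2ε'`.
  obtain ⟨L, hL⟩ := exists_tendsto_sub_principalPart hs
    (F := fun z => f z * exp (-ε z)) (hf.mul hε.neg.cexp)
  refine ⟨L, hL.congr fun z => ?_⟩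
  have d1 : deriv (fun z => f z * exp (-ε z)) η =
      deriv f η * exp (-ε η) + f η * (exp (-ε η) * -deriv ε η) :=
    (hf.differentiableAt.hasDerivAt.mul hε.differentiableAt.hasDerivAt.neg.cexp).deriv
  have d2 : deriv (fun z => n z * exp (ε z)) η =
      deriv n η * exp (ε η) + n η * (exp (ε η) * deriv ε η) :=
    (hn.differentiableAt.hasDerivAt.mul hε.differentiableAt.hasDerivAt.cexp).deriv
  have e1 : exp (-(2 * ε η)) = exp (-ε η) * exp (-ε η) := by rw [← Complex.exp_add]; ring_nf
  have e2 : exp (-ε η) * exp (ε η) = 1 := by rw [← Complex.exp_add]; simp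
  rw [d1, d2, e1, h1, eq_add_of_sub_eq h2]
  congr 1
  generalize exp (-ε η) = u at *
  generalize exp (ε η) = v at *
  generalize 1 / (z - η) = w
  generalize iteratedDeriv 3 s η / (3 * iteratedDeriv 2 s η) = y
  have hdb : d = d / b * b := (div_mul_cancel₀ d hb).symm
  generalize d / b = k at *
  subst hdb
  have huv : u * u * v = u := by linear_combination u * e2
  linear_combination -(2 / iteratedDeriv 2 s η / (z - η) * b *
    (k * n η + deriv n η - n η * deriv ε η + (w - y) * n η)) * huv

section

variable {q0 x t : ℝ} {qm qp : ℂ} {q : ℝ → ℝ → ℂ} {Φm Φp : ℝ → ℝ → ℂ → Mat} {S : ℂ → Mat}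
  {b d : ℂ → ℂ} {Z : Set ℂ} {η z : ℂ}

lemma analyticAt_theta (hz : z ≠ 0) : AnalyticAt ℂ (theta q0 x t) z := by
  rw [analyticAt_iff_eventually_differentiableAt]
  filter_upwards [isOpen_ne.mem_nhds hz] with w hw using differentiableAt_theta hw

/-- The identity needs no hypothesis `z ≠ p`: at `z = p` both sides are zero, division by zero being
zero. -/
lemma doublePole_eq (a e u v k p z : ℂ) :
    a / (z - p) * e * (u + (k + 1 / (z - p)) * v) = doublePole p (a * e * (u + k * v)) (a * e * v) z := by
  unfold doublePole; rcases eq_or_ne (z - p) 0 with h | h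
  · simp [h]
  · field_simp; ring

/-- The principal part of the first column of `M` at a point of `Z ∩ D⁺`. -/
lemma exists_tendsto_Mrhp_zero (h : ScatteringRelations q0 qm qp (Φp x t) (Φm x t) S)
    (hbd : AreProportionality Z Φm Φp b d) (hη : η ∈ Z ∩ Dp)
    (ho : analyticOrderAt (fun z => S z 0 0) η = 2) (i : Fin 2) :
    ∃ L, Tendsto (fun z => Mrhp q0 Φm Φp S x t z i 0 - Cco q0 x t (Acoef S b) η z *
      (dcol (modJost q0 Φm x t) 1 η i + (Dco q0 x t (Bcoef S b d) η + 1 / (z - η)) *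
        col (modJost q0 Φm x t) 1 η i)) (𝓝[≠] η) (𝓝 L) := by
  have hDp := isOpen_Dp.mem_nhds hη.2
  have hθ : AnalyticAt ℂ (theta q0 x t) η := analyticAt_theta (ne_zero_of_mem_Dp hη.2)
  obtain ⟨L, hL⟩ := exists_tendsto_sub_doublePole (s := fun z => S z 0 0)
    (ε := fun z => I * theta q0 x t z) (d := d η) ho ((h.extP0 i).1.analyticAt hDp)
    ((h.extN1 i).1.analyticAt hDp) (analyticAt_const.mul hθ) (hbd.b_ne η hη.1)
    (congrFun (hbd.b_plus η hη x t) i) (congrFun (hbd.d_plus η hη x t) i)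
  have hd : deriv (fun z => I * theta q0 x t z) η = I * deriv (theta q0 x t) η :=
    (hθ.differentiableAt.hasDerivAt.const_mul I).deriv
  have hm : ∀ w, modJost q0 Φm x t w i 1 = Φm x t w i 1 * exp (I * theta q0 x t w) :=
    fun w => modJost_one Φm w i
  refine ⟨L, hL.congr' ?_⟩
  filter_upwards [nhdsWithin_le_nhds hDp] with z hz
  simp only [Mrhp_zero_Dp hz, dcol, col, hm, Cco, Dco, Acoef, Bcoef, diagCoeff, if_pos hη.2, hd]
  congr 1
  rw [show -2 * I * theta q0 x t η = -(2 * (I * theta q0 x t η)) by ring,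
    show 2 * (I * deriv (theta q0 x t) η) = 2 * I * deriv (theta q0 x t) η by ring]

/-- The principal part of the second column of `M` at a point of `Z ∩ D⁻`. -/
lemma exists_tendsto_Mrhp_one (h : ScatteringRelations q0 qm qp (Φp x t) (Φm x t) S)
    (hbd : AreProportionality Z Φm Φp b d) (hη : η ∈ Z ∩ Dm)
    (ho : analyticOrderAt (fun z => S z 1 1) η = 2) (i : Fin 2) :
    ∃ L, Tendsto (fun z => Mrhp q0 Φm Φp S x t z i 1 - CHat q0 x t (Acoef S b) η z *
      (dcol (modJost q0 Φm x t) 0 η i + (DHat q0 x t (Bcoef S b d) η + 1 / (z - η)) *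
        col (modJost q0 Φm x t) 0 η i)) (𝓝[≠] η) (𝓝 L) := by
  have hDm := isOpen_Dm.mem_nhds hη.2
  have hθ : AnalyticAt ℂ (theta q0 x t) η := analyticAt_theta (ne_zero_of_mem_Dm hη.2)
  obtain ⟨L, hL⟩ := exists_tendsto_sub_doublePole (s := fun z => S z 1 1)
    (ε := fun z => -(I * theta q0 x t z)) (d := d η) ho ((h.extP1 i).1.analyticAt hDm)
    ((h.extN0 i).1.analyticAt hDm) (analyticAt_const.mul hθ).neg (hbd.b_ne η hη.1)
    (congrFun (hbd.b_minus η hη x t) i) (congrFun (hbd.d_minus η hη x t) i)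
  have hd : deriv (fun z => -(I * theta q0 x t z)) η = -(I * deriv (theta q0 x t) η) :=
    (hθ.differentiableAt.hasDerivAt.const_mul I).neg.deriv
  have hm : ∀ w, modJost q0 Φm x t w i 0 = Φm x t w i 0 * exp (-(I * theta q0 x t w)) :=
    fun w => modJost_zero Φm w i
  refine ⟨L, hL.congr' ?_⟩
  filter_upwards [nhdsWithin_le_nhds hDm] with z hz
  simp only [Mrhp_one_Dm hz, dcol, col, hm, CHat, DHat, Acoef, Bcoef, diagCoeff,
    if_neg (Dm_not_Dp hη.2), hd, neg_neg]
  congr 1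
  rw [show 2 * I * theta q0 x t η = -(2 * -(I * theta q0 x t η)) by ring,
    show 2 * -(I * deriv (theta q0 x t) η) = -(2 * I * deriv (theta q0 x t) η) by ring, sub_neg_eq_add]

lemma differentiableAt_exp_theta (hz : z ≠ 0) :
    DifferentiableAt ℂ (fun z => exp (I * theta q0 x t z)) z :=
  ((differentiableAt_theta hz).const_mul I).cexp

lemma differentiableAt_exp_neg_theta (hz : z ≠ 0) :
    DifferentiableAt ℂ (fun z => exp (-(I * theta q0 x t z))) z :=
  ((differentiableAt_theta hz).const_mul I).neg.cexp

lemma ExtendsTo.differentiableAt {f : ℂ → ℂ} {U Γ : Set ℂ} (h : ExtendsTo f U Γ) (hU : IsOpen U)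
    (hz : z ∈ U) : DifferentiableAt ℂ f z := h.1.differentiableAt (hU.mem_nhds hz)

lemma differentiableAt_Mrhp_zero (h : ScatteringRelations q0 qm qp (Φp x t) (Φm x t) S)
    (hz : z ∈ Dp ∪ Dm) (hs : z ∈ Dp → S z 0 0 ≠ 0) (i : Fin 2) :
    DifferentiableAt ℂ (fun z => Mrhp q0 Φm Φp S x t z i 0) z := by
  have hz0 := ne_zero_of_mem hz
  rcases hz with hz | hz
  · refine (((h.ext11.differentiableAt isOpen_Dp hz).inv (hs hz)).mul
      (((h.extP0 i).differentiableAt isOpen_Dp hz).mul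
        (differentiableAt_exp_neg_theta (q0 := q0) (x := x) (t := t) hz0))).congr_of_eventuallyEq ?_
    filter_upwards [isOpen_Dp.mem_nhds hz] with w hw using Mrhp_zero_Dp hw i
  · refine (((h.extN0 i).differentiableAt isOpen_Dm hz).mul
      (differentiableAt_exp_neg_theta (q0 := q0) (x := x) (t := t) hz0)).congr_of_eventuallyEq ?_
    filter_upwards [isOpen_Dm.mem_nhds hz] with w hw using Mrhp_zero_Dm hw i

lemma differentiableAt_Mrhp_one (h : ScatteringRelations q0 qm qp (Φp x t) (Φm x t) S)
    (hz : z ∈ Dp ∪ Dm) (hs : z ∈ Dm → S z 1 1 ≠ 0) (i : Fin 2) :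
    DifferentiableAt ℂ (fun z => Mrhp q0 Φm Φp S x t z i 1) z := by
  have hz0 := ne_zero_of_mem hz
  rcases hz with hz | hz
  · refine (((h.extN1 i).differentiableAt isOpen_Dp hz).mul
      (differentiableAt_exp_theta (q0 := q0) (x := x) (t := t) hz0)).congr_of_eventuallyEq ?_
    filter_upwards [isOpen_Dp.mem_nhds hz] with w hw using Mrhp_one_Dp hw i
  · refine (((h.ext22.differentiableAt isOpen_Dm hz).inv (hs hz)).mul
      (((h.extP1 i).differentiableAt isOpen_Dm hz).mul
        (differentiableAt_exp_theta (q0 := q0) (x := x) (t := t) hz0))).congr_of_eventuallyEq ?_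
    filter_upwards [isOpen_Dm.mem_nhds hz] with w hw using Mrhp_one_Dm hw i

lemma hasDerivAt_Mlead_one (hz : z ≠ 0) (i : Fin 2) :
    HasDerivAt (fun z => Mlead q0 q qm x t z i 1)
      (-(expSigma3 (I * (vMinus q0 q x t : ℂ))).mulVec ![I * qm / z ^ 2, 0] i) z := by
  fin_cases i
  · have := ((hasDerivAt_inv hz).const_mul (I * qm)).const_mul (exp (I * vMinus q0 q x t))
    refine (this.congr_deriv ?_).congr_of_eventuallyEq (Eventually.of_forall fun w => ?_)
    · simp [expSigma3, Matrix.mulVec, dotProduct]; ring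
    · exact (Mlead_one w).1
  · refine ((hasDerivAt_const z (exp (-(I * (vMinus q0 q x t : ℂ))))).congr_deriv ?_).congr_of_eventuallyEq
      (Eventually.of_forall fun w => (Mlead_one w).2)
    simp [expSigma3, Matrix.mulVec, dotProduct]

lemma differentiableAt_Mlead (hz : z ≠ 0) (i j : Fin 2) :
    DifferentiableAt ℂ (fun z => Mlead q0 q qm x t z i j) z := by
  fin_cases j
  · fin_cases i
    · exact (differentiableAt_const (exp (I * (vMinus q0 q x t : ℂ)))).congr_of_eventuallyEq
        (Eventually.of_forall fun w => (Mlead_zero w).1)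
    · exact (show DifferentiableAt ℂ (fun w => exp (-(I * (vMinus q0 q x t : ℂ))) *
        (I * conj qm / w)) z by fun_prop (disch := assumption)).congr_of_eventuallyEq
        (Eventually.of_forall fun w => (Mlead_zero w).2)
  · exact (hasDerivAt_Mlead_one hz i).differentiableAt

lemma Mlead_bound_atInf : ∃ C R : ℝ, ∀ z ∈ Dp ∪ Dm, R ≤ ‖z‖ → ∀ i j,
    ‖Mlead q0 q qm x t z i j - expSigma3 (I * vMinus q0 q x t) i j‖ ≤ C / ‖z‖ := by
  have e1 : ‖exp (I * (vMinus q0 q x t : ℂ))‖ = 1 := norm_exp_I_mul_real _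
  have e2 : ‖exp (-(I * (vMinus q0 q x t : ℂ)))‖ = 1 := norm_exp_neg_I_mul_real _
  refine ⟨‖qm‖, 0, fun z hz _ i j => ?_⟩
  obtain ⟨l1, l2⟩ := Mlead_zero (q0 := q0) (q := q) (qm := qm) (x := x) (t := t) z
  obtain ⟨l3, l4⟩ := Mlead_one (q0 := q0) (q := q) (qm := qm) (x := x) (t := t) z
  have hpos : 0 ≤ ‖qm‖ / ‖z‖ := by positivity
  fin_cases i <;> fin_cases j
  · simpa [expSigma3, l1] using hpos
  · simp [expSigma3, l3, e1]
  · simp [expSigma3, l2, e2]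
  · simpa [expSigma3, l4] using hpos

end

/-! ### Representation of the two columns of `M`, and the third symmetry for `μ₋` -/

section

variable {q0 x t : ℝ} {qm qp : ℂ} {q : ℝ → ℝ → ℂ} {Φm Φp : ℝ → ℝ → ℂ → Mat} {S : ℂ → Mat}
  {b d : ℂ → ℂ} {N1 N2 : ℕ} {zs : Fin N1 → ℂ} {ws : Fin N2 → ℂ} {z : ℂ}

lemma etaHat_eq_hatz (n : Fin (4 * N1 + 2 * N2)) : etaHat q0 zs ws n = hatz q0 (eta q0 zs ws n) := rfl

lemma Mrhp_sub_Mlead_atInf (hq : IsPotential q0 qm qp q) (hΦm : IsJostMinus q0 q qm Φm)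
    (hΦp : IsJostPlus q0 q qp Φp) (h : ScatteringRelations q0 qm qp (Φp x t) (Φm x t) S)
    (i j : Fin 2) : ∃ C R : ℝ, ∀ z ∈ Dp ∪ Dm, R ≤ ‖z‖ →
      ‖Mrhp q0 Φm Φp S x t z i j - Mlead q0 q qm x t z i j‖ ≤ C / ‖z‖ := by
  obtain ⟨C, R, -, h1⟩ := Mrhp_bound_atInf hq hΦm hΦp h
  obtain ⟨C', R', h2⟩ := Mlead_bound_atInf (q0 := q0) (q := q) (qm := qm) (x := x) (t := t)
  refine ⟨C + C', max R R', fun z hz hn => ?_⟩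
  rw [add_div, ← sub_sub_sub_cancel_right _ _ (expSigma3 (I * vMinus q0 q x t) i j)]
  exact (norm_sub_le _ _).trans (add_le_add (h1 z hz ((le_max_left _ _).trans hn) i j)
    (h2 z hz ((le_max_right _ _).trans hn) i j))

lemma hatz_injOn (h0 : 0 < q0) {z w : ℂ} (hz : z ≠ 0) (hw : w ≠ 0) (h : hatz q0 z = hatz q0 w) :
    z = w := by rw [← hatz_hatz h0 hz, h, hatz_hatz h0 hw]

/-- The representation of the first column of `M`. -/
theorem Mrhp_zero_formula (hq : IsPotential q0 qm qp q) (hΦm : IsJostMinus q0 q qm Φm)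
    (hΦp : IsJostPlus q0 q qp Φp) (h : ScatteringRelations q0 qm qp (Φp x t) (Φm x t) S)
    (hreg : NoSpectralSingularities q0 S) (hd : HasDoubleZeros q0 S zs ws)
    (hbd : AreProportionality (discSpec q0 zs ws) Φm Φp b d) (i : Fin 2) :
    ContinuousOn (fun ζ => plusLim (Mrhp q0 Φm Φp S x t) ζ i 0
      - minusLim (Mrhp q0 Φm Φp S x t) ζ i 0) Sig ∧
    (∃ C, 0 ≤ C ∧ ∀ ζ ∈ Sig, ‖plusLim (Mrhp q0 Φm Φp S x t) ζ i 0
      - minusLim (Mrhp q0 Φm Φp S x t) ζ i 0‖ * (1 + ‖ζ‖) ≤ C) ∧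
    ∀ z ∈ Dp ∪ Dm, z ∉ range (eta q0 zs ws) →
      Mrhp q0 Φm Φp S x t z i 0 = Mlead q0 q qm x t z i 0 + 1 / (2 * (Real.pi : ℂ) * I) *
        sigInt (fun ζ => (plusLim (Mrhp q0 Φm Φp S x t) ζ i 0
          - minusLim (Mrhp q0 Φm Φp S x t) ζ i 0) / (ζ - z)) +
        ∑ n, Cco q0 x t (Acoef S b) (eta q0 zs ws n) z *
          (dcol (modJost q0 Φm x t) 1 (eta q0 zs ws n) i +
            (Dco q0 x t (Bcoef S b d) (eta q0 zs ws n) + 1 / (z - eta q0 zs ws n)) *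
              col (modJost q0 Φm x t) 1 (eta q0 zs ws n) i) := by
  -- In `D⁻` the first column of `M` is the analytic `μ₋₁`, so its only poles are the `eta` in `D⁺`;
  -- for the second column the roles of the regions are exchanged.
  have hmem := hd.eta_mem_Dp h.pos
  simp only [Cco, doublePole_eq]
  refine cauchy_formula_of_doublePoles (hd.eta_injective h.pos) (fun n => Or.inl (hmem n))
    (fun z hz hzr => differentiableAt_Mrhp_zero h hz (fun hzp hs => ?_) i)
    (fun z hz => differentiableAt_Mlead hz i 0) (fun n => ?_)
    (fun ζ hζ => tendsto_matrix.1 (tendsto_plusLim h hreg hζ) i 0)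
    (fun ζ hζ => tendsto_matrix.1 (tendsto_minusLim h hreg hζ) i 0)
    (Mrhp_sub_Mlead_atInf hq hΦm hΦp h i 0) ?_
  · obtain ⟨n, hn⟩ := h.zero_Dp hd hzp hs
    exact hzr ⟨n, hn.symm⟩
  · have := exists_tendsto_Mrhp_zero h hbd ⟨eta_mem_discSpec n, hmem n⟩ (h.order_eta hd n) i
    simpa only [Cco, doublePole_eq] using this
  · obtain ⟨C, r, hr, hb⟩ := Mrhp_bound_zero hq hΦm hΦp h
    exact ⟨C, r, hr, fun z hz hn => hb z hz hn i 0⟩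

/-- The representation of the second column of `M`. -/
theorem Mrhp_one_formula (hq : IsPotential q0 qm qp q) (hΦm : IsJostMinus q0 q qm Φm)
    (hΦp : IsJostPlus q0 q qp Φp) (h : ScatteringRelations q0 qm qp (Φp x t) (Φm x t) S)
    (hreg : NoSpectralSingularities q0 S) (hd : HasDoubleZeros q0 S zs ws)
    (hbd : AreProportionality (discSpec q0 zs ws) Φm Φp b d) (i : Fin 2) :
    ContinuousOn (fun ζ => plusLim (Mrhp q0 Φm Φp S x t) ζ i 1
      - minusLim (Mrhp q0 Φm Φp S x t) ζ i 1) Sig ∧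
    (∃ C, 0 ≤ C ∧ ∀ ζ ∈ Sig, ‖plusLim (Mrhp q0 Φm Φp S x t) ζ i 1
      - minusLim (Mrhp q0 Φm Φp S x t) ζ i 1‖ * (1 + ‖ζ‖) ≤ C) ∧
    ∀ z ∈ Dp ∪ Dm, z ∉ range (etaHat q0 zs ws) →
      Mrhp q0 Φm Φp S x t z i 1 = Mlead q0 q qm x t z i 1 + 1 / (2 * (Real.pi : ℂ) * I) *
        sigInt (fun ζ => (plusLim (Mrhp q0 Φm Φp S x t) ζ i 1
          - minusLim (Mrhp q0 Φm Φp S x t) ζ i 1) / (ζ - z)) +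
        ∑ n, CHat q0 x t (Acoef S b) (etaHat q0 zs ws n) z *
          (dcol (modJost q0 Φm x t) 0 (etaHat q0 zs ws n) i +
            (DHat q0 x t (Bcoef S b d) (etaHat q0 zs ws n) + 1 / (z - etaHat q0 zs ws n)) *
              col (modJost q0 Φm x t) 0 (etaHat q0 zs ws n) i) := by
  have hmem := fun n => hd.eta_mem_Dp h.pos n
  have hmem' : ∀ n, etaHat q0 zs ws n ∈ Dm := fun n => hatz_mem_Dm h.pos (hmem n)
  simp only [CHat, doublePole_eq]
  refine cauchy_formula_of_doublePoles (fun m n hmn => hd.eta_injective h.pos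
      (hatz_injOn h.pos (ne_zero_of_mem_Dp (hmem m)) (ne_zero_of_mem_Dp (hmem n)) hmn))
    (fun n => Or.inr (hmem' n))
    (fun z hz hzr => differentiableAt_Mrhp_one h hz (fun hzp hs => ?_) i)
    (fun z hz => differentiableAt_Mlead hz i 1) (fun n => ?_)
    (fun ζ hζ => tendsto_matrix.1 (tendsto_plusLim h hreg hζ) i 1)
    (fun ζ hζ => tendsto_matrix.1 (tendsto_minusLim h hreg hζ) i 1)
    (Mrhp_sub_Mlead_atInf hq hΦm hΦp h i 1) ?_
  · obtain ⟨n, hn⟩ := h.zero_Dm hd hzp hs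
    exact hzr ⟨n, hn.symm⟩
  · have := exists_tendsto_Mrhp_one h hbd ⟨hd.etaHat_mem_discSpec h.pos n, hmem' n⟩
      (h.order_hatz (hmem n) (h.order_eta hd n)) i
    simpa only [CHat, doublePole_eq, etaHat_eq_hatz] using this
  · obtain ⟨C, r, hr, hb⟩ := Mrhp_bound_zero hq hΦm hΦp h
    exact ⟨C, r, hr, fun z hz hn => hb z hz hn i 1⟩

/-- The third symmetry for the modified Jost solution. -/
lemma modJost_hatz (h : ScatteringRelations q0 qm qp (Φp x t) (Φm x t) S) (hz : z ∈ Dp) (i : Fin 2) :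
    modJost q0 Φm x t z i 1 = I * qm / z * modJost q0 Φm x t (hatz q0 z) i 0 := by
  rw [modJost_one, modJost_zero, h.hatN1 z hz, theta_hatz h.pos (ne_zero_of_mem_Dp hz)]
  simp only [mul_neg, neg_neg]; ring

lemma hasDerivAt_modJost_zero (h : ScatteringRelations q0 qm qp (Φp x t) (Φm x t) S) (hz : z ∈ Dm)
    (i : Fin 2) : HasDerivAt (fun w => modJost q0 Φm x t w i 0)
      (dcol (modJost q0 Φm x t) 0 z i) z := by
  refine DifferentiableAt.hasDerivAt ?_
  simp only [modJost_zero]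
  exact ((h.extN0 i).differentiableAt isOpen_Dm hz).mul
    (differentiableAt_exp_neg_theta (ne_zero_of_mem_Dm hz))

lemma hasDerivAt_modJost_one (h : ScatteringRelations q0 qm qp (Φp x t) (Φm x t) S) (hz : z ∈ Dp)
    (i : Fin 2) : HasDerivAt (fun w => modJost q0 Φm x t w i 1)
      (dcol (modJost q0 Φm x t) 1 z i) z := by
  refine DifferentiableAt.hasDerivAt ?_
  simp only [modJost_one]
  exact ((h.extN1 i).differentiableAt isOpen_Dp hz).mul
    (differentiableAt_exp_theta (ne_zero_of_mem_Dp hz))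

/-- The symmetry `modJost_hatz` holds throughout `D⁺`, so it may be differentiated; the cube comes
from the prefactor `1/z` times the derivative `q₀²/z²` of `-q₀²/z`. -/
lemma dcol_modJost_hatz (h : ScatteringRelations q0 qm qp (Φp x t) (Φm x t) S) (hz : z ∈ Dp)
    (i : Fin 2) : dcol (modJost q0 Φm x t) 1 z i =
      -(I * qm / z ^ 2) * modJost q0 Φm x t (hatz q0 z) i 0 +
        I * qm * (q0 : ℂ) ^ 2 / z ^ 3 * dcol (modJost q0 Φm x t) 0 (hatz q0 z) i := by
  have hz0 := ne_zero_of_mem_Dp hz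
  have h1 := (hasDerivAt_modJost_zero h (hatz_mem_Dm h.pos hz) i).comp z (hasDerivAt_hatz hz0)
  have h2 := ((hasDerivAt_inv hz0).const_mul (I * qm)).mul h1
  refine (hasDerivAt_modJost_one h hz i).unique ((h2.congr_deriv ?_).congr_of_eventuallyEq ?_)
  · simp only [Function.comp_apply]; field_simp
  · filter_upwards [isOpen_Dp.mem_nhds hz] with w hw
    rw [modJost_hatz h hw]; rfl

end

end DNLS

end

/-! ### The solution formula and the linear system -/

theorem mainTheorem4 (q0 : ℝ) (qm qp : ℂ) (q : ℝ → ℝ → ℂ) (hq : DNLS.IsPotential q0 qm qp q)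
    (Φm Φp : ℝ → ℝ → ℂ → DNLS.Mat)
    (hΦm : DNLS.IsJostMinus q0 q qm Φm) (hΦp : DNLS.IsJostPlus q0 q qp Φp)
    (S : ℂ → DNLS.Mat) (hS : DNLS.IsScatteringMatrix q0 Φm Φp S)
    (hreg : DNLS.NoSpectralSingularities q0 S)
    (N1 N2 : ℕ) (zs : Fin N1 → ℂ) (ws : Fin N2 → ℂ) (hzero : DNLS.HasDoubleZeros q0 S zs ws)
    (b d : ℂ → ℂ) (hbd : DNLS.AreProportionality (DNLS.discSpec q0 zs ws) Φm Φp b d)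
    (x t : ℝ) :
    let η := DNLS.eta q0 zs ws
    let ηh := DNLS.etaHat q0 zs ws
    let A := DNLS.Acoef S b
    let B := DNLS.Bcoef S b d
    let C := fun n z => DNLS.Cco q0 x t A (η n) z
    let D := fun n => DNLS.Dco q0 x t B (η n)
    let Ch := fun n z => DNLS.CHat q0 x t A (ηh n) z
    let Dh := fun n => DNLS.DHat q0 x t B (ηh n)
    let M := DNLS.Mrhp q0 Φm Φp S x t
    let MJ := fun ζ => DNLS.plusLim M ζ * DNLS.jumpJ q0 S x t ζ
    let E := DNLS.expSigma3 (I * (DNLS.vMinus q0 q x t : ℂ))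
    let m1 := fun n => DNLS.col (DNLS.modJost q0 Φm x t) 0 (ηh n)
    let m1' := fun n => DNLS.dcol (DNLS.modJost q0 Φm x t) 0 (ηh n)
    let m2 := fun n => DNLS.col (DNLS.modJost q0 Φm x t) 1 (η n)
    let m2' := fun n => DNLS.dcol (DNLS.modJost q0 Φm x t) 1 (η n)
    -- the boundary values and the integrals exist
    (∀ ζ ∈ DNLS.Sig, Tendsto M (𝓝[DNLS.Dp] ζ) (𝓝 (DNLS.plusLim M ζ))) ∧
    (∀ z ∈ DNLS.Dp ∪ DNLS.Dm, ∀ i j,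
      DNLS.SigIntegrable (fun ζ => MJ ζ i j / (ζ - z)) ∧
      DNLS.SigIntegrable (fun ζ => MJ ζ i j / (ζ - z) ^ 2)) ∧
    -- the solution formula
    (∀ z ∈ (DNLS.Dp ∪ DNLS.Dm) \ DNLS.discSpec q0 zs ws,
      M z = E * (1 + (I / z) • (DNLS.sigma3 * DNLS.potMat qm))
        + (1 / (2 * (Real.pi : ℂ) * I)) •
            Matrix.of (fun i j => DNLS.sigInt (fun ζ => MJ ζ i j / (ζ - z)))
        + ∑ n, DNLS.colPair
            (C n z • (m2' n + (D n + 1 / (z - η n)) • m2 n))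
            (Ch n z • (m1' n + (Dh n + 1 / (z - ηh n)) • m1 n))) ∧
    -- the third symmetry at the points of the discrete spectrum
    (∀ n, m2 n = (I * qm / η n) • m1 n) ∧
    (∀ n, m2' n = -(I * qm / η n ^ 2) • m1 n + (I * qm * (q0 : ℂ) ^ 2 / η n ^ 3) • m1' n) ∧
    -- the linear system
    (∀ k, ∑ n, (Ch n (η k) • m1' n
          + (Ch n (η k) * (Dh n + 1 / (η k - ηh n)) - (if k = n then I * qm / η k else 0)) • m1 n)
        = -(E.mulVec ![I * qm / η k, 1])
          - (1 / (2 * (Real.pi : ℂ) * I)) •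
              (fun i => DNLS.sigInt (fun ζ => MJ ζ i 1 / (ζ - η k)))) ∧
    (∀ k, ∑ n, ((Ch n (η k) / (η k - ηh n)
              + (if k = n then I * qm * (q0 : ℂ) ^ 2 / η k ^ 3 else 0)) • m1' n
          + (Ch n (η k) / (η k - ηh n) * (Dh n + 2 / (η k - ηh n))
              - (if k = n then I * qm / η k ^ 2 else 0)) • m1 n)
        = -(E.mulVec ![I * qm / η k ^ 2, 0])
          + (1 / (2 * (Real.pi : ℂ) * I)) •
              (fun i => DNLS.sigInt (fun ζ => MJ ζ i 1 / (ζ - η k) ^ 2))) := by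
  intro η ηh A B C D Ch Dh M MJ E m1 m1' m2 m2'
  have h := DNLS.scatteringRelations hq.pos hq.norm_minus hq.norm_plus hΦm hΦp hS x t
  have f0 := DNLS.Mrhp_zero_formula hq hΦm hΦp h hreg hzero hbd
  have f1 := DNLS.Mrhp_one_formula hq hΦm hΦp h hreg hzero hbd
  -- The density `M⁺J` of the formula agrees with the jump `M⁺ - M⁻` off the branch points, which
  -- suffices under the integral.
  have hJ : ∀ i j (g : ℂ → ℂ), EqOn
      (fun ζ => (DNLS.plusLim M ζ i j - DNLS.minusLim M ζ i j) / g ζ)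
      (fun ζ => MJ ζ i j / g ζ) (DNLS.Sig \ DNLS.branch q0) := fun i j g ζ hζ =>
    congrArg (· / g ζ) (DNLS.plusLim_mul_jumpJ h hreg hζ i j).symm
  have hη : ∀ n, η n ∈ DNLS.Dp := hzero.eta_mem_Dp h.pos
  have hηh : ∀ n, ηh n ∈ DNLS.Dm := fun n => DNLS.hatz_mem_Dm h.pos (hη n)
  -- The poles of the second column lie in `D⁻`, so its representation may be evaluated and
  -- differentiated at the points `η k` of `D⁺`.
  have hηne : ∀ k, η k ∉ range ηh := by
    rintro k ⟨n, hn⟩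
    exact DNLS.Dm_not_Dp (hηh n) (hn ▸ hη k)
  have hM1 : ∀ i, ∀ z ∈ DNLS.Dp, M z i 1 = DNLS.modJost q0 Φm x t z i 1 := fun i z hz =>
    (DNLS.Mrhp_one_Dp hz i).trans (DNLS.modJost_one Φm z i).symm
  have s1 : ∀ n, m2 n = (I * qm / η n) • m1 n := fun n => by
    ext i
    exact DNLS.modJost_hatz h (hη n) i
  have s2 : ∀ n, m2' n = -(I * qm / η n ^ 2) • m1 n
      + (I * qm * (q0 : ℂ) ^ 2 / η n ^ 3) • m1' n := fun n => by
    ext i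
    exact DNLS.dcol_modJost_hatz h (hη n) i
  have hform : ∀ i, ∀ z ∈ DNLS.Dp ∪ DNLS.Dm, z ∉ range ηh →
      M z i 1 = DNLS.Mlead q0 q qm x t z i 1 + 1 / (2 * (Real.pi : ℂ) * I) *
        DNLS.sigInt (fun ζ => MJ ζ i 1 / (ζ - z)) +
        ∑ n, Ch n z * (m1' n i + (Dh n + 1 / (z - ηh n)) * m1 n i) := fun i z hz hzr => by
    refine ((f1 i).2.2 z hz hzr).trans ?_
    rw [DNLS.sigInt_congr h.pos (hJ i 1 fun ζ => ζ - z)]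
  refine ⟨fun ζ hζ => DNLS.tendsto_plusLim h hreg hζ, fun z hz i j => ?_, fun z hz => ?_, s1, s2,
    fun k => ?_, fun k => ?_⟩
  · have key : ContinuousOn (fun ζ => DNLS.plusLim M ζ i j - DNLS.minusLim M ζ i j) DNLS.Sig ∧
        ∃ C, 0 ≤ C ∧ ∀ ζ ∈ DNLS.Sig,
          ‖DNLS.plusLim M ζ i j - DNLS.minusLim M ζ i j‖ * (1 + ‖ζ‖) ≤ C := by
      fin_cases j
      · exact ⟨(f0 i).1, (f0 i).2.1⟩
      · exact ⟨(f1 i).1, (f1 i).2.1⟩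
    obtain ⟨k1, K, -, k2⟩ := key
    exact ⟨(DNLS.sigIntegrable_kernel k1 k2 hz).congr h.pos (hJ i j fun ζ => ζ - z),
      (DNLS.sigIntegrable_kernel_sq k1 k2 hz).congr h.pos (hJ i j fun ζ => (ζ - z) ^ 2)⟩
  · have z1 : z ∉ range η := by
      rintro ⟨n, rfl⟩; exact hz.2 (DNLS.eta_mem_discSpec n)
    have z2 : z ∉ range ηh := by
      rintro ⟨n, rfl⟩; exact hz.2 (hzero.etaHat_mem_discSpec h.pos n)
    ext i j
    rw [Matrix.add_apply, Matrix.add_apply, Matrix.smul_apply, Matrix.of_apply, Matrix.sum_apply]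
    fin_cases j
    · refine ((f0 i).2.2 z hz.1 z1).trans ?_
      rw [DNLS.sigInt_congr h.pos (hJ i 0 fun ζ => ζ - z)]
      rfl
    · exact hform i z hz.1 z2
  · ext i
    -- At `η k` the second column of `M` is `μ₋₂`, which the third symmetry expresses through `m1
    -- k`; moved to the other side this becomes the Kronecker delta term.
    have e : I * qm / η k * m1 k i = _ := (DNLS.modJost_hatz h (hη k) i).symm.trans
      ((hM1 i _ (hη k)).symm.trans (hform i (η k) (Or.inl (hη k)) (hηne k)))
    have e2 : DNLS.Mlead q0 q qm x t (η k) i 1 = E.mulVec ![I * qm / η k, 1] i := by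
      fin_cases i
      · simp [DNLS.Mlead_one, E, DNLS.expSigma3, Matrix.mulVec, dotProduct]
      · simp [DNLS.Mlead_one, E, DNLS.expSigma3, Matrix.mulVec, dotProduct]
    rw [e2] at e
    have e3 : ∑ n, (if k = n then I * qm / η k else 0) * m1 n i = I * qm / η k * m1 k i := by
      simp
    simp only [Finset.sum_apply, Pi.add_apply, Pi.smul_apply, smul_eq_mul, Pi.sub_apply,
      Pi.neg_apply]
    rw [show ∑ n, (Ch n (η k) * m1' n i + (Ch n (η k) * (Dh n + 1 / (η k - ηh n))
        - (if k = n then I * qm / η k else 0)) * m1 n i) =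
        ∑ n, Ch n (η k) * (m1' n i + (Dh n + 1 / (η k - ηh n)) * m1 n i) -
          ∑ n, (if k = n then I * qm / η k else 0) * m1 n i by
      rw [← Finset.sum_sub_distrib]; exact Finset.sum_congr rfl fun n _ => by ring, e3]
    linear_combination -e
  · ext i
    obtain ⟨k1, ⟨K, -, k2⟩, -⟩ := f1 i
    have d1 := DNLS.hasDerivAt_Mlead_one (q0 := q0) (x := x) (t := t) (qm := qm) (q := q)
      (DNLS.ne_zero_of_mem_Dp (hη k)) i
    have d2 := DNLS.hasDerivAt_sigInt_kernel k1 k2 (Or.inl (hη k))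
    rw [DNLS.sigInt_congr h.pos (hJ i 1 fun ζ => (ζ - η k) ^ 2)] at d2
    have d3 : HasDerivAt (fun z => ∑ n, Ch n z * (m1' n i + (Dh n + 1 / (z - ηh n)) * m1 n i))
        (∑ n, -(Ch n (η k) / (η k - ηh n) *
          (m1' n i + (Dh n + 2 / (η k - ηh n)) * m1 n i))) (η k) := by
      refine HasDerivAt.fun_sum fun n _ => ?_
      have hne : η k ≠ ηh n := fun hh => hηne k ⟨n, hh.symm⟩
      have hne' : η k - ηh n ≠ 0 := sub_ne_zero.2 hne
      simp only [Ch, DNLS.CHat, DNLS.doublePole_eq]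
      refine (DNLS.hasDerivAt_doublePole hne).congr_deriv ?_
      field_simp
      ring
    have d4 := (d1.add (d2.const_mul (1 / (2 * (Real.pi : ℂ) * I)))).add d3
    -- The representation of `μ₋₂` holds on a neighbourhood of `η k`, so both sides have the same
    -- derivative there; the left one is then rewritten by the differentiated third symmetry.
    have d5 := d4.congr_of_eventuallyEq (f₁ := fun z => DNLS.modJost q0 Φm x t z i 1) (by
      filter_upwards [DNLS.isOpen_Dp.mem_nhds (hη k)] with z hz
      have z2 : z ∉ range ηh := by
        rintro ⟨n, rfl⟩; exact DNLS.Dm_not_Dp (hηh n) hz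
      rw [← hM1 i z hz, hform i z (Or.inl hz) z2]
      simp only [Pi.add_apply]
      rw [DNLS.sigInt_congr h.pos (hJ i 1 fun ζ => ζ - z)])
    have e : m2' k i = _ := d5.deriv
    rw [s2 k] at e
    have e3 : ∑ n, (if k = n then I * qm * (q0 : ℂ) ^ 2 / η k ^ 3 else 0) * m1' n i =
        I * qm * (q0 : ℂ) ^ 2 / η k ^ 3 * m1' k i := by simp
    have e4 : ∑ n, (if k = n then I * qm / η k ^ 2 else 0) * m1 n i =
        I * qm / η k ^ 2 * m1 k i := by simp
    simp only [Finset.sum_apply, Pi.add_apply, Pi.smul_apply, smul_eq_mul, Pi.neg_apply] at e ⊢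
    rw [Finset.sum_neg_distrib] at e
    rw [show ∑ n, ((Ch n (η k) / (η k - ηh n)
          + (if k = n then I * qm * (q0 : ℂ) ^ 2 / η k ^ 3 else 0)) * m1' n i
          + (Ch n (η k) / (η k - ηh n) * (Dh n + 2 / (η k - ηh n))
              - (if k = n then I * qm / η k ^ 2 else 0)) * m1 n i) =
        ∑ n, Ch n (η k) / (η k - ηh n) * (m1' n i + (Dh n + 2 / (η k - ηh n)) * m1 n i) +
          ∑ n, (if k = n then I * qm * (q0 : ℂ) ^ 2 / η k ^ 3 else 0) * m1' n i -
          ∑ n, (if k = n then I * qm / η k ^ 2 else 0) * m1 n i by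
      rw [← Finset.sum_add_distrib, ← Finset.sum_sub_distrib]
      exact Finset.sum_congr rfl fun n _ => by ring, e3, e4]
    linear_combination e
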